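/- **Theorem 3.1.** Let $R$ be a commutative ring, let $A$ be a commutative $R$-algebra, and let $(A,L',L'')$ be a twilled Lie-Rinehart algebra over $R$: $(A,L')$ and $(A,L'')$ are Lie-Rinehart algebras with mutual actions $L'\otimes_R L''\to L''$ and $L''\otimes_R L'\to L'$ that make $L''$ an $(A,L')$-module and $L'$ an $(A,L'')$-module, such that the $A$-module $L=L'\oplus L''$, with the sum of the actions on $A$ and the bracket $$[(\alpha'',\alpha'),(\beta'',\beta')]=[\alpha'',\beta'']+[\alpha',\beta']+\alpha''\cdot\beta'-\beta'\cdot\alpha''+\alpha'\cdot\beta''-\beta''\cdot\alpha',$$ is a Lie-Rinehart algebra, the *twilled sum*. Suppose that $L'$ and $L''$ are finitely generated projective $A$-modules. Let $\mathcal A''=\mathrm{Alt}_A(L'',A)$ and $\mathcal L'=\mathrm{Alt}_A(L'',L')$, with the Lie-Rinehart differentials $d''$ of $L''$ (with coefficients in $A$ and in $L'$), the action of $\mathcal L'\cong\mathcal A''\otimes_A L'$ on $\mathcal A''$ given by $(\alpha\otimes x)(\beta)=\alpha\,x(\beta)$, and the crossed product bracket $$[\alpha\otimes x,\beta\otimes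 y]=(\alpha\beta)\otimes[x,y]+\alpha\,x(\beta)\otimes y-(-1)^{|\alpha||\beta|}\beta\,y(\alpha)\otimes x ,$$ where $\alpha,\beta\in\mathcal A''$, $x,y\in L'$, and $L'$ acts on $\mathcal A''$ through its actions on $L''$ and $A$ (Lie derivative). The differential graded Lie-Rinehart cohomology $\mathrm H^*(\mathcal L',\mathcal A'')$ is the cohomology of the standard complex $\mathrm{Alt}_{\mathcal A''}(\mathcal L',\mathcal A'')$ of graded alternating $\mathcal A''$-multilinear maps, in the total grading, with the sum of the graded Cartan-Chevalley-Eilenberg differential and, up to sign, the differential induced by $d''$. The Lie-Rinehart cohomology $\mathrm H^*(L,A)$ is the cohomology of $\mathrm{Alt}_A(L,A)$ with the Lie-Rinehart differential. On $\mathrm{Alt}_A^q(L'',\mathrm{Alt}_A^p(L',A))$ let $d''$ be the Lie-Rinehart differential of $L''$ with coefficients in the $(A,L'')$-module $\mathrm{Alt}_A^p(L',A)$, and let $d'$ be the Lie-Rinehart differential of $L'$ with coefficients in the $(A,L')$-module $\mathrm{Alt}_A^q(L'',A)$, transported along $\mathrm{Alt}_A^q(L'',\mathrm{Alt}_A^p(L',A))\cong\mathrm{Alt}_A^p(L',\mathrm{Alt}_A^q(L'',A))$.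 Then these three objects are cochain complexes, the first with the total differential $d'+(-1)^p d''$, and: 1. The bigraded complex $(\mathrm{Alt}_A(L'',\mathrm{Alt}_A(L',A)),d',d'')$ computes $\mathrm H^*(\mathcal L',\mathcal A'')$: there is a degree-preserving $R$-linear isomorphism from it, in the total grading, onto $\mathrm{Alt}_{\mathcal A''}(\mathcal L',\mathcal A'')$ that sends $F$ to the $f$ with $f(x_1,\dots,x_p)(v_1,\dots,v_q)=F(v_1,\dots,v_q)(x_1,\dots,x_p)$ for $x_i\in L'$, $v_j\in L''$; it commutes with the differentials and induces an isomorphism in cohomology. 2. $\mathrm H^*(\mathcal L',\mathcal A'')$ is naturally isomorphic to $\mathrm H^*(L,A)$: there is a degree-preserving $R$-linear isomorphism from $\mathrm{Alt}_{\mathcal A''}(\mathcal L',\mathcal A'')$, in the total grading, onto $\mathrm{Alt}_A(L,A)$ that sends $f$ to the $\omega$ with $\omega(x_1,\dots,x_p,v_1,\dots,v_q)=f(x_1,\dots,x_p)(v_1,\dots,v_q)$; it commutes with the differentials and induces the isomorphism in cohomology. -/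

import Mathlib

set_option linter.unusedSectionVars false
set_option linter.unnecessarySeqFocus false

open Finset Function

/-! ## Lie-Rinehart modules and twilled Lie-Rinehart algebras -/

/-- `M` is an `(A, L)`-module: an `A`-module with an action of the Lie ring `L` such that
`(a x) m = a (x m)` and `x (a m) = a (x m) + x(a) m`. -/
class LieRinehartModule (A L M : Type*) [CommRing A] [LieRing L] [Module A L] [LieRingModule L A]
    [AddCommGroup M] [Module A M] [LieRingModule L M] : Prop where
  smul_lie' (a : A) (x : L) (m : M) : ⁅a • x, m⁆ = a • ⁅x, m⁆
  lie_smul' (x : L) (a : A) (m : M) : ⁅x, a • m⁆ = a • ⁅x, m⁆ + ⁅x, a⁆ • m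

instance LieRinehartModule.self (A L : Type*) [CommRing A] [LieRing L] [Module A L]
    [LieRingModule L A] [LieRinehartRing A L] : LieRinehartModule A L A where
  smul_lie' a x m := by simp
  lie_smul' x a m := by simp

/-- The underlying `A`-module `L' ⊕ L''` of the twilled sum. -/
def TwilledSum (_A L' L'' : Type*) : Type _ := L' × L''

namespace TwilledSum

section basic

variable {R A L' L'' : Type*} [CommRing R] [CommRing A] [AddCommGroup L'] [AddCommGroup L'']
  [Module A L'] [Module A L''] [Algebra R A] [Module R L'] [Module R L'']

instance : AddCommGroup (TwilledSum A L' L'') := inferInstanceAs (AddCommGroup (L' × L''))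

instance : Module R (TwilledSum A L' L'') := inferInstanceAs (Module R (L' × L''))

instance [IsScalarTower R A L'] [IsScalarTower R A L''] :
    IsScalarTower R A (TwilledSum A L' L'') :=
  inferInstanceAs (IsScalarTower R A (L' × L''))

/-- The inclusion of `L'`. -/
def inl (x : L') : TwilledSum A L' L'' := ((x, 0) : L' × L'')

/-- The inclusion of `L''`. -/
def inr (v : L'') : TwilledSum A L' L'' := ((0, v) : L' × L'')

end basic

section bracket

variable {A L' L'' : Type*} [CommRing A] [LieRing L'] [LieRing L''] [Module A L'] [Module A L'']
  [LieRingModule L' A] [LieRingModule L'' A] [LieRingModule L' L''] [LieRingModule L'' L']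

/-- The bracket
`[(x, v), (y, w)] = [x, y] + [v, w] + v · y - y · v + x · w - w · x` on `L' ⊕ L''`, where
`x · w ∈ L''` and `v · y ∈ L'` are the mutual actions. -/
def bracket (z w : TwilledSum A L' L'') : TwilledSum A L' L'' :=
  ((⁅z.1, w.1⁆ + ⁅z.2, w.1⁆ - ⁅w.2, z.1⁆, ⁅z.2, w.2⁆ + ⁅z.1, w.2⁆ - ⁅w.1, z.2⁆) : L' × L'')

/-- The sum of the actions of `L'` and `L''` on `A`. -/
def anchor (z : TwilledSum A L' L'') (a : A) : A := ⁅z.1, a⁆ + ⁅z.2, a⁆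

end bracket

end TwilledSum

/-- The almost twilled Lie-Rinehart algebra `(A, L', L'')` (two Lie-Rinehart algebras with mutual
module structures) is twilled: `L' ⊕ L''` with the sum bracket and the sum of the actions on `A`
satisfies the axioms of a Lie-Rinehart algebra. -/
class IsTwilled (A L' L'' : Type*) [CommRing A] [LieRing L'] [LieRing L'']
    [Module A L'] [Module A L''] [LieRingModule L' A] [LieRingModule L'' A]
    [LieRingModule L' L''] [LieRingModule L'' L'] : Prop where
  bracket_self (x : TwilledSum A L' L'') : x.bracket x = 0
  jacobi (x y z : TwilledSum A L' L'') :
    x.bracket (y.bracket z) = (x.bracket y).bracket z + y.bracket (x.bracket z)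
  anchor_bracket (x y : TwilledSum A L' L'') (a : A) :
    (x.bracket y).anchor a = x.anchor (y.anchor a) - y.anchor (x.anchor a)
  bracket_smul (x y : TwilledSum A L' L'') (a : A) :
    x.bracket (a • y) = a • x.bracket y + x.anchor a • y

namespace TwilledSum

section instances

variable {R A L' L'' : Type*} [CommRing R] [CommRing A] [Algebra R A]
  [LieRing L'] [LieRing L''] [Module A L'] [Module A L'']
  [LieRingModule L' A] [LieRingModule L'' A] [LieRingModule L' L''] [LieRingModule L'' L']

instance [IsTwilled A L' L''] : LieRing (TwilledSum A L' L'') where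
  bracket := bracket
  add_lie x y z := by
    change bracket (x + y) z = bracket x z + bracket y z
    have h1 : (x + y).1 = x.1 + y.1 := rfl
    have h2 : (x + y).2 = x.2 + y.2 := rfl
    apply Prod.ext
    · change _ = (bracket x z).1 + (bracket y z).1
      simp only [bracket, h1, h2, add_lie, lie_add]; abel
    · change _ = (bracket x z).2 + (bracket y z).2
      simp only [bracket, h1, h2, add_lie, lie_add]; abel
  lie_add x y z := by
    change bracket x (y + z) = bracket x y + bracket x z
    have h1 : (y + z).1 = y.1 + z.1 := rfl
    have h2 : (y + z).2 = y.2 + z.2 := rfl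
    apply Prod.ext
    · change _ = (bracket x y).1 + (bracket x z).1
      simp only [bracket, h1, h2, add_lie, lie_add]; abel
    · change _ = (bracket x y).2 + (bracket x z).2
      simp only [bracket, h1, h2, add_lie, lie_add]; abel
  lie_self := IsTwilled.bracket_self
  leibniz_lie x y z := IsTwilled.jacobi x y z

instance [LieAlgebra R L'] [LieAlgebra R L''] [LieModule R L' L''] [LieModule R L'' L']
    [IsTwilled A L' L''] : LieAlgebra R (TwilledSum A L' L'') where
  lie_smul r x y := by
    change bracket x (r • y) = r • bracket x y
    have h1 : (r • y).1 = r • y.1 := rfl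
    have h2 : (r • y).2 = r • y.2 := rfl
    apply Prod.ext
    · change _ = r • (bracket x y).1
      simp only [bracket, h1, h2, smul_lie, lie_smul, smul_add, smul_sub]
    · change _ = r • (bracket x y).2
      simp only [bracket, h1, h2, smul_lie, lie_smul, smul_add, smul_sub]

instance [IsTwilled A L' L''] : LieRingModule (TwilledSum A L' L'') A where
  bracket := anchor
  add_lie x y a := by
    change ⁅x.1 + y.1, a⁆ + ⁅x.2 + y.2, a⁆ = (⁅x.1, a⁆ + ⁅x.2, a⁆) + (⁅y.1, a⁆ + ⁅y.2, a⁆)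
    simp only [add_lie]; abel
  lie_add x a b := by
    change ⁅x.1, a + b⁆ + ⁅x.2, a + b⁆ = (⁅x.1, a⁆ + ⁅x.2, a⁆) + (⁅x.1, b⁆ + ⁅x.2, b⁆)
    simp only [lie_add]; abel
  leibniz_lie x y a := by
    change x.anchor (y.anchor a) = (x.bracket y).anchor a + y.anchor (x.anchor a)
    rw [IsTwilled.anchor_bracket]; abel

instance [LieRinehartRing A L'] [LieRinehartRing A L''] [IsTwilled A L' L''] :
    LieRinehartRing A (TwilledSum A L' L'') where
  lie_smul_eq_mul' a b x := by
    change ⁅a • x.1, b⁆ + ⁅a • x.2, b⁆ = a * (⁅x.1, b⁆ + ⁅x.2, b⁆)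
    simp [mul_add]
  leibniz_mul_right' x a b := by
    change ⁅x.1, a * b⁆ + ⁅x.2, a * b⁆ =
      a • (⁅x.1, b⁆ + ⁅x.2, b⁆) + (⁅x.1, a⁆ + ⁅x.2, a⁆) * b
    simp only [LieRinehartRing.leibniz_mul_right, smul_add, add_mul]; abel
  leibniz_smul_right' x y a := IsTwilled.bracket_smul x y a

instance [LieAlgebra R L'] [LieAlgebra R L''] [LieModule R L' L''] [LieModule R L'' L']
    [LieRinehartRing A L'] [LieRinehartRing A L''] [LieRinehartAlgebra R A L']
    [LieRinehartAlgebra R A L''] [IsTwilled A L' L''] :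
    LieRinehartAlgebra R A (TwilledSum A L' L'') where
  smul_lie r x a := by
    change ⁅r • x.1, a⁆ + ⁅r • x.2, a⁆ = r • (⁅x.1, a⁆ + ⁅x.2, a⁆)
    simp [smul_add]
  lie_smul r x a := by
    change ⁅x.1, r • a⁆ + ⁅x.2, r • a⁆ = r • (⁅x.1, a⁆ + ⁅x.2, a⁆)
    rw [LieModule.lie_smul r x.1 a, LieModule.lie_smul r x.2 a, smul_add]

end instances

end TwilledSum

/-! ## Alternating forms -/

section bundling

variable {A V M : Type*} [CommRing A] [AddCommGroup V] [Module A V] [AddCommGroup M] [Module A M]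
  {n : ℕ}

theorem comp_swap_of_adjacent (f : (Fin n → V) → M)
    (hadd : ∀ v i x y, f (update v i (x + y)) = f (update v i x) + f (update v i y))
    (hadj : ∀ v (i j : Fin n), (j : ℕ) = i + 1 → v i = v j → f v = 0)
    (v : Fin n → V) (i j : Fin n) (h : (j : ℕ) = i + 1) :
    f (v ∘ Equiv.swap i j) = - f v := by
  have hij : i ≠ j := fun e => by subst e; omega
  have key : ∀ x y, f (update (update v i x) j y) = - f (update (update v i y) j x) := by
    intro x y
    have h0 : f (update (update v i (x + y)) j (x + y)) = 0 :=
      hadj _ i j h (by simp [hij])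
    have hx : f (update (update v i x) j x) = 0 := hadj _ i j h (by simp [hij])
    have hy : f (update (update v i y) j y) = 0 := hadj _ i j h (by simp [hij])
    have c : ∀ z w, update (update v i z) j w = update (update v j w) i z :=
      fun z w => update_comm hij z w v
    rw [hadd, c, c, hadd, hadd, ← c, ← c, ← c, ← c, hx, hy] at h0
    rw [eq_neg_iff_add_eq_zero]
    simpa [add_comm] using h0
  have h1 : v ∘ Equiv.swap i j = update (update v i (v j)) j (v i) := by
    funext k
    by_cases hk : k = i
    · subst hk; simp [hij]
    · by_cases hk' : k = j
      · subst hk'; simp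
      · simp [hk, hk', Equiv.swap_apply_of_ne_of_ne]
  rw [h1, key]; simp

/-- A function of `n` variables that is additive in every variable, homogeneous in the last one
and zero whenever two neighbouring arguments agree, as an alternating map. -/
def AlternatingMap.ofAdjacent (f : (Fin n → V) → M)
    (hadd : ∀ v i x y, f (update v i (x + y)) = f (update v i x) + f (update v i y))
    (hadj : ∀ v (i j : Fin n), (j : ℕ) = i + 1 → v i = v j → f v = 0)
    (hsmul : ∀ v (i : Fin n) (a : A) x, (i : ℕ) + 1 = n →
      f (update v i (a • x)) = a • f (update v i x)) : V [⋀^Fin n]→ₗ[A] M where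
  toFun := f
  map_update_add' {inst} v i x y := by
    obtain rfl : inst = instDecidableEqFin n := Subsingleton.elim _ _
    exact hadd v i x y
  map_update_smul' {inst} v i a x := by
    obtain rfl : inst = instDecidableEqFin n := Subsingleton.elim _ _
    have key : ∀ (d : ℕ) (v : Fin n → V) (i : Fin n), (i : ℕ) + 1 + d = n →
        f (update v i (a • x)) = a • f (update v i x) := by
      intro d
      induction d with
      | zero => intro v i h; exact hsmul v i a x h
      | succ d ih =>
        intro v i h
        obtain ⟨j, hj⟩ : ∃ j : Fin n, (j : ℕ) = i + 1 := ⟨⟨i + 1, by omega⟩, rfl⟩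
        have e : ∀ y, f (update v i y) = - f (update (v ∘ Equiv.swap i j) j y) := by
          intro y
          rw [← comp_swap_of_adjacent f hadd hadj _ i j hj]
          congr 1
          funext k
          by_cases hk : k = i
          · subst hk; simp
          · by_cases hk' : k = j
            · subst hk'
              have : i ≠ k := fun e => hk e.symm
              simp [this, hk]
            · simp [hk, hk', Equiv.swap_apply_of_ne_of_ne]
        rw [e, e, ih _ j (by omega), smul_neg]
    exact key (n - (i + 1)) v i (by omega)
  map_eq_zero_of_eq' v i j hv hij := by
    have key : ∀ (d : ℕ) (v : Fin n → V) (i j : Fin n), (j : ℕ) = i + 1 + d → v i = v j →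
        f v = 0 := by
      intro d
      induction d with
      | zero => intro v i j h hv; exact hadj v i j h hv
      | succ d ih =>
        intro v i j h hv
        obtain ⟨k, hk⟩ : ∃ k : Fin n, (k : ℕ) + 1 = j := ⟨⟨j - 1, by omega⟩, by simp; omega⟩
        have h1 := comp_swap_of_adjacent f hadd hadj v k j hk.symm
        rw [ih (v ∘ Equiv.swap k j) i k (by omega)] at h1
        · exact neg_eq_zero.mp h1.symm
        · have h2 : i ≠ k := fun e => by subst e; omega
          have h3 : i ≠ j := fun e => by subst e; omega
          simp [Equiv.swap_apply_of_ne_of_ne h2 h3, hv]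
    rcases lt_or_gt_of_ne hij with h | h
    · exact key (j - (i + 1)) v i j (by omega) hv
    · exact key (i - (j + 1)) v j i (by omega) hv.symm

end bundling

section lieDerivative

theorem AlternatingMap.update_add_update_eq_zero {A V M ι : Type*} [CommRing A] [AddCommGroup V]
    [Module A V] [AddCommGroup M] [Module A M] [DecidableEq ι] (ω : V [⋀^ι]→ₗ[A] M) (v : ι → V)
    {i j : ι} (hij : i ≠ j) (h : v i = v j) (z : V) :
    ω (update v i z) + ω (update v j z) = 0 := by
  have e : update v j z = update v i z ∘ Equiv.swap i j := by
    funext k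
    by_cases hk : k = i
    · subst hk; simp [hij, hij.symm, h]
    · by_cases hk' : k = j
      · subst hk'; simp
      · simp [hk, hk', Equiv.swap_apply_of_ne_of_ne]
  rw [e, add_comm]
  exact ω.map_swap_add _ hij

variable {R A L V M : Type*} [CommRing R] [CommRing A] [LieRing L] [Module A L] [LieRingModule L A]
  [AddCommGroup V] [Module A V] [LieRingModule L V] [LieRinehartModule A L V]
  [AddCommGroup M] [Module A M] [LieRingModule L M] [LieRinehartModule A L M] {n : ℕ}

/-- The Lie derivative
`(x ω)(v₁, …, vₙ) = x (ω(v₁, …, vₙ)) - ∑ⱼ ω(v₁, …, x vⱼ, …, vₙ)` of an `M`-valued form on `V`,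
where `V` and `M` are `(A, L)`-modules. -/
def lieDerivative (x : L) (ω : V [⋀^Fin n]→ₗ[A] M) : V [⋀^Fin n]→ₗ[A] M where
  toFun v := ⁅x, ω v⁆ - ∑ j, ω (update v j ⁅x, v j⁆)
  map_update_add' {inst} v i y z := by
    obtain rfl : inst = instDecidableEqFin n := Subsingleton.elim _ _
    have : ∀ k, ω (update (update v i (y + z)) k ⁅x, update v i (y + z) k⁆) =
        ω (update (update v i y) k ⁅x, update v i y k⁆) +
        ω (update (update v i z) k ⁅x, update v i z k⁆) := by
      intro k
      by_cases hk : k = i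
      · subst hk; simp
      · simp only [update_of_ne hk]
        rw [update_comm (Ne.symm hk), update_comm (Ne.symm hk), update_comm (Ne.symm hk),
          ω.map_update_add]
    simp only [this, sum_add_distrib, ω.map_update_add, lie_add]
    abel
  map_update_smul' {inst} v i a y := by
    obtain rfl : inst = instDecidableEqFin n := Subsingleton.elim _ _
    have : ∀ k, ω (update (update v i (a • y)) k ⁅x, update v i (a • y) k⁆) =
        a • ω (update (update v i y) k ⁅x, update v i y k⁆) +
        if k = i then ⁅x, a⁆ • ω (update v i y) else 0 := by
      intro k
      by_cases hk : k = i
      · subst hk; simp [LieRinehartModule.lie_smul']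
      · simp only [update_of_ne hk, if_neg hk, add_zero]
        rw [update_comm (Ne.symm hk), update_comm (Ne.symm hk), ω.map_update_smul]
    simp only [this, sum_add_distrib, ω.map_update_smul, LieRinehartModule.lie_smul', smul_sub,
      smul_sum, sum_ite_eq', mem_univ, if_true]
    abel
  map_eq_zero_of_eq' v i j h hij := by
    have h1 : ∑ k, ω (update v k ⁅x, v k⁆) = 0 := by
      rw [← sum_subset (subset_univ {i, j}), sum_pair hij, ← h]
      · exact ω.update_add_update_eq_zero v hij h _
      · intro k _ hk
        simp only [mem_insert, mem_singleton, not_or] at hk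
        exact ω.map_eq_zero_of_eq _
          (by rw [update_of_ne (Ne.symm hk.1), update_of_ne (Ne.symm hk.2), h]) hij
    rw [h1, ω.map_eq_zero_of_eq v h hij]; simp

/-- Forms on `V` with values in `M` are acted upon by `L` through the Lie derivative. -/
instance : LieRingModule L (V [⋀^Fin n]→ₗ[A] M) where
  bracket := lieDerivative
  add_lie x y ω := by
    ext v
    change ⁅x + y, ω v⁆ - ∑ j, ω (update v j ⁅x + y, v j⁆) =
      (⁅x, ω v⁆ - ∑ j, ω (update v j ⁅x, v j⁆)) + (⁅y, ω v⁆ - ∑ j, ω (update v j ⁅y, v j⁆))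
    simp only [add_lie, ω.map_update_add, sum_add_distrib]; abel
  lie_add x ω η := by
    ext v
    change ⁅x, ω v + η v⁆ - ∑ j, (ω (update v j ⁅x, v j⁆) + η (update v j ⁅x, v j⁆)) =
      (⁅x, ω v⁆ - ∑ j, ω (update v j ⁅x, v j⁆)) + (⁅x, η v⁆ - ∑ j, η (update v j ⁅x, v j⁆))
    simp only [lie_add, sum_add_distrib]; abel
  leibniz_lie x y ω := by
    ext v
    change ⁅x, ⁅y, ω v⁆ - ∑ j, ω (update v j ⁅y, v j⁆)⁆ -
        ∑ k, (⁅y, ω (update v k ⁅x, v k⁆)⁆ -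
          ∑ j, ω (update (update v k ⁅x, v k⁆) j ⁅y, update v k ⁅x, v k⁆ j⁆)) =
      (⁅⁅x, y⁆, ω v⁆ - ∑ j, ω (update v j ⁅⁅x, y⁆, v j⁆)) +
        (⁅y, ⁅x, ω v⁆ - ∑ j, ω (update v j ⁅x, v j⁆)⁆ -
        ∑ k, (⁅x, ω (update v k ⁅y, v k⁆)⁆ -
          ∑ j, ω (update (update v k ⁅y, v k⁆) j ⁅x, update v k ⁅y, v k⁆ j⁆)))
    have key : ∑ k, ∑ j, ω (update (update v k ⁅x, v k⁆) j ⁅y, update v k ⁅x, v k⁆ j⁆) +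
        ∑ j, ω (update v j ⁅⁅x, y⁆, v j⁆) =
        ∑ k, ∑ j, ω (update (update v k ⁅y, v k⁆) j ⁅x, update v k ⁅y, v k⁆ j⁆) := by
      conv_rhs => rw [sum_comm]
      have h1 : ∀ k j, ω (update (update v k ⁅x, v k⁆) j ⁅y, update v k ⁅x, v k⁆ j⁆) +
          (if k = j then ω (update v j ⁅⁅x, y⁆, v j⁆) else 0) =
          ω (update (update v j ⁅y, v j⁆) k ⁅x, update v j ⁅y, v j⁆ k⁆) := by
        intro k j
        by_cases hk : k = j
        · subst hk
          simp only [update_self, update_idem, if_true]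
          rw [← ω.map_update_add, leibniz_lie x y (v k), add_comm]
        · simp only [update_of_ne hk, update_of_ne (Ne.symm hk), if_neg hk, add_zero]
          rw [update_comm hk]
      simp only [← h1, sum_add_distrib]
      simp
    simp only [lie_sub, lie_sum, sum_sub_distrib, ← key, leibniz_lie x y (ω v)]
    abel

theorem lieDerivative_apply (x : L) (ω : V [⋀^Fin n]→ₗ[A] M) (v : Fin n → V) :
    ⁅x, ω⁆ v = ⁅x, ω v⁆ - ∑ j, ω (update v j ⁅x, v j⁆) := rfl

instance : LieRinehartModule A L (V [⋀^Fin n]→ₗ[A] M) where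
  smul_lie' a x ω := by
    ext v
    simp [lieDerivative_apply, LieRinehartModule.smul_lie', smul_sub, smul_sum]
  lie_smul' x a ω := by
    ext v
    simp only [lieDerivative_apply, LieRinehartModule.lie_smul', smul_sub, smul_sum,
      AlternatingMap.smul_apply, AlternatingMap.add_apply]
    abel

instance [LieAlgebra R L] [Algebra R A] [Module R V] [Module R M] [IsScalarTower R A V]
    [IsScalarTower R A M] [LieModule R L V] [LieModule R L M] :
    LieModule R L (V [⋀^Fin n]→ₗ[A] M) where
  smul_lie r x ω := by
    ext v
    have : ∀ j (w : V), ω (update v j (r • w)) = r • ω (update v j w) := by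
      intro j w
      rw [← algebraMap_smul A r w, ω.map_update_smul, algebraMap_smul]
    simp [lieDerivative_apply, smul_sub, smul_sum, this]
  lie_smul r x ω := by
    ext v
    simp [lieDerivative_apply, smul_sub, smul_sum]

end lieDerivative

/-! ## The Lie-Rinehart differential -/

section chevalleyEilenberg

variable {R A L M : Type*} [CommRing R] [CommRing A] [Algebra R A] [LieRing L] [Module A L]
  [LieRingModule L A] [LieRinehartRing A L]
  [AddCommGroup M] [Module A M] [LieRingModule L M] [LieRinehartModule A L M] {n : ℕ}

/-- The value of the Lie-Rinehart differential `dω`: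
`∑ᵢ (-1)ⁱ (xᵢ (ω(x₀, …, x̂ᵢ, …, xₙ)) - ∑_{j > i} ω(x₀, …, x̂ᵢ, …, [xᵢ, xⱼ], …, xₙ))`,
with `[xᵢ, xⱼ]` at the place of `xⱼ`. Moving `[xᵢ, xⱼ]` to the front gives the usual term
`(-1)ⁱ⁺ʲ ω([xᵢ, xⱼ], x₀, …, x̂ᵢ, …, x̂ⱼ, …, xₙ)`. -/
def ceFun (ω : L [⋀^Fin n]→ₗ[A] M) (x : Fin (n + 1) → L) : M :=
  ∑ i : Fin (n + 1), (-1 : ℤ) ^ (i : ℕ) •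
    (⁅x i, ω (i.removeNth x)⁆ - ∑ j ∈ Ioi i, ω (i.removeNth (update x j ⁅x i, x j⁆)))

section removeNth

variable {A V M : Type*} [CommRing A] [AddCommGroup V] [Module A V] [AddCommGroup M] [Module A M]
  {n : ℕ} (ω : V [⋀^Fin n]→ₗ[A] M)

theorem removeNth_update_succAbove (x : Fin (n + 1) → V) (i : Fin (n + 1)) (l : Fin n) (w : V) :
    i.removeNth (update x (i.succAbove l) w) = update (i.removeNth x) l w := by
  funext m
  by_cases hm : m = l
  · subst hm; simp [Fin.removeNth]
  · simp [Fin.removeNth, hm]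

theorem map_removeNth_add (x : Fin (n + 1) → V) {i k : Fin (n + 1)} (h : k ≠ i) (y z : V) :
    ω (i.removeNth (update x k (y + z))) =
      ω (i.removeNth (update x k y)) + ω (i.removeNth (update x k z)) := by
  obtain ⟨l, rfl⟩ := Fin.exists_succAbove_eq h
  simp only [removeNth_update_succAbove, ω.map_update_add]

theorem map_removeNth_smul (x : Fin (n + 1) → V) {i k : Fin (n + 1)} (h : k ≠ i) (a : A) (y : V) :
    ω (i.removeNth (update x k (a • y))) = a • ω (i.removeNth (update x k y)) := by
  obtain ⟨l, rfl⟩ := Fin.exists_succAbove_eq h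
  simp only [removeNth_update_succAbove, ω.map_update_smul]

theorem map_removeNth_eq_zero (x : Fin (n + 1) → V) {i j k : Fin (n + 1)} (hj : j ≠ i)
    (hk : k ≠ i) (hjk : j ≠ k) (h : x j = x k) : ω (i.removeNth x) = 0 := by
  obtain ⟨l, rfl⟩ := Fin.exists_succAbove_eq hj
  obtain ⟨m, rfl⟩ := Fin.exists_succAbove_eq hk
  exact ω.map_eq_zero_of_eq _ (i := l) (j := m) h (fun e => hjk (by rw [e]))

theorem map_removeNth_pair (x : Fin (n + 1) → V) {i j k : Fin (n + 1)} (hj : j ≠ i)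
    (hk : k ≠ i) (hjk : j ≠ k) (h : x j = x k) (z : V) :
    ω (i.removeNth (update x j z)) + ω (i.removeNth (update x k z)) = 0 := by
  obtain ⟨l, rfl⟩ := Fin.exists_succAbove_eq hj
  obtain ⟨m, rfl⟩ := Fin.exists_succAbove_eq hk
  simp only [removeNth_update_succAbove]
  exact ω.update_add_update_eq_zero _ (fun e => hjk (by rw [e])) h z

theorem removeNth_eq_of_adjacent (x : Fin (n + 1) → V) {i j : Fin (n + 1)} (hj : (j : ℕ) = i + 1)
    (h : x i = x j) : i.removeNth x = j.removeNth x := by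
  funext k
  simp only [Fin.removeNth]
  rcases lt_trichotomy (k : ℕ) i with hk | hk | hk
  · congr 1
    rw [Fin.succAbove_of_castSucc_lt _ _ (by simpa [Fin.lt_def] using hk),
      Fin.succAbove_of_castSucc_lt _ _ (by simp [Fin.lt_def]; omega)]
  · rw [Fin.succAbove_of_le_castSucc _ _ (by simp [Fin.le_def]; omega),
      Fin.succAbove_of_castSucc_lt _ _ (by simp [Fin.lt_def]; omega)]
    rw [show k.succ = j from Fin.ext (by simp; omega),
      show k.castSucc = i from Fin.ext (by simp; omega), h]
  · congr 1
    rw [Fin.succAbove_of_le_castSucc _ _ (by simp [Fin.le_def]; omega),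
      Fin.succAbove_of_le_castSucc _ _ (by simp [Fin.le_def]; omega)]

end removeNth

theorem ceFun_update_add (ω : L [⋀^Fin n]→ₗ[A] M) (x : Fin (n + 1) → L) (k : Fin (n + 1))
    (y z : L) :
    ceFun ω (update x k (y + z)) = ceFun ω (update x k y) + ceFun ω (update x k z) := by
  simp only [ceFun, ← sum_add_distrib, ← smul_add]
  refine sum_congr rfl fun i _ => congrArg _ ?_
  have h0 : ⁅update x k (y + z) i, ω (i.removeNth (update x k (y + z)))⁆ =
      ⁅update x k y i, ω (i.removeNth (update x k y))⁆ +
      ⁅update x k z i, ω (i.removeNth (update x k z))⁆ := by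
    by_cases hi : k = i
    · subst hi; simp
    · rw [map_removeNth_add ω x hi, update_of_ne (Ne.symm hi), update_of_ne (Ne.symm hi),
        update_of_ne (Ne.symm hi), lie_add]
  have h1 : ∀ j ∈ Ioi i,
      ω (i.removeNth (update (update x k (y + z)) j ⁅update x k (y + z) i, update x k (y + z) j⁆))
      = ω (i.removeNth (update (update x k y) j ⁅update x k y i, update x k y j⁆)) +
        ω (i.removeNth (update (update x k z) j ⁅update x k z i, update x k z j⁆)) := by
    intro j hj
    have hij : j ≠ i := ne_of_gt (mem_Ioi.mp hj)
    by_cases hi : k = i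
    · subst hi
      have c : ∀ w u, k.removeNth (update (update x k w) j u) = k.removeNth (update x j u) := by
        intro w u
        rw [update_comm hij.symm]; simp
      simp only [c, update_self, update_of_ne hij, add_lie, map_removeNth_add ω x hij]
    · by_cases hj : k = j
      · subst hj
        simp only [update_self, update_idem, update_of_ne (Ne.symm hi), lie_add,
          map_removeNth_add ω x hij]
      · simp only [update_of_ne (Ne.symm hi), update_of_ne (Ne.symm hj), update_comm hj,
          map_removeNth_add ω _ hi]
  rw [h0, sum_congr rfl h1, sum_add_distrib]
  abel

theorem ceFun_update_smul (ω : L [⋀^Fin n]→ₗ[A] M) (x : Fin (n + 1) → L) (k : Fin (n + 1))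
    (a : A) (y : L) (hk : (k : ℕ) + 1 = n + 1) :
    ceFun ω (update x k (a • y)) = a • ceFun ω (update x k y) := by
  simp only [ceFun, smul_sum, smul_comm a]
  refine sum_congr rfl fun i _ => congrArg _ ?_
  by_cases hi : k = i
  · subst hi
    have : Ioi k = ∅ := by
      ext j; simp only [mem_Ioi, Fin.lt_def, notMem_empty, iff_false]; omega
    simp [this, LieRinehartModule.smul_lie']
  · have hki : k ∈ Ioi i := by
      have : (k : ℕ) ≠ i := fun e => hi (Fin.ext e)
      rw [mem_Ioi, Fin.lt_def]; omega
    have h1 : ∀ j ∈ Ioi i,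
        ω (i.removeNth (update (update x k (a • y)) j
          ⁅update x k (a • y) i, update x k (a • y) j⁆))
        = a • ω (i.removeNth (update (update x k y) j ⁅update x k y i, update x k y j⁆)) +
          if k = j then ⁅x i, a⁆ • ω (i.removeNth (update x k y)) else 0 := by
      intro j _
      by_cases hj : k = j
      · subst hj
        simp only [update_self, update_idem, update_of_ne (Ne.symm hi), if_true,
          LieRinehartRing.leibniz_smul_right, map_removeNth_add ω x hi, map_removeNth_smul ω x hi]
      · simp only [update_of_ne (Ne.symm hi), update_of_ne (Ne.symm hj), update_comm hj,
          map_removeNth_smul ω _ hi, if_neg hj, add_zero]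
    rw [sum_congr rfl h1, sum_add_distrib, sum_ite_eq, if_pos hki, map_removeNth_smul ω x hi,
      update_of_ne (Ne.symm hi), update_of_ne (Ne.symm hi), LieRinehartModule.lie_smul', smul_sub,
      smul_sum]
    abel

theorem ceFun_eq_zero (ω : L [⋀^Fin n]→ₗ[A] M) (x : Fin (n + 1) → L) (k l : Fin (n + 1))
    (hl : (l : ℕ) = k + 1) (h : x k = x l) : ceFun ω x = 0 := by
  have hkl : k ≠ l := fun e => by subst e; omega
  rw [ceFun, ← sum_subset (subset_univ {k, l}), sum_pair hkl]
  · have h1 : Ioi k = insert l (Ioi l) := by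
      ext j; simp only [mem_insert, mem_Ioi, Fin.lt_def, Fin.ext_iff]; omega
    have h2 : ∀ j ∈ Ioi l, ω (k.removeNth (update x j ⁅x k, x j⁆)) =
        ω (l.removeNth (update x j ⁅x l, x j⁆)) := by
      intro j hj
      have hj' : l ≠ j := ne_of_lt (mem_Ioi.mp hj)
      have hj'' : k ≠ j := fun e => by
        subst e; have := mem_Ioi.mp hj; rw [Fin.lt_def] at this; omega
      rw [← h, removeNth_eq_of_adjacent _ hl (by rw [update_of_ne hj', update_of_ne hj'', h])]
    have h3 : ω (k.removeNth (update x l ⁅x k, x l⁆)) = 0 := by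
      have := map_removeNth_smul ω x hkl.symm (0 : A) 0
      rw [zero_smul, zero_smul] at this
      rw [h, lie_self, this]
    rw [h1, sum_insert (by simp), sum_congr rfl h2, h3, removeNth_eq_of_adjacent x hl h, h, hl,
      pow_succ, zero_add]
    simp
  · intro i _ hi
    simp only [mem_insert, mem_singleton, not_or] at hi
    have hk : k ≠ i := Ne.symm hi.1
    have hl' : l ≠ i := Ne.symm hi.2
    rw [map_removeNth_eq_zero ω x hk hl' hkl h, lie_zero, zero_sub]
    have : ∑ j ∈ Ioi i, ω (i.removeNth (update x j ⁅x i, x j⁆)) = 0 := by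
      have h0 : ∀ j, k ≠ j → l ≠ j → ω (i.removeNth (update x j ⁅x i, x j⁆)) = 0 := by
        intro j hj hj'
        exact map_removeNth_eq_zero ω _ hk hl' hkl (by rw [update_of_ne hj, update_of_ne hj', h])
      have hki : (k : ℕ) ≠ i := fun e => hk (Fin.ext e)
      have hli : (l : ℕ) ≠ i := fun e => hl' (Fin.ext e)
      by_cases hik : i < k
      · rw [Fin.lt_def] at hik
        rw [← sum_subset (s₁ := {k, l}), sum_pair hkl, ← h]
        · exact map_removeNth_pair ω x hk hl' hkl h _
        · intro j hj
          simp only [mem_insert, mem_singleton] at hj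
          rcases hj with rfl | rfl <;> rw [mem_Ioi, Fin.lt_def] <;> omega
        · intro j _ hj
          simp only [mem_insert, mem_singleton, not_or] at hj
          exact h0 j (Ne.symm hj.1) (Ne.symm hj.2)
      · rw [Fin.lt_def] at hik
        refine sum_eq_zero fun j hj => ?_
        have := mem_Ioi.mp hj
        rw [Fin.lt_def] at this
        exact h0 j (fun e => by subst e; omega) (fun e => by subst e; omega)
    rw [this]; simp

/-- The Lie-Rinehart differential `Altⁿ_A(L, M) → Altⁿ⁺¹_A(L, M)`. -/
def ceD (ω : L [⋀^Fin n]→ₗ[A] M) : L [⋀^Fin (n + 1)]→ₗ[A] M :=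
  AlternatingMap.ofAdjacent (ceFun ω) (ceFun_update_add ω) (ceFun_eq_zero ω)
    fun x k a y hk => ceFun_update_smul ω x k a y hk

theorem ceD_apply (ω : L [⋀^Fin n]→ₗ[A] M) (x : Fin (n + 1) → L) : ceD ω x = ceFun ω x := rfl

variable (R) in
/-- The Lie-Rinehart differential as an `R`-linear map. -/
def ceLinear [Module R M] [IsScalarTower R A M] [LieAlgebra R L] [LieModule R L M] :
    (L [⋀^Fin n]→ₗ[A] M) →ₗ[R] (L [⋀^Fin (n + 1)]→ₗ[A] M) where
  toFun := ceD
  map_add' ω η := by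
    ext x
    simp only [AlternatingMap.add_apply, ceD_apply, ceFun, lie_add, sum_add_distrib]
    refine (sum_congr rfl fun i _ => ?_).trans sum_add_distrib
    rw [← smul_add]
    congr 1
    abel
  map_smul' r ω := by
    ext x
    simp only [AlternatingMap.smul_apply, ceD_apply, ceFun, lie_smul, smul_sum, smul_sub,
      RingHom.id_apply]
    refine sum_congr rfl fun i _ => ?_
    simp only [smul_comm r]

end chevalleyEilenberg

/-! ## Graded modules of forms, products, and the crossed product -/

/-- The graded module of forms `Alt*_A(L, M)`; a form is the family of its homogeneous components.
When `L` is finitely generated, `Altⁿ_A(L, M) = 0` for large `n`, so that this is the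
direct sum of the homogeneous parts. -/
abbrev Forms (A L M : Type*) [CommRing A] [AddCommGroup L] [Module A L] [AddCommGroup M]
    [Module A M] : Type _ :=
  ∀ n : ℕ, L [⋀^Fin n]→ₗ[A] M

section shuffle

variable {A V M : Type*} [CommRing A] [AddCommGroup V] [Module A V] [AddCommGroup M] [Module A M]
  {n : ℕ}

/-- The sign of the shuffle of `{0, …, n - 1}` that lists first `S` and then its complement, both
in increasing order. -/
def shuffleSign (S : Finset (Fin n)) : ℤ :=
  ∏ p ∈ S ×ˢ Sᶜ, if p.2 < p.1 then -1 else 1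

/-- The value of the component of degree `#S` of `ω` on the arguments `vᵢ`, `i ∈ S`, taken in
increasing order. -/
def evalOn (ω : Forms A V M) (S : Finset (Fin n)) (v : Fin n → V) : M :=
  ω S.card (v ∘ S.orderEmbOfFin rfl)

theorem evalOn_eq (ω : Forms A V M) (S : Finset (Fin n)) (v : Fin n → V) {k : ℕ}
    (h : S.card = k) : evalOn ω S v = ω k (v ∘ S.orderEmbOfFin h) := by
  subst h; rfl

theorem exists_orderEmb {S : Finset (Fin n)} {i : Fin n} (hi : i ∈ S) :
    ∃ k, S.orderEmbOfFin rfl k = i := by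
  have : i ∈ Set.range (S.orderEmbOfFin rfl) := by rw [range_orderEmbOfFin]; exact hi
  exact this

theorem evalOn_update_add (ω : Forms A V M) {S : Finset (Fin n)} (v : Fin n → V) {i : Fin n}
    (hi : i ∈ S) (x y : V) : evalOn ω S (update v i (x + y)) =
      evalOn ω S (update v i x) + evalOn ω S (update v i y) := by
  obtain ⟨k, rfl⟩ := exists_orderEmb hi
  simp only [evalOn, update_comp_eq_of_injective _ (S.orderEmbOfFin rfl).injective,
    AlternatingMap.map_update_add]

theorem evalOn_update_smul (ω : Forms A V M) {S : Finset (Fin n)} (v : Fin n → V) {i : Fin n}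
    (hi : i ∈ S) (a : A) (x : V) :
    evalOn ω S (update v i (a • x)) = a • evalOn ω S (update v i x) := by
  obtain ⟨k, rfl⟩ := exists_orderEmb hi
  simp only [evalOn, update_comp_eq_of_injective _ (S.orderEmbOfFin rfl).injective,
    AlternatingMap.map_update_smul]

theorem evalOn_update_of_notMem (ω : Forms A V M) {S : Finset (Fin n)} (v : Fin n → V) {i : Fin n}
    (hi : i ∉ S) (x : V) : evalOn ω S (update v i x) = evalOn ω S v := by
  rw [evalOn, update_comp_eq_of_notMem_range]
  · rfl
  · rw [range_orderEmbOfFin]; exact hi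

theorem evalOn_eq_zero (ω : Forms A V M) {S : Finset (Fin n)} (v : Fin n → V) {i j : Fin n}
    (hi : i ∈ S) (hj : j ∈ S) (hij : i ≠ j) (h : v i = v j) : evalOn ω S v = 0 := by
  obtain ⟨k, rfl⟩ := exists_orderEmb hi
  obtain ⟨l, rfl⟩ := exists_orderEmb hj
  exact (ω _).map_eq_zero_of_eq _ h (fun e => hij (by rw [e]))

theorem evalOn_pair (ω : Forms A V M) {S : Finset (Fin n)} (v : Fin n → V) {i j : Fin n}
    (hi : i ∈ S) (hj : j ∈ S) (hij : i ≠ j) (h : v i = v j) (z : V) :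
    evalOn ω S (update v i z) + evalOn ω S (update v j z) = 0 := by
  obtain ⟨k, rfl⟩ := exists_orderEmb hi
  obtain ⟨l, rfl⟩ := exists_orderEmb hj
  simp only [evalOn, update_comp_eq_of_injective _ (S.orderEmbOfFin rfl).injective]
  exact (ω S.card).update_add_update_eq_zero (v ∘ S.orderEmbOfFin rfl)
    (fun e => hij (by rw [e])) h z

theorem swap_lt_swap {i j : Fin n} (hij : (j : ℕ) = i + 1) {a b : Fin n} (hab : a < b)
    (h : ¬ (a = i ∧ b = j)) : Equiv.swap i j a < Equiv.swap i j b := by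
  simp only [Equiv.swap_apply_def, Fin.lt_def, Fin.ext_iff] at *
  split_ifs <;> omega

theorem evalOn_map_swap (ω : Forms A V M) (S : Finset (Fin n)) (v : Fin n → V) {i j : Fin n}
    (hij : (j : ℕ) = i + 1) (h : ¬ (i ∈ S ∧ j ∈ S)) :
    evalOn ω (S.map (Equiv.swap i j).toEmbedding) v = evalOn ω S (v ∘ Equiv.swap i j) := by
  rw [evalOn_eq ω _ v (card_map _), evalOn, comp_assoc]
  congr 2
  symm
  apply orderEmbOfFin_unique
  · intro k
    simp
  · intro k l hkl
    refine swap_lt_swap hij ((S.orderEmbOfFin rfl).strictMono hkl) fun e => h ?_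
    exact ⟨e.1 ▸ orderEmbOfFin_mem _ _ _, e.2 ▸ orderEmbOfFin_mem _ _ _⟩

theorem compl_map_swap (S : Finset (Fin n)) (i j : Fin n) :
    (S.map (Equiv.swap i j).toEmbedding)ᶜ = Sᶜ.map (Equiv.swap i j).toEmbedding := by
  ext k; simp [mem_map_equiv]

theorem shuffleSign_map_swap (S : Finset (Fin n)) {i j : Fin n}
    (hij : (j : ℕ) = i + 1) (h : i ∈ S ↔ j ∉ S) :
    shuffleSign (S.map (Equiv.swap i j).toEmbedding) = - shuffleSign S := by
  have hne : i ≠ j := fun e => by subst e; omega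
  have key : ∀ q : Fin n × Fin n, q.1 ≠ q.2 → q ≠ (i, j) → q ≠ (j, i) →
      (if Equiv.swap i j q.2 < Equiv.swap i j q.1 then (-1 : ℤ) else 1) =
        if q.2 < q.1 then -1 else 1 := by
    rintro ⟨a, b⟩ hab h1 h2
    simp only [ne_eq, Prod.mk.injEq] at hab h1 h2
    rcases lt_or_gt_of_ne hab with h | h
    · rw [if_neg (not_lt_of_gt h), if_neg (not_lt_of_gt (swap_lt_swap hij h h1))]
    · rw [if_pos h, if_pos (swap_lt_swap hij h (fun e => h2 ⟨e.2, e.1⟩))]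
  obtain ⟨p, hp, hp', hq⟩ : ∃ p ∈ S ×ˢ Sᶜ, (p = (i, j) ∨ p = (j, i)) ∧
      ∀ q ∈ S ×ˢ Sᶜ, q ≠ p → q ≠ (i, j) ∧ q ≠ (j, i) := by
    by_cases hi : i ∈ S
    · have hj := h.mp hi
      refine ⟨(i, j), by simp [hi, hj], Or.inl rfl, fun q hq hne => ⟨hne, ?_⟩⟩
      rintro rfl
      simp [hj] at hq
    · have hj : j ∈ S := by by_contra hj; exact hi (h.mpr hj)
      refine ⟨(j, i), by simp [hi, hj], Or.inr rfl, fun q hq hne => ⟨?_, hne⟩⟩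
      rintro rfl
      simp [hi] at hq
  have e : shuffleSign (S.map (Equiv.swap i j).toEmbedding) =
      ∏ q ∈ S ×ˢ Sᶜ, if Equiv.swap i j q.2 < Equiv.swap i j q.1 then (-1 : ℤ) else 1 := by
    rw [shuffleSign, compl_map_swap, prod_product, prod_product, prod_map]
    simp only [prod_map, Equiv.coe_toEmbedding]
  rw [e, shuffleSign, ← mul_prod_erase _ _ hp, ← mul_prod_erase _ _ hp, ← neg_mul]
  congr 1
  · have hlt : i < j := by rw [Fin.lt_def]; omega
    rcases hp' with rfl | rfl <;> simp [hlt, not_lt_of_gt hlt]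
  · refine prod_congr rfl fun q hq' => ?_
    have hq1 := mem_erase.mp hq'
    have hq2 := mem_product.mp hq1.2
    refine key q ?_ (hq q hq1.2 hq1.1).1 (hq q hq1.2 hq1.1).2
    intro e
    exact (mem_compl.mp hq2.2) (e ▸ hq2.1)

/-- The form `v ↦ ∑_S ± t(S, v)`, the sum over all shuffles. -/
def AlternatingMap.ofShuffles (t : Finset (Fin n) → (Fin n → V) → M)
    (hadd : ∀ S v i x y, t S (update v i (x + y)) = t S (update v i x) + t S (update v i y))
    (hsmul : ∀ S v i (a : A) x, t S (update v i (a • x)) = a • t S (update v i x))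
    (hzero : ∀ S v (i j : Fin n), (j : ℕ) = i + 1 → v i = v j → (i ∈ S ↔ j ∈ S) → t S v = 0)
    (hswap : ∀ S v (i j : Fin n), (j : ℕ) = i + 1 → v i = v j → (i ∈ S ↔ j ∉ S) →
      t (S.map (Equiv.swap i j).toEmbedding) v = t S v) : V [⋀^Fin n]→ₗ[A] M :=
  AlternatingMap.ofAdjacent (fun v => ∑ S : Finset (Fin n), shuffleSign S • t S v)
    (by
      intro v i x y
      simp only [hadd, smul_add, sum_add_distrib])
    (by
      intro v i j hij h
      refine sum_involution (fun S _ => S.map (Equiv.swap i j).toEmbedding) ?_ ?_ ?_ ?_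
      · intro S _
        by_cases hS : i ∈ S ↔ j ∉ S
        · rw [shuffleSign_map_swap S hij hS, hswap S v i j hij h hS, neg_smul, add_neg_cancel]
        · rw [hzero S v i j hij h (by tauto), hzero _ v i j hij h, smul_zero, smul_zero, add_zero]
          simp only [mem_map_equiv, Equiv.symm_swap, Equiv.swap_apply_left, Equiv.swap_apply_right]
          tauto
      · intro S _ hS e
        have hS' : i ∈ S ↔ j ∉ S := by
          by_contra hc
          exact hS (by rw [hzero S v i j hij h (by tauto), smul_zero])
        have := congrArg (i ∈ ·) e
        simp only [mem_map_equiv, Equiv.symm_swap, Equiv.swap_apply_left, eq_iff_iff] at this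
        tauto
      · intro S _; exact mem_univ _
      · intro S _
        ext k; simp [mem_map_equiv])
    (by
      intro v i a x _
      simp only [hsmul, smul_sum, smul_comm a])

end shuffle

section products

variable {A L M : Type*} [CommRing A] [AddCommGroup L] [Module A L] [AddCommGroup M] [Module A M]

theorem evalOn_map_swap_of_eq {V : Type*} [AddCommGroup V] [Module A V] {n : ℕ} (ω : Forms A V M)
    (S : Finset (Fin n)) (v : Fin n → V) {i j : Fin n} (hij : (j : ℕ) = i + 1) (hv : v i = v j)
    (h : ¬ (i ∈ S ∧ j ∈ S)) :
    evalOn ω (S.map (Equiv.swap i j).toEmbedding) v = evalOn ω S v := by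
  rw [evalOn_map_swap ω S v hij h]
  congr 1
  funext k
  simp only [comp_apply, Equiv.swap_apply_def]
  split_ifs with h1 h2
  · rw [h1, hv]
  · rw [h2, hv]
  · rfl

/-- The product `(α ∧ β)(v) = ∑_S ± α(v_S) β(v_{Sᶜ})` of a scalar form and an `M`-valued form,
the sum over all shuffles. -/
def wedge (α : Forms A L A) (β : Forms A L M) : Forms A L M := fun n =>
  AlternatingMap.ofShuffles (n := n) (fun S v => evalOn α S v • evalOn β Sᶜ v)
    (by
      intro S v i x y
      by_cases hi : i ∈ S
      · have hi' : i ∉ Sᶜ := by simpa using hi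
        simp only [evalOn_update_add α v hi, evalOn_update_of_notMem β v hi', add_smul]
      · have hi' : i ∈ Sᶜ := by simpa using hi
        simp only [evalOn_update_add β v hi', evalOn_update_of_notMem α v hi, smul_add])
    (by
      intro S v i a x
      by_cases hi : i ∈ S
      · have hi' : i ∉ Sᶜ := by simpa using hi
        simp only [evalOn_update_smul α v hi, evalOn_update_of_notMem β v hi', smul_assoc]
      · have hi' : i ∈ Sᶜ := by simpa using hi
        simp only [evalOn_update_smul β v hi', evalOn_update_of_notMem α v hi, smul_comm a])
    (by
      intro S v i j hij h hS
      have hne : i ≠ j := fun e => by subst e; omega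
      by_cases hi : i ∈ S
      · rw [evalOn_eq_zero α v hi (hS.mp hi) hne h, zero_smul]
      · rw [evalOn_eq_zero β v (mem_compl.mpr hi) (mem_compl.mpr (fun e => hi (hS.mpr e))) hne h,
          smul_zero])
    (by
      intro S v i j hij h hS
      rw [compl_map_swap, evalOn_map_swap_of_eq α S v hij h (by tauto),
        evalOn_map_swap_of_eq β Sᶜ v hij h (by simp only [mem_compl]; tauto)])

end products

section crossedProduct

variable {A K V M : Type*} [CommRing A] [LieRing K] [Module A K] [LieRingModule K A]
  [LieRinehartRing A K] [AddCommGroup V] [Module A V] [LieRingModule K V] [LieRinehartModule A K V]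
  [AddCommGroup M] [Module A M]

/-- `∑_{i ∈ S} ω(v_S with vᵢ replaced by y vᵢ)`. -/
def derivSum {n : ℕ} (ω : Forms A V M) (y : K) (S : Finset (Fin n)) (v : Fin n → V) : M :=
  ∑ i ∈ S, evalOn ω S (update v i ⁅y, v i⁆)

variable {n : ℕ} (ω : Forms A V M)

theorem derivSum_zero (S : Finset (Fin n)) (v : Fin n → V) :
    derivSum ω (0 : K) S v = 0 := by
  refine sum_eq_zero fun i hi => ?_
  have := evalOn_update_smul ω v hi (0 : A) 0
  rw [zero_smul, zero_smul] at this
  rw [zero_lie, this]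

theorem derivSum_add (y z : K) (S : Finset (Fin n)) (v : Fin n → V) :
    derivSum ω (y + z) S v = derivSum ω y S v + derivSum ω z S v := by
  rw [derivSum, derivSum, derivSum, ← sum_add_distrib]
  exact sum_congr rfl fun i hi => by rw [add_lie, evalOn_update_add ω v hi]

theorem derivSum_smul (a : A) (y : K) (S : Finset (Fin n)) (v : Fin n → V) :
    derivSum ω (a • y) S v = a • derivSum ω y S v := by
  rw [derivSum, derivSum, smul_sum]
  exact sum_congr rfl fun i hi => by
    rw [LieRinehartModule.smul_lie', evalOn_update_smul ω v hi]

theorem derivSum_update_add (y : K) {S : Finset (Fin n)} (v : Fin n → V) {i : Fin n} (hi : i ∈ S)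
    (x z : V) : derivSum ω y S (update v i (x + z)) =
      derivSum ω y S (update v i x) + derivSum ω y S (update v i z) := by
  rw [derivSum, derivSum, derivSum, ← sum_add_distrib]
  refine sum_congr rfl fun k hk => ?_
  by_cases h : i = k
  · subst h
    simp only [update_self, update_idem, lie_add, evalOn_update_add ω v hi]
  · simp only [update_of_ne (Ne.symm h), update_comm h, evalOn_update_add ω _ hi]

theorem derivSum_update_smul (y : K) {S : Finset (Fin n)} (v : Fin n → V) {i : Fin n} (hi : i ∈ S)
    (a : A) (x : V) : derivSum ω y S (update v i (a • x)) =
      a • derivSum ω y S (update v i x) + ⁅y, a⁆ • evalOn ω S (update v i x) := by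
  have : ∀ k ∈ S, evalOn ω S (update (update v i (a • x)) k ⁅y, update v i (a • x) k⁆) =
      a • evalOn ω S (update (update v i x) k ⁅y, update v i x k⁆) +
      if i = k then ⁅y, a⁆ • evalOn ω S (update v i x) else 0 := by
    intro k hk
    by_cases h : i = k
    · subst h
      simp only [update_self, update_idem, LieRinehartModule.lie_smul', evalOn_update_add ω v hi,
        evalOn_update_smul ω v hi, if_true]
    · simp only [update_of_ne (Ne.symm h), update_comm h, evalOn_update_smul ω _ hi, if_neg h,
        add_zero]
  rw [derivSum, sum_congr rfl this, sum_add_distrib, sum_ite_eq, if_pos hi, derivSum, smul_sum]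

theorem derivSum_update_of_notMem (y : K) {S : Finset (Fin n)} (v : Fin n → V) {i : Fin n}
    (hi : i ∉ S) (x : V) : derivSum ω y S (update v i x) = derivSum ω y S v := by
  refine sum_congr rfl fun k hk => ?_
  have h : i ≠ k := fun e => hi (e ▸ hk)
  simp only [update_of_ne (Ne.symm h), update_comm h, evalOn_update_of_notMem ω _ hi]

theorem derivSum_eq_zero (y : K) {S : Finset (Fin n)} (v : Fin n → V) {i j : Fin n}
    (hi : i ∈ S) (hj : j ∈ S) (hij : i ≠ j) (h : v i = v j) : derivSum ω y S v = 0 := by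
  rw [derivSum, ← sum_subset (s₁ := {i, j}), sum_pair hij, ← h]
  · exact evalOn_pair ω v hi hj hij h _
  · intro k hk
    simp only [mem_insert, mem_singleton] at hk
    rcases hk with rfl | rfl <;> assumption
  · intro k _ hk
    simp only [mem_insert, mem_singleton, not_or] at hk
    exact evalOn_eq_zero ω _ hi hj hij
      (by rw [update_of_ne (Ne.symm hk.1), update_of_ne (Ne.symm hk.2), h])

theorem derivSum_map_swap (y : K) (S : Finset (Fin n)) (v : Fin n → V) {i j : Fin n}
    (hij : (j : ℕ) = i + 1) (hv : v i = v j) (h : ¬ (i ∈ S ∧ j ∈ S)) :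
    derivSum ω y (S.map (Equiv.swap i j).toEmbedding) v = derivSum ω y S v := by
  have hvs : ∀ k, v (Equiv.swap i j k) = v k := by
    intro k
    simp only [Equiv.swap_apply_def]
    split_ifs with h1 h2
    · rw [h1, hv]
    · rw [h2, hv]
    · rfl
  rw [derivSum, sum_map]
  refine sum_congr rfl fun k hk => ?_
  rw [evalOn_map_swap ω S _ hij h]
  congr 1
  funext l
  simp only [comp_apply, Equiv.coe_toEmbedding, update_apply, hvs, EmbeddingLike.apply_eq_iff_eq]

/-- The action of `ξ ∈ Alt_A(V, K)` on `β ∈ Alt_A(V, M)`, for `(A, K)`-modules `V` and `M`: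
`ξ(β)(v) = ∑_S ± (ξ(v_S) β)(v_{Sᶜ})`, where `ξ(v_S) ∈ K` acts by the Lie derivative. For
`ξ = α ⊗ x` this is `α ∧ (x β)`. -/
def crossedAction [LieRingModule K M] [LieRinehartModule A K M] (ξ : Forms A V K)
    (β : Forms A V M) : Forms A V M := fun n =>
  AlternatingMap.ofShuffles (n := n)
    (fun S v => ⁅evalOn ξ S v, evalOn β Sᶜ v⁆ - derivSum β (evalOn ξ S v) Sᶜ v)
    (by
      intro S v i x y
      by_cases hi : i ∈ S
      · have hi' : i ∉ Sᶜ := by simpa using hi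
        simp only [evalOn_update_add ξ v hi, evalOn_update_of_notMem β v hi',
          derivSum_update_of_notMem β _ v hi', derivSum_add, add_lie]
        abel
      · have hi' : i ∈ Sᶜ := by simpa using hi
        simp only [evalOn_update_add β v hi', evalOn_update_of_notMem ξ v hi,
          derivSum_update_add β _ v hi', lie_add]
        abel)
    (by
      intro S v i a x
      by_cases hi : i ∈ S
      · have hi' : i ∉ Sᶜ := by simpa using hi
        simp only [evalOn_update_smul ξ v hi, evalOn_update_of_notMem β v hi',
          derivSum_update_of_notMem β _ v hi', derivSum_smul, LieRinehartModule.smul_lie', smul_sub]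
      · have hi' : i ∈ Sᶜ := by simpa using hi
        simp only [evalOn_update_smul β v hi', evalOn_update_of_notMem ξ v hi,
          derivSum_update_smul β _ v hi', LieRinehartModule.lie_smul', smul_sub]
        abel)
    (by
      intro S v i j hij h hS
      have hne : i ≠ j := fun e => by subst e; omega
      by_cases hi : i ∈ S
      · rw [evalOn_eq_zero ξ v hi (hS.mp hi) hne h, zero_lie, derivSum_zero, sub_zero]
      · have hi' : i ∈ Sᶜ := mem_compl.mpr hi
        have hj' : j ∈ Sᶜ := mem_compl.mpr (fun e => hi (hS.mpr e))
        rw [evalOn_eq_zero β v hi' hj' hne h, derivSum_eq_zero β _ v hi' hj' hne h, lie_zero,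
          sub_zero])
    (by
      intro S v i j hij h hS
      rw [compl_map_swap, evalOn_map_swap_of_eq ξ S v hij h (by tauto),
        evalOn_map_swap_of_eq β Sᶜ v hij h (by simp only [mem_compl]; tauto),
        derivSum_map_swap β _ Sᶜ v hij h (by simp only [mem_compl]; tauto)])

theorem evalOn_add (ω η : Forms A V M) (S : Finset (Fin n)) (v : Fin n → V) :
    evalOn (ω + η) S v = evalOn ω S v + evalOn η S v := rfl

theorem evalOn_smul {R : Type*} [CommRing R] [Algebra R A] [Module R M] [IsScalarTower R A M]
    (r : R) (ω : Forms A V M) (S : Finset (Fin n)) (v : Fin n → V) :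
    evalOn (r • ω) S v = r • evalOn ω S v := rfl

theorem crossedAction_add [LieRingModule K M] [LieRinehartModule A K M] (ξ : Forms A V K)
    (β γ : Forms A V M) : crossedAction ξ (β + γ) = crossedAction ξ β + crossedAction ξ γ := by
  funext n
  ext v
  change ∑ S : Finset (Fin n), shuffleSign S •
      (⁅evalOn ξ S v, evalOn (β + γ) Sᶜ v⁆ - derivSum (β + γ) (evalOn ξ S v) Sᶜ v) =
    ∑ S : Finset (Fin n), shuffleSign S •
      (⁅evalOn ξ S v, evalOn β Sᶜ v⁆ - derivSum β (evalOn ξ S v) Sᶜ v) +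
    ∑ S : Finset (Fin n), shuffleSign S •
      (⁅evalOn ξ S v, evalOn γ Sᶜ v⁆ - derivSum γ (evalOn ξ S v) Sᶜ v)
  rw [← sum_add_distrib]
  refine sum_congr rfl fun S _ => ?_
  rw [← smul_add]
  congr 1
  simp only [derivSum, evalOn_add, lie_add, sum_add_distrib]
  abel

theorem crossedAction_smul {R : Type*} [CommRing R] [Algebra R A] [Module R M]
    [IsScalarTower R A M] [LieAlgebra R K] [LieRingModule K M] [LieModule R K M]
    [LieRinehartModule A K M] (r : R) (ξ : Forms A V K)
    (β : Forms A V M) : crossedAction ξ (r • β) = r • crossedAction ξ β := by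
  funext n
  ext v
  change ∑ S : Finset (Fin n), shuffleSign S •
      (⁅evalOn ξ S v, evalOn (r • β) Sᶜ v⁆ - derivSum (r • β) (evalOn ξ S v) Sᶜ v) =
    r • ∑ S : Finset (Fin n), shuffleSign S •
      (⁅evalOn ξ S v, evalOn β Sᶜ v⁆ - derivSum β (evalOn ξ S v) Sᶜ v)
  rw [smul_sum]
  refine sum_congr rfl fun S _ => ?_
  rw [smul_comm r]
  congr 1
  simp only [derivSum, evalOn_smul, lie_smul, smul_sub, smul_sum]

theorem wedge_add (α : Forms A V A) (β γ : Forms A V M) :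
    wedge α (β + γ) = wedge α β + wedge α γ := by
  funext n
  ext v
  change ∑ S : Finset (Fin n), shuffleSign S • (evalOn α S v • evalOn (β + γ) Sᶜ v) =
    ∑ S : Finset (Fin n), shuffleSign S • (evalOn α S v • evalOn β Sᶜ v) +
    ∑ S : Finset (Fin n), shuffleSign S • (evalOn α S v • evalOn γ Sᶜ v)
  simp only [evalOn_add, smul_add, sum_add_distrib]

theorem wedge_smul {R : Type*} [CommRing R] [Algebra R A] [Module R M]
    [IsScalarTower R A M] (r : R) (α : Forms A V A) (β : Forms A V M) :
    wedge α (r • β) = r • wedge α β := by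
  funext n
  ext v
  change ∑ S : Finset (Fin n), shuffleSign S • (evalOn α S v • evalOn (r • β) Sᶜ v) =
    r • ∑ S : Finset (Fin n), shuffleSign S • (evalOn α S v • evalOn β Sᶜ v)
  rw [smul_sum]
  refine sum_congr rfl fun S _ => ?_
  rw [evalOn_smul, smul_comm r (shuffleSign S), smul_comm r (evalOn α S v)]

/-- The crossed product bracket on `Alt_A(V, K)`, for an `(A, K)`-module `V`:
`[ξ, η](v) = ∑_S ± ([ξ(v_S), η(v_{Sᶜ})] - ∑_{j ∉ S} η(v_{Sᶜ} with vⱼ replaced by ξ(v_S) vⱼ)`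
`+ ∑_{i ∈ S} ξ(v_S with vᵢ replaced by η(v_{Sᶜ}) vᵢ))`.
On `ξ = α ⊗ x` and `η = β ⊗ y` with scalar forms `α`, `β` and `x, y ∈ K` it is
`(α ∧ β) ⊗ [x, y] + (α ∧ x β) ⊗ y - (-1)^(|α||β|) (β ∧ y α) ⊗ x`. -/
def crossedBracket (ξ η : Forms A V K) : Forms A V K := fun n =>
  AlternatingMap.ofShuffles (n := n)
    (fun S v => ⁅evalOn ξ S v, evalOn η Sᶜ v⁆ - derivSum η (evalOn ξ S v) Sᶜ v
      + derivSum ξ (evalOn η Sᶜ v) S v)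
    (by
      intro S v i x y
      by_cases hi : i ∈ S
      · have hi' : i ∉ Sᶜ := by simpa using hi
        simp only [evalOn_update_add ξ v hi, evalOn_update_of_notMem η v hi',
          derivSum_update_of_notMem η _ v hi', derivSum_add, add_lie, derivSum_update_add ξ _ v hi]
        abel
      · have hi' : i ∈ Sᶜ := by simpa using hi
        simp only [evalOn_update_add η v hi', evalOn_update_of_notMem ξ v hi,
          derivSum_update_add η _ v hi', lie_add, derivSum_update_of_notMem ξ _ v hi, derivSum_add]
        abel)
    (by
      intro S v i a x
      by_cases hi : i ∈ S
      · have hi' : i ∉ Sᶜ := by simpa using hi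
        have e : ∀ z w : K, ⁅a • z, w⁆ = a • ⁅z, w⁆ - ⁅w, a⁆ • z := by
          intro z w
          rw [← lie_skew, LieRinehartRing.leibniz_smul_right, ← lie_skew z w, smul_neg]
          abel
        simp only [evalOn_update_smul ξ v hi, evalOn_update_of_notMem η v hi',
          derivSum_update_of_notMem η _ v hi', derivSum_smul, smul_sub, smul_add, e,
          derivSum_update_smul ξ _ v hi]
        abel
      · have hi' : i ∈ Sᶜ := by simpa using hi
        simp only [evalOn_update_smul η v hi', evalOn_update_of_notMem ξ v hi,
          derivSum_update_smul η _ v hi', derivSum_update_of_notMem ξ _ v hi, derivSum_smul,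
          LieRinehartRing.leibniz_smul_right, smul_sub, smul_add]
        abel)
    (by
      intro S v i j hij h hS
      have hne : i ≠ j := fun e => by subst e; omega
      by_cases hi : i ∈ S
      · rw [evalOn_eq_zero ξ v hi (hS.mp hi) hne h, zero_lie, derivSum_zero,
          derivSum_eq_zero ξ _ v hi (hS.mp hi) hne h, sub_zero, add_zero]
      · have hi' : i ∈ Sᶜ := mem_compl.mpr hi
        have hj' : j ∈ Sᶜ := mem_compl.mpr (fun e => hi (hS.mpr e))
        rw [evalOn_eq_zero η v hi' hj' hne h, derivSum_eq_zero η _ v hi' hj' hne h, lie_zero,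
          derivSum_zero, sub_zero, add_zero])
    (by
      intro S v i j hij h hS
      rw [compl_map_swap, evalOn_map_swap_of_eq ξ S v hij h (by tauto),
        evalOn_map_swap_of_eq η Sᶜ v hij h (by simp only [mem_compl]; tauto),
        derivSum_map_swap η _ Sᶜ v hij h (by simp only [mem_compl]; tauto),
        derivSum_map_swap ξ _ S v hij h (by tauto)])

end crossedProduct

/-! ## Cohomology -/

section cohomology

/-- Submodules `C N` (the cochains of degree `N`) of a module `X` with an operator `D` on `X`. -/
structure CochainSystem (R : Type*) [CommRing R] where
  /-- The ambient module. -/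
  X : Type*
  [addCommGroup : AddCommGroup X]
  [module : Module R X]
  /-- The operator that gives the differential. -/
  D : X →ₗ[R] X
  /-- The cochains of degree `N`. -/
  C : ℕ → Submodule R X

attribute [instance] CochainSystem.addCommGroup CochainSystem.module

namespace CochainSystem

variable {R : Type*} [CommRing R] (K : CochainSystem R)

/-- The submodules `C N` with the restrictions of `D` form a cochain complex. -/
def IsComplex : Prop :=
  ∀ N, ∀ x ∈ K.C N, K.D x ∈ K.C (N + 1) ∧ K.D (K.D x) = 0

/-- Cocycles of degree `N`. -/
def cocycles (N : ℕ) : Submodule R K.X :=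
  K.C N ⊓ LinearMap.ker K.D

/-- Coboundaries of degree `N`. -/
def coboundaries : ℕ → Submodule R K.X
  | 0 => ⊥
  | N + 1 => (K.C N).map K.D

/-- The cohomology module `Hᴺ`: cocycles modulo coboundaries. -/
abbrev Cohomology (N : ℕ) : Type _ :=
  K.cocycles N ⧸ (K.coboundaries N).submoduleOf (K.cocycles N)

/-- The class of a cocycle. -/
def cohomologyClass (N : ℕ) (x : K.cocycles N) : K.Cohomology N :=
  Submodule.Quotient.mk x

variable {K} {K' : CochainSystem R}

/-- The isomorphisms `Φ N` are compatible with the differentials. -/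
def CommutesWithD (Φ : ∀ N, K.C N ≃ₗ[R] K'.C N) : Prop :=
  ∀ N (x : K.C N) (y : K.C (N + 1)), K.D x.1 = y.1 → K'.D (Φ N x).1 = (Φ (N + 1) y).1

/-- The isomorphisms `φ N` on cohomology are induced by the maps `Φ N`:
`φ N` sends the class of a cocycle `x` to the class of the cocycle `Φ N x`. -/
def IsInducedBy (φ : ∀ N, K.Cohomology N ≃ₗ[R] K'.Cohomology N)
    (Φ : ∀ N, K.C N ≃ₗ[R] K'.C N) : Prop :=
  ∀ N (x : K.cocycles N) (y : K'.cocycles N), y.1 = (Φ N ⟨x.1, x.2.1⟩).1 →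
    φ N (K.cohomologyClass N x) = K'.cohomologyClass N y

end CochainSystem

end cohomology

section lieRinehartCohomology

variable (R A L M : Type*) [CommRing R] [CommRing A] [Algebra R A] [LieRing L] [Module A L]
  [LieAlgebra R L] [LieRingModule L A] [LieRinehartRing A L]
  [AddCommGroup M] [Module A M] [Module R M] [IsScalarTower R A M] [LieRingModule L M]
  [LieModule R L M] [LieRinehartModule A L M]

/-- The Lie-Rinehart differential on `Alt*_A(L, M)`. -/
def formsD : Forms A L M →ₗ[R] Forms A L M where
  toFun ω
    | 0 => 0
    | n + 1 => ceLinear R (ω n)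
  map_add' ω η := by
    funext n
    cases n with
    | zero => simp
    | succ n => simp
  map_smul' r ω := by
    funext n
    cases n with
    | zero => simp
    | succ n => simp

/-- The forms of degree `N`. -/
def formsDegree (N : ℕ) : Submodule R (Forms A L M) where
  carrier := {ω | ∀ n, n ≠ N → ω n = 0}
  add_mem' h h' n hn := by simp [h n hn, h' n hn]
  zero_mem' n _ := rfl
  smul_mem' r ω h n hn := by simp [h n hn]

/-- The complex `Alt*_A(L, M)`; its cohomology is the Lie-Rinehart cohomology `H*(L, M)`. -/
def lieRinehartComplex : CochainSystem R where
  X := Forms A L M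
  D := formsD R A L M
  C := formsDegree R A L M

end lieRinehartCohomology

/-! ## The bigraded complex -/

section bigraded

instance AlternatingMap.isScalarTower_base {R A V M ι : Type*} [CommRing R] [CommRing A]
    [Algebra R A] [AddCommGroup V] [Module A V] [AddCommGroup M] [Module A M] [Module R M]
    [IsScalarTower R A M] : IsScalarTower R A (V [⋀^ι]→ₗ[A] M) where
  smul_assoc r a ω := by ext v; simp

/-- Interchanging the two groups of variables. -/
def altSwap (R : Type*) {A V W M : Type*} [CommRing R] [CommRing A] [Algebra R A] [AddCommGroup V]
    [Module A V] [AddCommGroup W] [Module A W] [AddCommGroup M] [Module A M] [Module R M]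
    [IsScalarTower R A M] {p q : ℕ} :
    (V [⋀^Fin q]→ₗ[A] (W [⋀^Fin p]→ₗ[A] M)) →ₗ[R] (W [⋀^Fin p]→ₗ[A] (V [⋀^Fin q]→ₗ[A] M)) where
  toFun f :=
    { toFun w :=
        { toFun v := f v w
          map_update_add' v i x y := by simp
          map_update_smul' v i a x := by simp
          map_eq_zero_of_eq' v i j h hij := by simp [f.map_eq_zero_of_eq v h hij] }
      map_update_add' w i x y := by ext v; simp
      map_update_smul' w i a x := by ext v; simp
      map_eq_zero_of_eq' w i j h hij := by
        ext v; exact (f v).map_eq_zero_of_eq w h hij }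
  map_add' f g := by ext; rfl
  map_smul' r f := by ext; rfl

variable (R A L' L'' : Type*) [CommRing R] [CommRing A] [Algebra R A]
  [LieRing L'] [LieAlgebra R L'] [Module A L'] [LieRingModule L' A] [LieRinehartRing A L']
  [LieRinehartAlgebra R A L']
  [LieRing L''] [LieAlgebra R L''] [Module A L''] [LieRingModule L'' A] [LieRinehartRing A L'']
  [LieRinehartAlgebra R A L'']
  [LieRingModule L' L''] [LieModule R L' L''] [LieRinehartModule A L' L'']
  [LieRingModule L'' L'] [LieModule R L'' L'] [LieRinehartModule A L'' L']

/-- The bigraded module `Alt^q_A(L'', Alt^p_A(L', A))`. -/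
abbrev BiForms : Type _ := ∀ p q : ℕ, L'' [⋀^Fin q]→ₗ[A] (L' [⋀^Fin p]→ₗ[A] A)

/-- The operator `d''`: the Lie-Rinehart differential of `L''` with coefficients in the
`(A, L'')`-module `Alt^p_A(L', A)`. -/
def dDoublePrime (p q : ℕ) : (L'' [⋀^Fin q]→ₗ[A] (L' [⋀^Fin p]→ₗ[A] A)) →ₗ[R]
    (L'' [⋀^Fin (q + 1)]→ₗ[A] (L' [⋀^Fin p]→ₗ[A] A)) :=
  ceLinear R

/-- The operator `d'`: the Lie-Rinehart differential of `L'` with coefficients in the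
`(A, L')`-module `Alt^q_A(L'', A)`, where `Alt^q_A(L'', Alt^p_A(L', A))` is identified with
`Alt^p_A(L', Alt^q_A(L'', A))`. -/
def dPrime (p q : ℕ) : (L'' [⋀^Fin q]→ₗ[A] (L' [⋀^Fin p]→ₗ[A] A)) →ₗ[R]
    (L'' [⋀^Fin q]→ₗ[A] (L' [⋀^Fin (p + 1)]→ₗ[A] A)) :=
  altSwap R ∘ₗ ceLinear R ∘ₗ altSwap R

/-- The total differential `d' + (-1)^p d''`. -/
def biFormsD : BiForms A L' L'' →ₗ[R] BiForms A L' L'' where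
  toFun F p q :=
    (match p with
      | 0 => 0
      | p + 1 => dPrime R A L' L'' p q (F p q)) +
    (-1 : ℤ) ^ p • (match q with
      | 0 => 0
      | q + 1 => dDoublePrime R A L' L'' p q (F p q))
  map_add' F G := by
    funext p q
    cases p <;> cases q <;> simp <;> abel
  map_smul' r F := by
    funext p q
    cases p <;> cases q <;> simp [smul_comm r]

/-- The elements of total degree `N`. -/
def biFormsDegree (N : ℕ) : Submodule R (BiForms A L' L'') where
  carrier := {F | ∀ p q, p + q ≠ N → F p q = 0}
  add_mem' h h' p q hn := by simp [h p q hn, h' p q hn]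
  zero_mem' p q _ := rfl
  smul_mem' r F h p q hn := by simp [h p q hn]

/-- The total complex of `(Alt_A(L'', Alt_A(L', A)), d', d'')`. -/
def biFormsComplex : CochainSystem R where
  X := BiForms A L' L''
  D := biFormsD R A L' L''
  C := biFormsDegree R A L' L''

end bigraded

/-! ## Differential graded Lie-Rinehart cohomology of the crossed product -/

section differentialGraded

variable (R A L' L'' : Type*) [CommRing R] [CommRing A] [Algebra R A]
  [LieRing L'] [LieAlgebra R L'] [Module A L'] [LieRingModule L' A] [LieRinehartRing A L']
  [LieRinehartAlgebra R A L']
  [LieRing L''] [LieAlgebra R L''] [Module A L''] [LieRingModule L'' A] [LieRinehartRing A L'']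
  [LieRinehartAlgebra R A L'']
  [LieRingModule L' L''] [LieModule R L' L''] [LieRinehartModule A L' L'']
  [LieRingModule L'' L'] [LieModule R L'' L'] [LieRinehartModule A L'' L']

/-- A homogeneous element of `𝓛' = Alt_A(L'', L')`, with its degree. -/
abbrev HForm : Type _ := Σ k : ℕ, L'' [⋀^Fin k]→ₗ[A] L'

variable {A L' L''}

/-- A homogeneous element as an element of the graded module `𝓛'`. -/
def HForm.toForms (ξ : HForm A L' L'') : Forms A L'' L' := Pi.single ξ.1 ξ.2

/-- An element of `L'` as an element of `𝓛'` of degree `0`. -/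
def HForm.const (x : L') : HForm A L' L'' := ⟨0, AlternatingMap.constOfIsEmpty A L'' (Fin 0) x⟩

/-- The product of `α ∈ 𝓐''` of degree `m` with a homogeneous element of `𝓛'`. -/
def HForm.smul {m : ℕ} (α : L'' [⋀^Fin m]→ₗ[A] A) (ξ : HForm A L' L'') : HForm A L' L'' :=
  ⟨m + ξ.1, wedge (Pi.single m α) ξ.toForms (m + ξ.1)⟩

/-- The crossed product bracket of homogeneous elements of `𝓛'`. -/
def HForm.bracket (ξ η : HForm A L' L'') : HForm A L' L'' :=
  ⟨ξ.1 + η.1, crossedBracket ξ.toForms η.toForms (ξ.1 + η.1)⟩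

/-- The differential `d''` of `𝓛' = Alt_A(L'', L')`, the Lie-Rinehart differential of `L''` with
coefficients in the `(A, L'')`-module `L'`. -/
def HForm.d (ξ : HForm A L' L'') : HForm A L' L'' := ⟨ξ.1 + 1, ceD ξ.2⟩

variable (A L' L'')

/-- Functions of `p` homogeneous elements of `𝓛'` with values in `𝓐'' = Alt_A(L'', A)`. -/
abbrev DGFun (p : ℕ) : Type _ := (Fin p → HForm A L' L'') → Forms A L'' A

/-- The graded Lie-Rinehart (Cartan-Chevalley-Eilenberg) operator of the graded Lie-Rinehart
algebra `(𝓐'', 𝓛')`: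
`∑ᵢ ± (ξᵢ(f(ξ₀, …, ξ̂ᵢ, …, ξ_p)) - ∑_{j > i} ± f(ξ₀, …, ξ̂ᵢ, …, [ξᵢ, ξⱼ], …, ξ_p))`,
with `[ξᵢ, ξⱼ]` at the place of `ξⱼ`. The outer sign is `(-1)ⁱ` times the Koszul sign of moving
`ξᵢ` to the front, and the inner one is the Koszul sign of moving `ξᵢ` from the front to `ξⱼ`. -/
def dgD₁ (p : ℕ) : DGFun A L' L'' p →ₗ[R] DGFun A L' L'' (p + 1) where
  toFun f ξ := ∑ i : Fin (p + 1), (-1 : ℤ) ^ ((i : ℕ) + (ξ i).1 * ∑ l ∈ Iio i, (ξ l).1) •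
    (crossedAction (ξ i).toForms (f (i.removeNth ξ)) -
      ∑ j ∈ Ioi i, (-1 : ℤ) ^ ((ξ i).1 * ∑ l ∈ (Iio j).erase i, (ξ l).1) •
        f (i.removeNth (update ξ j ((ξ i).bracket (ξ j)))))
  map_add' f g := by
    funext ξ
    simp only [Pi.add_apply, crossedAction_add, smul_add, sum_add_distrib, smul_sub,
      sum_sub_distrib]
    abel
  map_smul' r f := by
    funext ξ
    simp only [Pi.smul_apply, crossedAction_smul, smul_sub, smul_sum, RingHom.id_apply,
      smul_comm r]

/-- The operator induced by the differentials `d''` of `𝓐''` and `𝓛'`: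
`± (d''(f(ξ₁, …, ξ_p)) - ∑ᵢ ± f(ξ₁, …, d''ξᵢ, …, ξ_p))`, where the sign of the sum's `i`-th term
is `(-1)^(|ξ₁| + ⋯ + |ξᵢ₋₁|)` and the outer sign is `(-1)^(|ξ₁| + ⋯ + |ξ_p|)`. -/
def dgD₂ (p : ℕ) : DGFun A L' L'' p →ₗ[R] DGFun A L' L'' p where
  toFun f ξ := (-1 : ℤ) ^ (∑ i, (ξ i).1) •
    (formsD R A L'' A (f ξ) -
      ∑ i, (-1 : ℤ) ^ (∑ l ∈ Iio i, (ξ l).1) • f (update ξ i (ξ i).d))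
  map_add' f g := by
    funext ξ
    simp only [Pi.add_apply, map_add, smul_add, sum_add_distrib, smul_sub]
    abel
  map_smul' r f := by
    funext ξ
    simp only [Pi.smul_apply, map_smul, smul_sub, smul_sum, RingHom.id_apply, smul_comm r]

/-- The total differential: its component on functions of `p` variables is
`(dgD₁ f_{p-1}) + (-1)^p (dgD₂ f_p)`. -/
def dgD : (∀ p, DGFun A L' L'' p) →ₗ[R] (∀ p, DGFun A L' L'' p) where
  toFun F p :=
    (match p with
      | 0 => 0
      | p + 1 => dgD₁ R A L' L'' p (F p)) +
    (-1 : ℤ) ^ p • dgD₂ R A L' L'' p (F p)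
  map_add' F G := by
    funext p
    cases p <;> simp <;> abel
  map_smul' r F := by
    funext p
    cases p <;> simp [smul_comm r]

/-- `Alt_{𝓐''}(𝓛', 𝓐'')` in total degree `N`: families `f = (f_p)` of functions on homogeneous
elements of `𝓛'` such that
* `f_p(ξ₁, …, ξ_p)` is homogeneous of degree `N - p + |ξ₁| + ⋯ + |ξ_p|`;
* `f_p` is additive in each variable, and `𝓐''`-linear in the graded sense:
  `f_p(…, α ξᵢ, …) = (-1)^(|α| (|ξ₁| + ⋯ + |ξᵢ₋₁|)) α f_p(…, ξᵢ, …)`;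
* `f_p` is graded alternating: interchanging the neighbours `ξᵢ`, `ξᵢ₊₁` gives the
  sign `-(-1)^(|ξᵢ||ξᵢ₊₁|)`, and `f_p` vanishes if `ξᵢ = ξᵢ₊₁` is of even degree. -/
def dgCochains (N : ℕ) : Submodule R (∀ p, DGFun A L' L'' p) where
  carrier := {f | ∀ p (ξ : Fin p → HForm A L' L''),
    (∀ n, n + p ≠ N + ∑ i, (ξ i).1 → f p ξ n = 0) ∧
    (∀ i k (x y : L'' [⋀^Fin k]→ₗ[A] L'),
      f p (update ξ i ⟨k, x + y⟩) = f p (update ξ i ⟨k, x⟩) + f p (update ξ i ⟨k, y⟩)) ∧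
    (∀ i m (α : L'' [⋀^Fin m]→ₗ[A] A),
      f p (update ξ i ((ξ i).smul α)) =
        (-1 : ℤ) ^ (m * ∑ l ∈ Iio i, (ξ l).1) • wedge (Pi.single m α) (f p ξ)) ∧
    (∀ i j : Fin p, (j : ℕ) = i + 1 →
      f p (ξ ∘ Equiv.swap i j) = -(-1 : ℤ) ^ ((ξ i).1 * (ξ j).1) • f p ξ) ∧
    (∀ i j : Fin p, (j : ℕ) = i + 1 → ξ i = ξ j → Even (ξ i).1 → f p ξ = 0)}
  add_mem' {f g} h h' p ξ := by
    obtain ⟨h1, h2, h3, h4, h5⟩ := h p ξ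
    obtain ⟨g1, g2, g3, g4, g5⟩ := h' p ξ
    refine ⟨fun n hn => ?_, fun i k x y => ?_, fun i m α => ?_, fun i j hij => ?_,
      fun i j hij e he => ?_⟩
    · simp [h1 n hn, g1 n hn]
    · simp only [Pi.add_apply, h2, g2]; abel
    · simp only [Pi.add_apply, h3, g3, wedge_add, smul_add]
    · simp only [Pi.add_apply, h4 i j hij, g4 i j hij, smul_add]
    · simp [h5 i j hij e he, g5 i j hij e he]
  zero_mem' p ξ := by
    refine ⟨fun n hn => rfl, fun i k x y => by simp, fun i m α => ?_, fun i j hij => by simp,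
      fun i j hij e he => rfl⟩
    have := wedge_smul (0 : R) (Pi.single m α : Forms A L'' A) (0 : Forms A L'' A)
    rw [zero_smul, zero_smul] at this
    simp [this]
  smul_mem' r f h p ξ := by
    obtain ⟨h1, h2, h3, h4, h5⟩ := h p ξ
    refine ⟨fun n hn => ?_, fun i k x y => ?_, fun i m α => ?_, fun i j hij => ?_,
      fun i j hij e he => ?_⟩
    · simp [h1 n hn]
    · simp only [Pi.smul_apply, h2, smul_add]
    · simp only [Pi.smul_apply, h3, wedge_smul, smul_comm r]
    · simp only [Pi.smul_apply, h4 i j hij, smul_comm r]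
    · simp [h5 i j hij e he]

/-- The standard complex `Alt_{𝓐''}(𝓛', 𝓐'')` of the crossed product
`(𝓐'', 𝓛') = (Alt_A(L'', A), Alt_A(L'', L'))` with its differential `d''`; its cohomology is the
differential graded Lie-Rinehart cohomology `H*(𝓛', 𝓐'')`. -/
def dgLieRinehartComplex : CochainSystem R where
  X := ∀ p, DGFun A L' L'' p
  D := dgD R A L' L''
  C := dgCochains R A L' L''

end differentialGraded

/-!
All three complexes have the same underlying graded module, in three disguises, and the point is
that the two comparison maps respect the differentials. Write `i_x` and `L_x` for the contraction
and the Lie derivative along `x`. Every identity of forms is obtained by induction on the degree: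
a form of positive degree is determined by its contractions (`succ_ext_of_contract`), and Cartan's
formula `i_x d + d i_x = L_x` (`contract_formsD`) reduces an assertion about differentials to one in
lower degree. Shuffle sums enter only through one rule, that contraction is a graded derivation for
them (`contract_shuffleForm`).

*Bigraded forms and the twilled sum.* A bigraded form `F` is sent to the form on `L' ⊕ L''` that is
the shuffle sum of the maps `(z, w) ↦ F(w'')(z')` (`toTwilledForms`). Contraction with `x ∈ L'` and
with `v ∈ L''` become the contractions of `F`; by `[x, v] = x · v - v · x` the Lie derivative along
`x ∈ L'` becomes the Lie derivative of `F` plus the insertion of the `1`-form `v ↦ v · x`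
(`lie_toTwilledForms`). The same operator is the anticommutator of `i_x` with the total
differential `d' + (-1)^p d''` (`insertOp_biFormsD`). Since a form on `L' ⊕ L''` is determined by its
contractions with elements of `L'` and by its restriction to `L''`, the map commutes with the
differentials (`formsD_toTwilledForms`). In particular the total differential squares to zero.

*Bigraded forms and the crossed product.* An element `ξ` of `Alt_A(L'', L')` acts on bigraded forms
by the insertion `j_ξ`, that is `α i_x` for `ξ = α ⊗ x`. A bigraded form `F` is sent to the function
with value `± j_{ξ_p} ⋯ j_{ξ_1} F` on `ξ_1, …, ξ_p` (`toDGFun`). Two commutation rules carry the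
comparison of the differentials: `[d'', j_ξ] = j_{d''ξ}` (`dDoublePrimeOp_mul_insertFormOp`) and
`[[j_ξ, d'], j_η] = j_{[ξ, η]}` with the crossed product bracket
(`lieFormOp_insertFormOp_commutator`). The latter is checked on decomposable elements, which suffice
because `L'` is finitely generated and projective; there it follows formally from Cartan's formula
for `d'` and the commutation rules of multiplications and insertions (`commutator_identity`). With
these rules Cartan's formula for the graded Cartan-Chevalley-Eilenberg operator (`dgD₁_succ`) gives
the compatibility with `d'` by induction on the number of arguments (`toDGFun_dPrimeOp`). A cochain
of the crossed product is determined by its values on elements of `L'`, again because decomposable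
elements span (`dgCochains_eq_zero`), and so the comparison is bijective.
-/

section

-- The ring of additive endomorphisms of bigraded forms is found only at a greater depth.
set_option maxSynthPendingDepth 3

/-! ### Contraction of forms -/

section contraction

variable {A V M : Type*} [CommRing A] [AddCommGroup V] [Module A V] [AddCommGroup M] [Module A M]

/-- Contraction `i_v ω = ω(v, -)` of a graded form. -/
def contract (v : V) : Forms A V M →ₗ[A] Forms A V M where
  toFun ω n := (ω (n + 1)).curryLeft v
  map_add' _ _ := rfl
  map_smul' _ _ := rfl

theorem contract_apply (v : V) (ω : Forms A V M) (n : ℕ) (w : Fin n → V) :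
    contract v ω n w = ω (n + 1) (Fin.cons v w) := rfl

theorem contract_add_left (v w : V) (ω : Forms A V M) :
    contract (v + w) ω = contract v ω + contract w ω := by
  funext n
  exact (ω (n + 1)).curryLeft.map_add v w

theorem contract_sub_left (v w : V) (ω : Forms A V M) :
    contract (v - w) ω = contract v ω - contract w ω := by
  funext n
  exact (ω (n + 1)).curryLeft.map_sub v w

/-- Forms of positive degree are determined by their contractions; identities of forms are proved
with this by induction on the degree. -/
theorem succ_ext_of_contract {ω η : Forms A V M} {n : ℕ}
    (h : ∀ v, contract v ω n = contract v η n) : ω (n + 1) = η (n + 1) := by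
  ext x
  rw [← Fin.cons_self_tail x]
  exact congrArg (fun f : V [⋀^Fin n]→ₗ[A] M => f (Fin.tail x)) (h (x 0))

theorem zero_ext {ω η : V [⋀^Fin 0]→ₗ[A] M} (h : ω ![] = η ![]) : ω = η := by
  ext x
  rw [Subsingleton.elim x ![], h]

/-- Multiplication of the component of degree `n` by `sⁿ`; the sign involution for `s = -1`. -/
def twist (s : ℤ) : Forms A V M →ₗ[A] Forms A V M where
  toFun ω n := s ^ n • ω n
  map_add' _ _ := by funext n; simp
  map_smul' a ω := by
    funext n
    exact smul_comm (s ^ n) a (ω n)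

theorem twist_apply (s : ℤ) (ω : Forms A V M) (n : ℕ) : twist s ω n = s ^ n • ω n := rfl

theorem contract_twist (s : ℤ) (v : V) (ω : Forms A V M) :
    contract v (twist s ω) = s • twist s (contract v ω) := by
  funext n
  ext w
  simp [contract_apply, twist_apply, pow_succ, mul_smul, smul_comm s]

theorem twist_twist (s t : ℤ) (ω : Forms A V M) : twist s (twist t ω) = twist (s * t) ω := by
  funext n
  simp only [twist_apply, mul_pow, mul_smul]

theorem twist_one (ω : Forms A V M) : twist 1 ω = ω := by
  funext n
  simp [twist_apply]

theorem twist_single (s : ℤ) (k : ℕ) (ω : V [⋀^Fin k]→ₗ[A] M) :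
    twist s (Pi.single k ω : Forms A V M) = s ^ k • Pi.single k ω := by
  funext n
  by_cases h : n = k
  · subst h
    simp [twist_apply]
  · simp [twist_apply, h]

theorem contract_single_succ (v : V) (m : ℕ) (ω : V [⋀^Fin (m + 1)]→ₗ[A] M) :
    contract v (Pi.single (m + 1) ω : Forms A V M) = Pi.single m (ω.curryLeft v) := by
  funext n
  by_cases h : n = m
  · subst h
    ext w
    simp [contract_apply, Matrix.vecCons]
  · ext w
    rw [contract_apply, Pi.single_eq_of_ne h, Pi.single_eq_of_ne (by omega)]
    rfl

theorem contract_single_zero (v : V) (ω : V [⋀^Fin 0]→ₗ[A] M) :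
    contract v (Pi.single 0 ω : Forms A V M) = 0 := by
  funext n
  ext w
  rw [contract_apply, Pi.single_eq_of_ne (by omega)]
  rfl

end contraction

/-! ### Shuffle sums -/

section shuffleSums

theorem sum_finset_fin_succ {n : ℕ} {M : Type*} [AddCommMonoid M] (f : Finset (Fin (n + 1)) → M) :
    ∑ S, f S = ∑ S : Finset (Fin n), f (insert 0 (S.map (Fin.succEmb n))) +
      ∑ S : Finset (Fin n), f (S.map (Fin.succEmb n)) := by
  have h0 : (0 : Fin (n + 1)) ∉ (univ : Finset (Fin n)).map (Fin.succEmb n) := by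
    simp
  have h1 : (univ : Finset (Finset (Fin (n + 1)))) =
      (insert 0 ((univ : Finset (Fin n)).map (Fin.succEmb n))).powerset := by
    ext S
    simp only [mem_univ, mem_powerset, true_iff]
    intro i _
    refine Fin.cases (by simp) (fun j => by simp) i
  have h2 : ((univ : Finset (Fin n)).map (Fin.succEmb n)).powerset =
      (univ : Finset (Finset (Fin n))).map (mapEmbedding (Fin.succEmb n)).toEmbedding := by
    ext S
    simp only [mem_powerset, mem_map, mem_univ, true_and, RelEmbedding.coe_toEmbedding,
      mapEmbedding_apply]
    rw [subset_map_iff]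
    simp [eq_comm]
  rw [h1, sum_powerset_insert h0, h2, sum_map, sum_map, add_comm]
  rfl

theorem compl_insert_zero_map_succ {n : ℕ} (S : Finset (Fin n)) :
    (insert 0 (S.map (Fin.succEmb n)))ᶜ = Sᶜ.map (Fin.succEmb n) := by
  ext i
  refine Fin.cases (by simp) (fun j => by simp) i

theorem compl_map_succ {n : ℕ} (S : Finset (Fin n)) :
    (S.map (Fin.succEmb n))ᶜ = insert 0 (Sᶜ.map (Fin.succEmb n)) := by
  ext i
  refine Fin.cases (by simp) (fun j => by simp) i

theorem card_insert_zero_map_succ {n : ℕ} (S : Finset (Fin n)) :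
    (insert 0 (S.map (Fin.succEmb n))).card = S.card + 1 := by
  rw [card_insert_of_notMem (by simp), card_map]

theorem shuffleSign_insert_zero {n : ℕ} (S : Finset (Fin n)) :
    shuffleSign (insert 0 (S.map (Fin.succEmb n))) = shuffleSign S := by
  rw [shuffleSign, shuffleSign, compl_insert_zero_map_succ, prod_product, prod_product,
    prod_insert (by simp), prod_map]
  simp

theorem shuffleSign_map_succ {n : ℕ} (S : Finset (Fin n)) :
    shuffleSign (S.map (Fin.succEmb n)) = (-1) ^ S.card * shuffleSign S := by
  rw [shuffleSign, shuffleSign, compl_map_succ, prod_product, prod_product, prod_map]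
  simp only [prod_insert (by simp : (0 : Fin (n + 1)) ∉ Sᶜ.map (Fin.succEmb n))]
  rw [prod_mul_distrib]
  simp

theorem orderEmbOfFin_insert_zero {n : ℕ} (S : Finset (Fin n)) :
    ((insert 0 (S.map (Fin.succEmb n))).orderEmbOfFin (card_insert_zero_map_succ S) :
      Fin (S.card + 1) → Fin (n + 1)) = Fin.cons 0 (Fin.succ ∘ S.orderEmbOfFin rfl) := by
  symm
  apply orderEmbOfFin_unique
  · intro k
    refine Fin.cases (by simp) (fun j => ?_) k
    simp
  · intro k l
    refine Fin.cases ?_ (fun k => ?_) k <;> refine Fin.cases ?_ (fun l => ?_) l <;> simp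

theorem orderEmbOfFin_map_succ {n : ℕ} (S : Finset (Fin n)) :
    ((S.map (Fin.succEmb n)).orderEmbOfFin (card_map _) :
      Fin S.card → Fin (n + 1)) = Fin.succ ∘ S.orderEmbOfFin rfl := by
  symm
  apply orderEmbOfFin_unique
  · intro k
    simp
  · intro k l
    simp

variable {A V M : Type*} [CommRing A] [AddCommGroup V] [Module A V] [AddCommGroup M] [Module A M]

/-- A family of alternating maps in two groups of variables. -/
abbrev DoubleForms (A V W M : Type*) [CommRing A] [AddCommGroup V] [Module A V] [AddCommGroup W]
    [Module A W] [AddCommGroup M] [Module A M] : Type _ :=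
  ∀ p q : ℕ, V [⋀^Fin p]→ₗ[A] (W [⋀^Fin q]→ₗ[A] M)

/-- The value of the component of degrees `(#S, #Sᶜ)` of `G` on `v_S` and `v_{Sᶜ}`. -/
def evalOnPair {n : ℕ} (G : DoubleForms A V V M) (S : Finset (Fin n)) (v : Fin n → V) : M :=
  G S.card Sᶜ.card (v ∘ S.orderEmbOfFin rfl) (v ∘ Sᶜ.orderEmbOfFin rfl)

theorem evalOnPair_eq {n : ℕ} (G : DoubleForms A V V M) (S T : Finset (Fin n)) (v : Fin n → V)
    {p q : ℕ} (hT : Sᶜ = T) (hp : S.card = p) (hq : T.card = q) :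
    evalOnPair G S v = G p q (v ∘ S.orderEmbOfFin hp) (v ∘ T.orderEmbOfFin hq) := by
  subst hT hp hq; rfl

theorem evalOnPair_eq_left {n : ℕ} (G : DoubleForms A V V M) (S : Finset (Fin n)) (v w : Fin n → V)
    (h : v ∘ Sᶜ.orderEmbOfFin rfl = w ∘ Sᶜ.orderEmbOfFin rfl) :
    evalOnPair G S v = evalOn (fun p => G p Sᶜ.card) S v (w ∘ Sᶜ.orderEmbOfFin rfl) := by
  rw [← h]; rfl

theorem evalOnPair_eq_right {n : ℕ} (G : DoubleForms A V V M) (S : Finset (Fin n)) (v w : Fin n → V)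
    (h : v ∘ S.orderEmbOfFin rfl = w ∘ S.orderEmbOfFin rfl) :
    evalOnPair G S v = evalOn (fun q => G S.card q (w ∘ S.orderEmbOfFin rfl)) Sᶜ v := by
  rw [← h]; rfl

theorem update_comp_orderEmbOfFin {n : ℕ} {S : Finset (Fin n)} {i : Fin n} (hi : i ∉ S)
    (v : Fin n → V) (x : V) : update v i x ∘ S.orderEmbOfFin rfl = v ∘ S.orderEmbOfFin rfl :=
  update_comp_eq_of_notMem_range _ _ (by rw [range_orderEmbOfFin]; exact hi)

/-- The shuffle sum `v ↦ ∑_S ± G(v_S)(v_{Sᶜ})` of a family of maps that alternate in two groups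
of variables. Products, insertions and the comparison with forms on a direct sum are all of this
kind. -/
def shuffleForm (G : DoubleForms A V V M) : Forms A V M := fun n =>
  AlternatingMap.ofShuffles (n := n) (evalOnPair G)
    (by
      intro S v i x y
      by_cases hi : i ∈ S
      · have hi' : i ∉ Sᶜ := by simpa using hi
        simp only [evalOnPair_eq_left G S _ v (update_comp_orderEmbOfFin hi' _ _),
          evalOn_update_add _ v hi, AlternatingMap.add_apply]
      · have hi' : i ∈ Sᶜ := by simpa using hi
        simp only [evalOnPair_eq_right G S _ v (update_comp_orderEmbOfFin hi _ _),
          evalOn_update_add _ v hi'])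
    (by
      intro S v i a x
      by_cases hi : i ∈ S
      · have hi' : i ∉ Sᶜ := by simpa using hi
        simp only [evalOnPair_eq_left G S _ v (update_comp_orderEmbOfFin hi' _ _),
          evalOn_update_smul _ v hi, AlternatingMap.smul_apply]
      · have hi' : i ∈ Sᶜ := by simpa using hi
        simp only [evalOnPair_eq_right G S _ v (update_comp_orderEmbOfFin hi _ _),
          evalOn_update_smul _ v hi'])
    (by
      intro S v i j hij h hS
      have hne : i ≠ j := fun e => by subst e; omega
      by_cases hi : i ∈ S
      · rw [evalOnPair_eq_left G S v v rfl, evalOn_eq_zero _ v hi (hS.mp hi) hne h,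
          AlternatingMap.zero_apply]
      · rw [evalOnPair_eq_right G S v v rfl, evalOn_eq_zero _ v (mem_compl.mpr hi)
          (mem_compl.mpr (fun e => hi (hS.mpr e))) hne h])
    (by
      intro S v i j hij h hS
      have key : ∀ T : Finset (Fin n), ¬ (i ∈ T ∧ j ∈ T) →
          v ∘ (T.map (Equiv.swap i j).toEmbedding).orderEmbOfFin (card_map _) =
            v ∘ T.orderEmbOfFin rfl := by
        intro T hT
        have e : (Equiv.swap i j ∘ T.orderEmbOfFin rfl : Fin T.card → Fin n) =
            (T.map (Equiv.swap i j).toEmbedding).orderEmbOfFin (card_map _) := by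
          apply orderEmbOfFin_unique
          · intro k
            simp
          · intro k l hkl
            refine swap_lt_swap hij ((T.orderEmbOfFin rfl).strictMono hkl) fun e => hT ?_
            exact ⟨e.1 ▸ orderEmbOfFin_mem _ _ _, e.2 ▸ orderEmbOfFin_mem _ _ _⟩
        rw [← e]
        funext k
        simp only [comp_apply, Equiv.swap_apply_def]
        split_ifs with h1 h2
        · rw [h1, h]
        · rw [h2, h]
        · rfl
      rw [evalOnPair_eq G _ _ v (compl_map_swap S i j) (card_map _) (card_map _),
        key S (by tauto), key Sᶜ (by simp only [mem_compl]; tauto)]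
      rfl)

theorem shuffleForm_apply (G : DoubleForms A V V M) (n : ℕ) (v : Fin n → V) :
    shuffleForm G n v = ∑ S : Finset (Fin n), shuffleSign S • evalOnPair G S v := rfl

/-- Contraction of the first group of variables. -/
def contractFst {W : Type*} [AddCommGroup W] [Module A W] (v : V) (G : DoubleForms A V W M) :
    DoubleForms A V W M :=
  fun p q => (G (p + 1) q).curryLeft v

/-- Contraction of the second group of variables, with the sign `(-1)ᵖ` for passing the first
group. -/
def contractSnd {W : Type*} [AddCommGroup W] [Module A W] (v : W) (G : DoubleForms A V W M) :
    DoubleForms A V W M :=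
  fun p q => (-1 : ℤ) ^ p •
    (AlternatingMap.curryLeftLinearMap.flip v).compAlternatingMap (G p (q + 1))

theorem contractFst_apply {W : Type*} [AddCommGroup W] [Module A W] (v : V)
    (G : DoubleForms A V W M) (p q : ℕ) (x : Fin p → V) (y : Fin q → W) :
    contractFst v G p q x y = G (p + 1) q (Fin.cons v x) y := rfl

theorem contractSnd_apply {W : Type*} [AddCommGroup W] [Module A W] (v : W)
    (G : DoubleForms A V W M) (p q : ℕ) (x : Fin p → V) (y : Fin q → W) :
    contractSnd v G p q x y = (-1 : ℤ) ^ p • G p (q + 1) x (Fin.cons v y) := rfl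

theorem shuffleForm_zero_apply (G : DoubleForms A V V M) (v : Fin 0 → V) :
    shuffleForm G 0 v = G 0 0 ![] ![] := by
  rw [shuffleForm_apply, Fintype.sum_eq_single ∅ (fun S hS => (hS (Subsingleton.elim _ _)).elim),
    evalOnPair_eq G ∅ ∅ v (Subsingleton.elim _ _) rfl rfl]
  simp only [shuffleSign, empty_product, prod_empty, one_smul]
  exact congrArg₂ (fun w w' : Fin 0 → V => G 0 0 w w') (Subsingleton.elim _ _)
    (Subsingleton.elim _ _)

theorem shuffleForm_add (G H : DoubleForms A V V M) :
    shuffleForm (G + H) = shuffleForm G + shuffleForm H := by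
  funext n
  ext v
  simp only [Pi.add_apply, AlternatingMap.add_apply, shuffleForm_apply, ← sum_add_distrib,
    ← smul_add]
  rfl

/-- Contraction is a graded derivation for shuffle sums. -/
theorem contract_shuffleForm (v : V) (G : DoubleForms A V V M) :
    contract v (shuffleForm G) =
      shuffleForm (contractFst v G) + shuffleForm (contractSnd v G) := by
  funext n
  ext w
  rw [contract_apply, shuffleForm_apply, sum_finset_fin_succ, Pi.add_apply,
    AlternatingMap.add_apply, shuffleForm_apply, shuffleForm_apply]
  have hc : ∀ (k : ℕ) (f : Fin k → Fin n), (Fin.cons v w : Fin (n + 1) → V) ∘ Fin.succ ∘ f =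
      w ∘ f := fun k f => by funext i; simp
  have hc' : ∀ (k : ℕ) (f : Fin k → Fin n), (Fin.cons v w : Fin (n + 1) → V) ∘
      (Fin.cons 0 (Fin.succ ∘ f) : Fin (k + 1) → Fin (n + 1)) = Fin.cons v (w ∘ f) := by
    intro k f
    funext i
    refine Fin.cases (by simp) (fun i => by simp) i
  congr 1
  · refine sum_congr rfl fun S _ => ?_
    rw [shuffleSign_insert_zero, evalOnPair_eq G _ _ _ (compl_insert_zero_map_succ S)
      (card_insert_zero_map_succ S) (card_map _), orderEmbOfFin_insert_zero,
      orderEmbOfFin_map_succ, hc, hc']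
    rfl
  · refine sum_congr rfl fun S _ => ?_
    rw [shuffleSign_map_succ, evalOnPair_eq G _ _ _ (compl_map_succ S) (card_map _)
      (card_insert_zero_map_succ Sᶜ), orderEmbOfFin_insert_zero,
      orderEmbOfFin_map_succ, hc, hc', mul_comm, mul_smul]
    rfl

end shuffleSums

/-! ### Products of forms along a bilinear pairing -/

section pairings

variable {A V M M₁ M₂ M₃ M₄ M₅ : Type*} [CommRing A] [AddCommGroup V] [Module A V]
  [AddCommGroup M] [Module A M] [AddCommGroup M₁] [Module A M₁] [AddCommGroup M₂] [Module A M₂]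
  [AddCommGroup M₃] [Module A M₃] [AddCommGroup M₄] [Module A M₄] [AddCommGroup M₅] [Module A M₅]

/-- The family `(v, w) ↦ B(α(v), β(w))`. -/
def pairForms (B : M₁ →ₗ[A] M₂ →ₗ[A] M₃) (α : Forms A V M₁) (β : Forms A V M₂) :
    DoubleForms A V V M₃ := fun p q =>
  LinearMap.compAlternatingMap
    { toFun := fun m => (B m).compAlternatingMap (β q)
      map_add' := fun m m' => by ext w; simp
      map_smul' := fun a m => by ext w; simp } (α p)

theorem pairForms_apply (B : M₁ →ₗ[A] M₂ →ₗ[A] M₃) (α : Forms A V M₁) (β : Forms A V M₂)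
    (p q : ℕ) (v : Fin p → V) (w : Fin q → V) :
    pairForms B α β p q v w = B (α p v) (β q w) := rfl

theorem shuffleForm_smul (a : A) (G : DoubleForms A V V M) :
    shuffleForm (a • G) = a • shuffleForm G := by
  funext n
  ext v
  simp only [Pi.smul_apply, AlternatingMap.smul_apply, shuffleForm_apply, smul_sum]
  exact sum_congr rfl fun S _ => smul_comm _ _ _

/-- The product of forms `(α ∧ β)(v) = ∑_S ± B(α(v_S), β(v_{Sᶜ}))` along a bilinear pairing. -/
def pairWedge (B : M₁ →ₗ[A] M₂ →ₗ[A] M₃) :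
    Forms A V M₁ →ₗ[A] Forms A V M₂ →ₗ[A] Forms A V M₃ :=
  LinearMap.mk₂ A (fun α β => shuffleForm (pairForms B α β))
    (fun α α' β => by
      rw [← shuffleForm_add]
      congr 1; funext p q; ext v w; simp [pairForms_apply])
    (fun a α β => by
      rw [← shuffleForm_smul]
      congr 1; funext p q; ext v w; simp [pairForms_apply])
    (fun α β β' => by
      rw [← shuffleForm_add]
      congr 1; funext p q; ext v w; simp [pairForms_apply])
    (fun a α β => by
      rw [← shuffleForm_smul]
      congr 1; funext p q; ext v w; simp [pairForms_apply])

theorem pairWedge_eq (B : M₁ →ₗ[A] M₂ →ₗ[A] M₃) (α : Forms A V M₁) (β : Forms A V M₂) :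
    pairWedge B α β = shuffleForm (pairForms B α β) := rfl

theorem pairWedge_apply (B : M₁ →ₗ[A] M₂ →ₗ[A] M₃) (α : Forms A V M₁) (β : Forms A V M₂) (n : ℕ)
    (v : Fin n → V) : pairWedge B α β n v =
      ∑ S : Finset (Fin n), shuffleSign S • B (evalOn α S v) (evalOn β Sᶜ v) := rfl

theorem wedge_eq_pairWedge (α : Forms A V A) (β : Forms A V M) :
    wedge α β = pairWedge (LinearMap.lsmul A M) α β := rfl

theorem pairWedge_zero_apply (B : M₁ →ₗ[A] M₂ →ₗ[A] M₃) (α : Forms A V M₁) (β : Forms A V M₂)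
    (v : Fin 0 → V) : pairWedge B α β 0 v = B (α 0 ![]) (β 0 ![]) := by
  rw [pairWedge_eq, shuffleForm_zero_apply, pairForms_apply]

theorem contract_pairWedge (B : M₁ →ₗ[A] M₂ →ₗ[A] M₃) (α : Forms A V M₁) (β : Forms A V M₂)
    (v : V) : contract v (pairWedge B α β) =
      pairWedge B (contract v α) β + pairWedge B (twist (-1) α) (contract v β) := by
  rw [pairWedge_eq, contract_shuffleForm]
  congr 2
  funext p q
  ext x y
  simp [contractSnd_apply, pairForms_apply, twist_apply, contract_apply]

theorem pairWedge_apply_eq_zero (B : M₁ →ₗ[A] M₂ →ₗ[A] M₃) {α : Forms A V M₁} {β : Forms A V M₂}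
    {n : ℕ} (h : ∀ p q, p + q = n → α p = 0 ∨ β q = 0) : pairWedge B α β n = 0 := by
  ext v
  rw [pairWedge_apply]
  refine sum_eq_zero fun S _ => ?_
  rcases h S.card Sᶜ.card (by rw [card_add_card_compl, Fintype.card_fin]) with h | h
  · simp [evalOn, h]
  · simp [evalOn, h]

theorem twist_pairWedge (s : ℤ) (B : M₁ →ₗ[A] M₂ →ₗ[A] M₃) (α : Forms A V M₁)
    (β : Forms A V M₂) :
    twist s (pairWedge B α β) = pairWedge B (twist s α) (twist s β) := by
  funext n
  ext v
  simp only [twist_apply, pairWedge_apply, AlternatingMap.smul_apply, smul_sum]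
  refine sum_congr rfl fun S _ => ?_
  have h : n = S.card + Sᶜ.card := by rw [card_add_card_compl, Fintype.card_fin]
  have e : s ^ n = s ^ S.card * s ^ Sᶜ.card := by rw [← pow_add, ← h]
  simp only [evalOn, twist_apply, AlternatingMap.smul_apply, map_zsmul, LinearMap.smul_apply]
  rw [e, mul_comm, mul_smul, smul_comm (shuffleSign S), smul_comm (shuffleSign S)]

/-- Associativity of products of forms, for pairings that are associative. -/
theorem pairWedge_assoc {B : M₁ →ₗ[A] M₂ →ₗ[A] M₃} {C : M₃ →ₗ[A] M →ₗ[A] M₄}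
    {B' : M₁ →ₗ[A] M₅ →ₗ[A] M₄} {C' : M₂ →ₗ[A] M →ₗ[A] M₅}
    (h : ∀ a b x, C (B a b) x = B' a (C' b x))
    (α : Forms A V M₁) (β : Forms A V M₂) (γ : Forms A V M) :
    pairWedge C (pairWedge B α β) γ = pairWedge B' α (pairWedge C' β γ) := by
  funext n
  induction n generalizing α β γ with
  | zero =>
    refine zero_ext ?_
    simp only [pairWedge_zero_apply, h]
  | succ n ih =>
    refine succ_ext_of_contract fun v => ?_
    simp only [contract_pairWedge, map_add, LinearMap.add_apply, twist_pairWedge, Pi.add_apply, ih,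
      add_assoc]

/-- Products of homogeneous forms may be interchanged, up to the Koszul sign, when the pairings
may be interchanged up to the factor `c`. -/
theorem pairWedge_comm {B : M₁ →ₗ[A] M₃ →ₗ[A] M₄} {C : M₂ →ₗ[A] M →ₗ[A] M₃}
    {B' : M₁ →ₗ[A] M →ₗ[A] M₅} {C' : M₂ →ₗ[A] M₅ →ₗ[A] M₄} {c : ℤ}
    (h : ∀ a b x, B a (C b x) = c • C' b (B' a x)) (m : ℕ)
    (α : V [⋀^Fin m]→ₗ[A] M₁) (β : Forms A V M₂) (γ : Forms A V M) :
    pairWedge B (Pi.single m α) (pairWedge C β γ) =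
      c • pairWedge C' (twist ((-1) ^ m) β) (pairWedge B' (Pi.single m α) γ) := by
  funext n
  induction n generalizing m α β γ with
  | zero =>
    refine zero_ext ?_
    simp only [pairWedge_zero_apply, Pi.smul_apply, AlternatingMap.smul_apply, twist_apply, h,
      pow_zero, one_smul]
  | succ n ih =>
    refine succ_ext_of_contract fun v => ?_
    cases m with
    | zero =>
      simp only [contract_pairWedge, map_add, map_zsmul, contract_single_zero, map_zero,
        LinearMap.zero_apply, zero_add, twist_single, Pi.add_apply,
        Pi.smul_apply, Pi.zero_apply, pow_zero, one_smul, ih, twist_one, smul_add]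
    | succ m =>
      simp only [contract_pairWedge, map_add, map_zsmul, contract_single_succ,
        twist_single, LinearMap.smul_apply, contract_twist, twist_twist,
        Pi.add_apply, Pi.smul_apply, ih, smul_add]
      have h1 : (-1 : ℤ) ^ (m + 1) * (-1) = (-1) ^ m := by rw [pow_succ]; simp
      have h2 : (-1 : ℤ) * (-1) ^ (m + 1) = (-1) ^ m := by rw [mul_comm, h1]
      simp only [h1, h2, smul_comm c]
      abel

end pairings

/-! ### Derivations of modules and of forms -/

section derivations

variable {A : Type*} [CommRing A]

/-- An additive operator `D` on a module with `D(a m) = a D(m) + δ(a) m`. -/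
structure ModDer (δ : A → A) (M : Type*) [AddCommGroup M] [Module A M] extends M →+ M where
  leibniz' (a : A) (m : M) : toFun (a • m) = a • toFun m + δ a • m

namespace ModDer

variable {δ δ' : A → A} {V M M₁ M₂ M₃ : Type*} [AddCommGroup V] [Module A V]
  [AddCommGroup M] [Module A M] [AddCommGroup M₁] [Module A M₁] [AddCommGroup M₂] [Module A M₂]
  [AddCommGroup M₃] [Module A M₃]

instance : FunLike (ModDer δ M) M M where
  coe D := D.toFun
  coe_injective D E h := by
    cases D; cases E; congr; exact DFunLike.coe_injective h

instance : AddMonoidHomClass (ModDer δ M) M M where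
  map_add D := D.map_add'
  map_zero D := D.map_zero'

theorem leibniz (D : ModDer δ M) (a : A) (m : M) : D (a • m) = a • D m + δ a • m := D.leibniz' a m

/-- The operator on alternating maps induced by operators on the arguments and on the values:
`(D ω)(v₁, …, vₙ) = D(ω(v₁, …, vₙ)) - ∑ⱼ ω(v₁, …, D vⱼ, …, vₙ)`. -/
def forms (D : ModDer δ V) (E : ModDer δ M) (n : ℕ) : ModDer δ (V [⋀^Fin n]→ₗ[A] M) where
  toFun ω :=
    { toFun v := E (ω v) - ∑ j, ω (update v j (D (v j)))
      map_update_add' {inst} v i y z := by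
        obtain rfl : inst = instDecidableEqFin n := Subsingleton.elim _ _
        have : ∀ k, ω (update (update v i (y + z)) k (D (update v i (y + z) k))) =
            ω (update (update v i y) k (D (update v i y k))) +
            ω (update (update v i z) k (D (update v i z k))) := by
          intro k
          by_cases hk : k = i
          · subst hk; simp
          · simp only [update_of_ne hk]
            rw [update_comm (Ne.symm hk), update_comm (Ne.symm hk), update_comm (Ne.symm hk),
              ω.map_update_add]
        simp only [this, sum_add_distrib, ω.map_update_add, map_add]
        abel
      map_update_smul' {inst} v i a y := by
        obtain rfl : inst = instDecidableEqFin n := Subsingleton.elim _ _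
        have : ∀ k, ω (update (update v i (a • y)) k (D (update v i (a • y) k))) =
            a • ω (update (update v i y) k (D (update v i y k))) +
            if k = i then δ a • ω (update v i y) else 0 := by
          intro k
          by_cases hk : k = i
          · subst hk; simp [leibniz]
          · simp only [update_of_ne hk, if_neg hk, add_zero]
            rw [update_comm (Ne.symm hk), update_comm (Ne.symm hk), ω.map_update_smul]
        simp only [this, sum_add_distrib, ω.map_update_smul, leibniz, smul_sub,
          smul_sum, sum_ite_eq', mem_univ, if_true]
        abel
      map_eq_zero_of_eq' v i j h hij := by
        have h1 : ∑ k, ω (update v k (D (v k))) = 0 := by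
          rw [← sum_subset (subset_univ {i, j}), sum_pair hij, ← h]
          · exact ω.update_add_update_eq_zero v hij h _
          · intro k _ hk
            simp only [mem_insert, mem_singleton, not_or] at hk
            exact ω.map_eq_zero_of_eq _
              (by rw [update_of_ne (Ne.symm hk.1), update_of_ne (Ne.symm hk.2), h]) hij
        rw [h1, ω.map_eq_zero_of_eq v h hij]; simp }
  map_zero' := by ext v; simp
  map_add' ω η := by
    ext v
    simp only [AlternatingMap.coe_mk, MultilinearMap.coe_mk, AlternatingMap.add_apply, map_add,
      sum_add_distrib]
    abel
  leibniz' a ω := by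
    ext v
    simp only [AlternatingMap.coe_mk, MultilinearMap.coe_mk, AlternatingMap.add_apply,
      AlternatingMap.smul_apply, leibniz, smul_sub, smul_sum]
    abel

theorem forms_apply (D : ModDer δ V) (E : ModDer δ M) {n : ℕ} (ω : V [⋀^Fin n]→ₗ[A] M)
    (v : Fin n → V) : D.forms E n ω v = E (ω v) - ∑ j, ω (update v j (D (v j))) := rfl

/-- The operator on graded forms induced by operators on the arguments and on the values. -/
def onForms (D : ModDer δ V) (E : ModDer δ M) : Forms A V M →+ Forms A V M where
  toFun ω n := D.forms E n (ω n)
  map_zero' := by funext n; exact map_zero _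
  map_add' _ _ := by funext n; exact map_add _ _ _

theorem onForms_apply (D : ModDer δ V) (E : ModDer δ M) (ω : Forms A V M) (n : ℕ) :
    D.onForms E ω n = D.forms E n (ω n) := rfl

theorem onForms_zero_apply (D : ModDer δ V) (E : ModDer δ M) (ω : Forms A V M)
    (v : Fin 0 → V) : D.onForms E ω 0 v = E (ω 0 v) := by
  rw [onForms_apply, forms_apply]
  simp

theorem contract_onForms (D : ModDer δ V) (E : ModDer δ M) (u : V) (ω : Forms A V M) :
    contract u (D.onForms E ω) = D.onForms E (contract u ω) - contract (D u) ω := by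
  funext n
  ext w
  rw [contract_apply, onForms_apply, forms_apply, Pi.sub_apply, AlternatingMap.sub_apply,
    onForms_apply, forms_apply, Fin.sum_univ_succ]
  simp only [Fin.cons_zero, Fin.cons_succ, Fin.update_cons_zero, ← Fin.cons_update,
    contract_apply]
  abel

theorem onForms_twist (D : ModDer δ V) (E : ModDer δ M) (s : ℤ) (ω : Forms A V M) :
    D.onForms E (twist s ω) = twist s (D.onForms E ω) := by
  funext n
  simp only [onForms_apply, twist_apply, map_zsmul]

theorem onForms_single (D : ModDer δ V) (E : ModDer δ M) (k : ℕ) (ω : V [⋀^Fin k]→ₗ[A] M) :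
    D.onForms E (Pi.single k ω) = Pi.single k (D.forms E k ω) := by
  funext n
  by_cases h : n = k
  · subst h; simp [onForms_apply]
  · simp [onForms_apply, h]

/-- Induced operators are derivations for products along an invariant pairing. -/
theorem onForms_pairWedge (D : ModDer δ V) {E₁ : ModDer δ M₁} {E₂ : ModDer δ M₂}
    {E₃ : ModDer δ M₃} {B : M₁ →ₗ[A] M₂ →ₗ[A] M₃}
    (h : ∀ a b, E₃ (B a b) = B (E₁ a) b + B a (E₂ b)) (α : Forms A V M₁) (β : Forms A V M₂) :
    D.onForms E₃ (pairWedge B α β) =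
      pairWedge B (D.onForms E₁ α) β + pairWedge B α (D.onForms E₂ β) := by
  funext n
  induction n generalizing α β with
  | zero =>
    refine zero_ext ?_
    simp only [onForms_zero_apply, pairWedge_zero_apply, h, Pi.add_apply, AlternatingMap.add_apply]
  | succ n ih =>
    refine succ_ext_of_contract fun v => ?_
    simp only [contract_onForms, contract_pairWedge, map_add, map_sub, Pi.add_apply, Pi.sub_apply,
      LinearMap.sub_apply, ih, ← onForms_twist]
    abel

/-- Induced operators satisfy the commutation relations of the given ones. -/
theorem onForms_commutator {δ₁ δ₂ δ₃ : A → A} {D₁ : ModDer δ₁ V} {D₂ : ModDer δ₂ V}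
    {D₃ : ModDer δ₃ V} {E₁ : ModDer δ₁ M} {E₂ : ModDer δ₂ M} {E₃ : ModDer δ₃ M}
    (hD : ∀ v, D₃ v = D₁ (D₂ v) - D₂ (D₁ v)) (hE : ∀ m, E₃ m = E₁ (E₂ m) - E₂ (E₁ m))
    (ω : Forms A V M) : D₃.onForms E₃ ω =
      D₁.onForms E₁ (D₂.onForms E₂ ω) - D₂.onForms E₂ (D₁.onForms E₁ ω) := by
  funext n
  induction n generalizing ω with
  | zero =>
    refine zero_ext ?_
    simp only [onForms_zero_apply, hE, Pi.sub_apply, AlternatingMap.sub_apply]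
  | succ n ih =>
    refine succ_ext_of_contract fun v => ?_
    simp only [contract_onForms, map_sub, Pi.sub_apply, ih, hD, contract_sub_left]
    abel

section lie

variable {L : Type*} [LieRing L] [LieRingModule L A]

/-- The action of an element of a Lie-Rinehart algebra on a module. -/
def ofLie [Module A L] [LieRingModule L M] [LieRinehartModule A L M] (x : L) :
    ModDer (fun a : A => ⁅x, a⁆) M where
  toFun m := ⁅x, m⁆
  map_zero' := lie_zero x
  map_add' := lie_add x
  leibniz' := LieRinehartModule.lie_smul' x

/-- The adjoint action of an element of a Lie-Rinehart algebra. -/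
def ad [Module A L] [LieRinehartRing A L] (x : L) : ModDer (fun a : A => ⁅x, a⁆) L where
  toFun y := ⁅x, y⁆
  map_zero' := lie_zero x
  map_add' := lie_add x
  leibniz' a y := by rw [LieRinehartRing.leibniz_smul_right]

end lie

end ModDer

end derivations

/-! ### The Cartan calculus of the Lie-Rinehart differential -/

section cartan

variable {R A L M M₁ M₂ M₃ : Type*} [CommRing R] [CommRing A] [Algebra R A] [LieRing L]
  [Module A L] [LieAlgebra R L] [LieRingModule L A] [LieRinehartRing A L]
  [AddCommGroup M] [Module A M] [Module R M] [IsScalarTower R A M] [LieRingModule L M]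
  [LieModule R L M] [LieRinehartModule A L M]
  [AddCommGroup M₁] [Module A M₁] [Module R M₁] [IsScalarTower R A M₁] [LieRingModule L M₁]
  [LieModule R L M₁] [LieRinehartModule A L M₁]
  [AddCommGroup M₂] [Module A M₂] [Module R M₂] [IsScalarTower R A M₂] [LieRingModule L M₂]
  [LieModule R L M₂] [LieRinehartModule A L M₂]
  [AddCommGroup M₃] [Module A M₃] [Module R M₃] [IsScalarTower R A M₃] [LieRingModule L M₃]
  [LieModule R L M₃] [LieRinehartModule A L M₃]

open ModDer

theorem removeNth_succ_cons {α : Type*} {n : ℕ} (i : Fin (n + 1)) (a : α) (x : Fin (n + 1) → α) :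
    i.succ.removeNth (Fin.cons a x : Fin (n + 2) → α) = Fin.cons a (i.removeNth x) := by
  funext k
  refine Fin.cases ?_ (fun k => ?_) k
  · simp [Fin.removeNth]
  · simp [Fin.removeNth, Fin.succ_succAbove_succ]

theorem sum_Ioi_zero {n : ℕ} {N : Type*} [AddCommMonoid N] (f : Fin (n + 1) → N) :
    ∑ j ∈ Ioi 0, f j = ∑ j : Fin n, f j.succ := by
  rw [Fin.Ioi_zero_eq_map, sum_map]; rfl

theorem sum_Ioi_succ {n : ℕ} {N : Type*} [AddCommMonoid N] (i : Fin n) (f : Fin (n + 1) → N) :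
    ∑ j ∈ Ioi i.succ, f j = ∑ j ∈ Ioi i, f j.succ := by
  rw [← Fin.map_succEmb_Ioi, sum_map]; rfl

theorem ceFun_cons {n : ℕ} (ω : L [⋀^Fin (n + 1)]→ₗ[A] M) (x : L) (y : Fin (n + 1) → L) :
    ceFun ω (Fin.cons x y) =
      (ad x : ModDer (fun a : A => ⁅x, a⁆) L).forms (ofLie x) (n + 1) ω y
        - ceFun (ω.curryLeft x) y := by
  refine Eq.trans ?_ (sub_eq_add_neg _ _).symm
  rw [ceFun, Fin.sum_univ_succ, forms_apply, sum_Ioi_zero, ceFun, ← sum_neg_distrib]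
  congr 1
  · simp only [Fin.val_zero, pow_zero, one_smul, Fin.cons_zero, Fin.removeNth_zero, Fin.tail_cons,
      Fin.cons_succ, ← Fin.cons_update]
    rfl
  · refine sum_congr rfl fun i _ => ?_
    rw [sum_Ioi_succ]
    simp only [removeNth_succ_cons, Fin.cons_succ, ← Fin.cons_update, Fin.val_succ, pow_succ,
      mul_neg, mul_one, neg_smul]
    rfl

theorem formsD_succ (ω : Forms A L M) (n : ℕ) : formsD R A L M ω (n + 1) = ceD (ω n) := rfl

theorem formsD_zero (ω : Forms A L M) : formsD R A L M ω 0 = 0 := rfl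

/-- Cartan's formula `i_x d + d i_x = L_x`. -/
theorem contract_formsD (x : L) (ω : Forms A L M) :
    contract x (formsD R A L M ω) =
      (ad x : ModDer (fun a : A => ⁅x, a⁆) L).onForms (ofLie x) ω
        - formsD R A L M (contract x ω) := by
  funext n
  ext y
  rw [contract_apply, formsD_succ, ceD_apply, Pi.sub_apply, AlternatingMap.sub_apply]
  cases n with
  | zero =>
    rw [formsD_zero, onForms_zero_apply, AlternatingMap.zero_apply, sub_zero, ceFun]
    simp only [Fin.sum_univ_succ, univ_eq_empty, sum_empty, sum_Ioi_zero]
    simp only [Fin.val_zero, pow_zero, one_smul, Fin.cons_zero, Fin.removeNth_zero, Fin.tail_cons,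
      add_zero, sub_zero]
    rfl
  | succ n =>
    rw [ceFun_cons]
    rfl

theorem formsD_twist_neg_one (ω : Forms A L M) :
    formsD R A L M (twist (-1) ω) = - twist (-1) (formsD R A L M ω) := by
  funext n
  cases n with
  | zero => simp [formsD_zero, twist_apply]
  | succ n =>
    have h : ∀ (c : ℤ) (η : L [⋀^Fin n]→ₗ[A] M), ceD (c • η) = c • ceD η :=
      fun c η => map_zsmul (ceLinear R : (L [⋀^Fin n]→ₗ[A] M) →ₗ[R] _) c η
    rw [formsD_succ, Pi.neg_apply, twist_apply, twist_apply, formsD_succ, h, pow_succ]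
    simp

/-- The differential is a graded derivation for products along an invariant pairing. -/
theorem formsD_pairWedge {B : M₁ →ₗ[A] M₂ →ₗ[A] M₃}
    (h : ∀ (x : L) a b, ⁅x, B a b⁆ = B ⁅x, a⁆ b + B a ⁅x, b⁆) (α : Forms A L M₁)
    (β : Forms A L M₂) :
    formsD R A L M₃ (pairWedge B α β) =
      pairWedge B (formsD R A L M₁ α) β + pairWedge B (twist (-1) α) (formsD R A L M₂ β) := by
  funext n
  induction n generalizing α β with
  | zero =>
    refine zero_ext ?_
    simp only [Pi.add_apply, AlternatingMap.add_apply, pairWedge_zero_apply, formsD_zero,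
      AlternatingMap.zero_apply, map_zero, LinearMap.zero_apply, add_zero]
  | succ n ih =>
    refine succ_ext_of_contract fun v => ?_
    have hL := fun a b => onForms_pairWedge (ad v : ModDer (fun a : A => ⁅v, a⁆) L)
      (E₁ := ofLie v) (E₂ := ofLie v) (E₃ := ofLie v) (h v) (α := a) (β := b)
    simp only [contract_formsD, contract_pairWedge, map_add, map_sub, Pi.add_apply, Pi.sub_apply,
      LinearMap.sub_apply, ih, hL, formsD_twist_neg_one, twist_twist, contract_twist]
    simp only [map_neg, LinearMap.neg_apply, Pi.neg_apply, neg_smul, one_smul, mul_neg, mul_one,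
      neg_neg, twist_one]
    abel

theorem onForms_ad_formsD (z : L) (ω : Forms A L M) :
    (ad z : ModDer (fun a : A => ⁅z, a⁆) L).onForms (ofLie z) (formsD R A L M ω) =
      formsD R A L M ((ad z : ModDer (fun a : A => ⁅z, a⁆) L).onForms (ofLie z) ω) := by
  funext n
  induction n generalizing ω with
  | zero =>
    refine zero_ext ?_
    simp only [onForms_zero_apply, formsD_zero, AlternatingMap.zero_apply, map_zero]
  | succ n ih =>
    refine succ_ext_of_contract fun w => ?_
    have hc := onForms_commutator (D₁ := (ad z : ModDer (fun a : A => ⁅z, a⁆) L)) (D₂ := ad w)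
      (D₃ := ad ⁅z, w⁆) (E₁ := ofLie z) (E₂ := ofLie w) (E₃ := ofLie ⁅z, w⁆)
      (fun v => lie_lie z w v) (fun m => lie_lie z w m) ω
    have hz : (ad z : ModDer (fun a : A => ⁅z, a⁆) L) w = ⁅z, w⁆ := rfl
    simp only [contract_formsD, contract_onForms, map_sub, Pi.sub_apply, ih, hz, hc]
    abel

/-- The Lie-Rinehart differential squares to zero. -/
theorem formsD_formsD (ω : Forms A L M) : formsD R A L M (formsD R A L M ω) = 0 := by
  funext n
  induction n generalizing ω with
  | zero => rfl
  | succ n ih =>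
    refine succ_ext_of_contract fun w => ?_
    simp only [contract_formsD, onForms_ad_formsD, map_sub, Pi.sub_apply, ih, map_zero]
    simp

end cartan

/-! ### Change of coefficients and decomposable forms -/

section coefficients

variable {A V M M' M₁ M₂ M₃ M₄ : Type*} [CommRing A] [AddCommGroup V] [Module A V]
  [AddCommGroup M] [Module A M] [AddCommGroup M'] [Module A M'] [AddCommGroup M₁] [Module A M₁]
  [AddCommGroup M₂] [Module A M₂] [AddCommGroup M₃] [Module A M₃] [AddCommGroup M₄] [Module A M₄]

/-- The effect of a linear map of the coefficients on forms. -/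
def mapForms (f : M →ₗ[A] M') : Forms A V M →ₗ[A] Forms A V M' where
  toFun ω n := f.compAlternatingMap (ω n)
  map_add' _ _ := by funext n; ext v; simp
  map_smul' _ _ := by funext n; ext v; simp

theorem mapForms_apply (f : M →ₗ[A] M') (ω : Forms A V M) (n : ℕ) (v : Fin n → V) :
    mapForms f ω n v = f (ω n v) := rfl

theorem contract_mapForms (f : M →ₗ[A] M') (v : V) (ω : Forms A V M) :
    contract v (mapForms f ω) = mapForms f (contract v ω) := rfl

theorem mapForms_pairWedge {f : M₃ →ₗ[A] M₄} {f' : M₂ →ₗ[A] M} {B : M₁ →ₗ[A] M₂ →ₗ[A] M₃}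
    {B' : M₁ →ₗ[A] M →ₗ[A] M₄} {c : ℤ} (h : ∀ a b, f (B a b) = c • B' a (f' b))
    (α : Forms A V M₁) (β : Forms A V M₂) :
    mapForms f (pairWedge B α β) = c • pairWedge B' α (mapForms f' β) := by
  funext n
  ext v
  simp only [Pi.smul_apply, AlternatingMap.smul_apply, mapForms_apply, pairWedge_apply, map_sum,
    map_zsmul, h, smul_sum]
  exact sum_congr rfl fun S _ => smul_comm _ _ _

theorem pairWedge_single_zero (B : M₁ →ₗ[A] M₂ →ₗ[A] M₃) (c : V [⋀^Fin 0]→ₗ[A] M₁)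
    (β : Forms A V M₂) : pairWedge B (Pi.single 0 c) β = mapForms (B (c ![])) β := by
  funext n
  induction n generalizing β with
  | zero =>
    refine zero_ext ?_
    rw [pairWedge_zero_apply, mapForms_apply, Pi.single_eq_same]
  | succ n ih =>
    refine succ_ext_of_contract fun v => ?_
    rw [contract_pairWedge, contract_single_zero, map_zero, LinearMap.zero_apply, zero_add,
      twist_single, pow_zero, one_smul, ih, contract_mapForms]

/-- The form `α ⊗ x`, for a scalar form `α`. -/
def tensorForm (x : M) : Forms A V A →ₗ[A] Forms A V M :=
  mapForms (LinearMap.toSpanSingleton A M x)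

theorem tensorForm_apply (x : M) (α : Forms A V A) (n : ℕ) (v : Fin n → V) :
    tensorForm x α n v = α n v • x := rfl

theorem tensorForm_single (x : M) (k : ℕ) (α : V [⋀^Fin k]→ₗ[A] A) :
    tensorForm x (Pi.single k α : Forms A V A) =
      Pi.single k ((LinearMap.toSpanSingleton A M x).compAlternatingMap α) := by
  funext n
  by_cases h : n = k
  · subst h
    ext v
    simp [tensorForm_apply]
  · ext v
    simp [tensorForm_apply, h]

theorem wedge_single_zero (α : Forms A V A) (c : V [⋀^Fin 0]→ₗ[A] M) :
    wedge α (Pi.single 0 c) = tensorForm (c ![]) α := by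
  funext n
  induction n generalizing α with
  | zero =>
    refine zero_ext ?_
    rw [wedge_eq_pairWedge, pairWedge_zero_apply, tensorForm_apply, Pi.single_eq_same]
    rfl
  | succ n ih =>
    refine succ_ext_of_contract fun v => ?_
    rw [wedge_eq_pairWedge, contract_pairWedge, contract_single_zero, map_zero, add_zero,
      ← wedge_eq_pairWedge, ih]
    rfl

theorem wedge_single_zero_left (c : V [⋀^Fin 0]→ₗ[A] A) (β : Forms A V M) :
    wedge (Pi.single 0 c) β = c ![] • β := by
  rw [wedge_eq_pairWedge, pairWedge_single_zero]
  rfl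

theorem pairWedge_tensorForm (B : M₁ →ₗ[A] M₂ →ₗ[A] M₃) (x : M₁) (α : Forms A V A)
    (β : Forms A V M₂) : pairWedge B (tensorForm x α) β =
      pairWedge (LinearMap.lsmul A M₃) α (mapForms (B x) β) := by
  funext n
  ext v
  simp only [pairWedge_apply]
  refine sum_congr rfl fun S _ => ?_
  change _ • B (evalOn α S v • x) _ = _ • evalOn α S v • B x (evalOn β Sᶜ v)
  rw [map_smul]
  rfl

theorem alternatingMap_sum_apply {ι κ : Type*} (s : Finset κ) (f : κ → V [⋀^ι]→ₗ[A] M)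
    (v : ι → V) : (∑ b ∈ s, f b) v = ∑ b ∈ s, f b v :=
  map_sum (AddMonoidHom.mk' (fun g : V [⋀^ι]→ₗ[A] M => g v) fun _ _ => rfl) f s

/-- Forms with values in a finitely generated projective module are sums of decomposable ones. -/
theorem exists_sum_tensorForm [Module.Finite A M] [Module.Projective A M] :
    ∃ (n : ℕ) (x : Fin n → M) (φ : Fin n → M →ₗ[A] A), ∀ (k : ℕ) (ω : V [⋀^Fin k]→ₗ[A] M),
      ω = ∑ b, (LinearMap.toSpanSingleton A M (x b)).compAlternatingMap
        ((φ b).compAlternatingMap ω) := by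
  obtain ⟨n, f, hf⟩ := Module.Finite.exists_fin' A M
  obtain ⟨g, hg⟩ := Module.projective_lifting_property f LinearMap.id hf
  refine ⟨n, fun b => f (Pi.single b 1), fun b => (LinearMap.proj b).comp g, fun k ω => ?_⟩
  ext v
  have h1 : f (g (ω v)) = ω v := LinearMap.congr_fun hg (ω v)
  rw [alternatingMap_sum_apply]
  conv_lhs => rw [← h1, pi_eq_sum_univ' (g (ω v)), map_sum]
  refine sum_congr rfl fun b _ => ?_
  simp

end coefficients

/-! ### Operators on bigraded forms -/

section operators

open ModDer

variable (R : Type*) {A L' L'' : Type*} [CommRing R] [CommRing A] [Algebra R A]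
  [LieRing L'] [LieAlgebra R L'] [Module A L'] [LieRingModule L' A] [LieRinehartRing A L']
  [LieRinehartAlgebra R A L']
  [LieRing L''] [LieAlgebra R L''] [Module A L''] [LieRingModule L'' A] [LieRinehartRing A L'']
  [LieRinehartAlgebra R A L'']
  [LieRingModule L' L''] [LieModule R L' L''] [LieRinehartModule A L' L'']
  [LieRingModule L'' L'] [LieModule R L'' L'] [LieRinehartModule A L'' L']

theorem evalOn_tensorForm {V M : Type*} [AddCommGroup V] [Module A V] [AddCommGroup M] [Module A M]
    {n : ℕ} (α : Forms A V A) (x : M) (S : Finset (Fin n)) (v : Fin n → V) :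
    evalOn (tensorForm x α) S v = evalOn α S v • x := rfl

/-- The insertion pairing `(x, f) ↦ f(x, -)`. -/
def insertPairing (A W M : Type*) [CommRing A] [AddCommGroup W] [Module A W] [AddCommGroup M]
    [Module A M] (p : ℕ) :
    W →ₗ[A] (W [⋀^Fin (p + 1)]→ₗ[A] M) →ₗ[A] (W [⋀^Fin p]→ₗ[A] M) :=
  AlternatingMap.curryLeftLinearMap.flip

theorem insertPairing_comm {A W M : Type*} [CommRing A] [AddCommGroup W] [Module A W]
    [AddCommGroup M] [Module A M] (p : ℕ) (x y : W) (f : W [⋀^Fin (p + 2)]→ₗ[A] M) :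
    insertPairing A W M p x (insertPairing A W M (p + 1) y f) =
      (-1 : ℤ) • insertPairing A W M p y (insertPairing A W M (p + 1) x f) := by
  have h1 := f.curryLeft_same (x + y)
  simp only [map_add, AlternatingMap.curryLeft_add, LinearMap.add_apply,
    AlternatingMap.curryLeft_same, zero_add, add_zero] at h1
  rw [neg_one_smul, eq_neg_iff_add_eq_zero, ← h1]
  rfl

/-- Insertion of `x ∈ L'` in bigraded forms. -/
def insertOp (x : L') : Module.End ℤ (BiForms A L' L'') := AddMonoidHom.toIntLinearMap
  { toFun := fun (F : BiForms A L' L'') p => mapForms (insertPairing A L' A p x) (F (p + 1))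
    map_zero' := by funext p; simp
    map_add' := fun (_ _ : BiForms A L' L'') => by funext p; simp }

/-- Insertion of `ξ ∈ Alt_A(L'', L')` in bigraded forms. -/
def insertFormOp : Forms A L'' L' →+ Module.End ℤ (BiForms A L' L'') where
  toFun ξ :=
    AddMonoidHom.toIntLinearMap
      { toFun := fun (F : BiForms A L' L'') p => pairWedge (insertPairing A L' A p) ξ (F (p + 1))
        map_zero' := by funext p; simp
        map_add' := fun (_ _ : BiForms A L' L'') => by funext p; simp }
  map_zero' := by
    refine LinearMap.ext fun F => funext fun p => ?_
    change pairWedge _ 0 _ = 0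
    simp
  map_add' ξ η := by
    refine LinearMap.ext fun F => funext fun p => ?_
    change pairWedge _ (ξ + η) _ = pairWedge _ ξ _ + pairWedge _ η _
    simp

/-- Multiplication by a scalar form `α ∈ Alt_A(L'', A)`. -/
def wedgeOp : Forms A L'' A →+ Module.End ℤ (BiForms A L' L'') where
  toFun α :=
    AddMonoidHom.toIntLinearMap
      { toFun := fun (F : BiForms A L' L'') p => pairWedge (LinearMap.lsmul A _) α (F p)
        map_zero' := by funext p; simp
        map_add' := fun (_ _ : BiForms A L' L'') => by funext p; simp }
  map_zero' := by
    refine LinearMap.ext fun F => funext fun p => ?_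
    change pairWedge _ 0 _ = 0
    simp
  map_add' ξ η := by
    refine LinearMap.ext fun F => funext fun p => ?_
    change pairWedge _ (ξ + η) _ = pairWedge _ ξ _ + pairWedge _ η _
    simp

/-- The Lie derivative along `x ∈ L'` of bigraded forms. -/
def lieOp (x : L') : Module.End ℤ (BiForms A L' L'') := AddMonoidHom.toIntLinearMap
  { toFun := fun (F : BiForms A L' L'') p =>
      (ofLie x).onForms ((ad x : ModDer (fun a : A => ⁅x, a⁆) L').forms (ofLie x) p) (F p)
    map_zero' := by funext p; simp
    map_add' := fun (_ _ : BiForms A L' L'') => by funext p; simp }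

/-- The forms on `L'` with values in `Alt^q_A(L'', A)` that correspond to a bigraded form. -/
def swapForms (q : ℕ) : BiForms A L' L'' →+ Forms A L' (L'' [⋀^Fin q]→ₗ[A] A) where
  toFun F p := altSwap R (F p q)
  map_zero' := by funext p; simp
  map_add' _ _ := by funext p; simp

variable (A L' L'') in
/-- The operator `d'` on bigraded forms. -/
def dPrimeOp : Module.End ℤ (BiForms A L' L'') := AddMonoidHom.toIntLinearMap
  { toFun := fun (F : BiForms A L' L'') p q => altSwap R (formsD R A L' _ (swapForms R q F) p)
    map_zero' := by funext p q; simp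
    map_add' := fun (_ _ : BiForms A L' L'') => by funext p q; simp }

variable (A L' L'') in
/-- The operator `d''` on bigraded forms. -/
def dDoublePrimeOp : Module.End ℤ (BiForms A L' L'') := AddMonoidHom.toIntLinearMap
  { toFun := fun (F : BiForms A L' L'') p => formsD R A L'' _ (F p)
    map_zero' := by funext p; simp
    map_add' := fun (_ _ : BiForms A L' L'') => by funext p; simp }

theorem biFormsD_apply (F : BiForms A L' L'') (p : ℕ) :
    biFormsD R A L' L'' F p =
      dPrimeOp R A L' L'' F p + (-1 : ℤ) ^ p • dDoublePrimeOp R A L' L'' F p := by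
  funext q
  change _ = dPrimeOp R A L' L'' F p q + (-1 : ℤ) ^ p • dDoublePrimeOp R A L' L'' F p q
  have h : altSwap R (0 : L' [⋀^Fin 0]→ₗ[A] (L'' [⋀^Fin q]→ₗ[A] A)) = 0 := map_zero _
  cases p with
  | zero =>
    have h0 : dPrimeOp R A L' L'' F 0 q = 0 := h
    rw [h0]
    cases q <;> rfl
  | succ p => cases q <;> rfl

theorem insertOp_apply (x : L') (F : BiForms A L' L'') (p : ℕ) :
    insertOp x F p = mapForms (insertPairing A L' A p x) (F (p + 1)) := rfl

theorem insertFormOp_apply (ξ : Forms A L'' L') (F : BiForms A L' L'') (p : ℕ) :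
    insertFormOp ξ F p = pairWedge (insertPairing A L' A p) ξ (F (p + 1)) := rfl

theorem wedgeOp_apply (α : Forms A L'' A) (F : BiForms A L' L'') (p : ℕ) :
    wedgeOp α F p = pairWedge (LinearMap.lsmul A _) α (F p) := rfl

theorem dPrimeOp_apply_zero (F : BiForms A L' L'') : dPrimeOp R A L' L'' F 0 = 0 :=
  funext fun _ => map_zero (altSwap R)

theorem biForms_succ_ext {F G : BiForms A L' L''} {p : ℕ}
    (h : ∀ x, insertOp x F p = insertOp x G p) : F (p + 1) = G (p + 1) := by
  funext q
  ext v x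
  have := congrArg (fun ω : Forms A L'' (L' [⋀^Fin p]→ₗ[A] A) => ω q v (Fin.tail x)) (h (x 0))
  rw [← Fin.cons_self_tail x]
  exact this

theorem insertOp_mul_wedgeOp (x : L') (α : Forms A L'' A) :
    insertOp x * wedgeOp α = wedgeOp α * insertOp (A := A) (L'' := L'') x := by
  refine LinearMap.ext fun F => funext fun p => ?_
  have := mapForms_pairWedge (f := insertPairing A L' A p x) (f' := insertPairing A L' A p x)
    (B := LinearMap.lsmul A _) (B' := LinearMap.lsmul A _) (c := 1)
    (by intro a b; rw [one_smul]; exact map_smul _ a b) α (F (p + 1))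
  rw [one_smul] at this
  exact this

theorem insertOp_mul_insertFormOp (x : L') (ξ : Forms A L'' L') :
    insertOp x * insertFormOp ξ = - (insertFormOp ξ * insertOp (A := A) (L'' := L'') x) := by
  refine LinearMap.ext fun F => funext fun p => ?_
  have := mapForms_pairWedge (f := insertPairing A L' A p x)
    (f' := insertPairing A L' A (p + 1) x)
    (B := insertPairing A L' A (p + 1)) (B' := insertPairing A L' A p) (c := -1)
    (fun a b => insertPairing_comm p x a b) ξ (F (p + 2))
  rw [neg_one_smul] at this
  exact this

theorem insertOp_mul_insertOp (x y : L') :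
    insertOp x * insertOp y = - (insertOp y * insertOp (A := A) (L'' := L'') x) := by
  refine LinearMap.ext fun F => funext fun p => funext fun q => ?_
  ext v : 1
  refine (insertPairing_comm p x y (F (p + 2) q v)).trans (neg_one_smul ℤ _)

theorem insertOp_mul_lieOp (x z : L') :
    insertOp x * lieOp z = lieOp z * insertOp x - insertOp (A := A) (L'' := L'') ⁅z, x⁆ := by
  refine LinearMap.ext fun F => funext fun p => funext fun q => ?_
  ext v y
  have h : ∀ f : L' [⋀^Fin (p + 1)]→ₗ[A] A,
      insertPairing A L' A p x ((ad z : ModDer (fun a : A => ⁅z, a⁆) L').forms (ofLie z) (p + 1) f)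
      = (ad z : ModDer (fun a : A => ⁅z, a⁆) L').forms (ofLie z) p (insertPairing A L' A p x f)
        - insertPairing A L' A p ⁅z, x⁆ f := by
    intro f
    have := contract_onForms (ad z : ModDer (fun a : A => ⁅z, a⁆) L') (ofLie z) x
      (Pi.single (p + 1) f : Forms A L' A)
    have h2 := congrFun this p
    simp only [onForms_single, contract_single_succ, Pi.single_eq_same, Pi.sub_apply] at h2
    exact h2
  have e : insertOp x (lieOp z F) p q v =
      lieOp z (insertOp x F) p q v - insertOp ⁅z, x⁆ F p q v := by
    change insertPairing A L' A p x ((ad z : ModDer (fun a : A => ⁅z, a⁆) L').forms (ofLie z)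
      (p + 1) (F (p + 1) q v) - ∑ j, F (p + 1) q (update v j ⁅z, v j⁆)) =
      (ad z : ModDer (fun a : A => ⁅z, a⁆) L').forms (ofLie z) p
      (insertPairing A L' A p x (F (p + 1) q v)) -
      ∑ j, insertPairing A L' A p x (F (p + 1) q (update v j ⁅z, v j⁆)) -
      insertPairing A L' A p ⁅z, x⁆ (F (p + 1) q v)
    rw [map_sub, h, map_sum]
    abel
  exact congrArg (fun f : L' [⋀^Fin p]→ₗ[A] A => f y) e

theorem insertFormOp_tensorForm (x : L') (α : Forms A L'' A) :
    insertFormOp (tensorForm x α) = wedgeOp α * insertOp (A := A) x :=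
  LinearMap.ext fun F => funext fun p => pairWedge_tensorForm _ x α (F (p + 1))

theorem wedgeOp_mul_wedgeOp (α β : Forms A L'' A) :
    wedgeOp α * wedgeOp β = wedgeOp (L' := L') (wedge α β) := by
  refine LinearMap.ext fun F => funext fun p => ?_
  have := pairWedge_assoc (B := LinearMap.lsmul A A)
    (C := LinearMap.lsmul A (L' [⋀^Fin p]→ₗ[A] A)) (B' := LinearMap.lsmul A _)
    (C' := LinearMap.lsmul A _) (fun a b x => mul_smul a b x) α β (F p)
  exact this.symm

theorem wedgeOp_mul_insertFormOp (α : Forms A L'' A) (ξ : Forms A L'' L') :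
    wedgeOp α * insertFormOp ξ = insertFormOp (A := A) (wedge α ξ) := by
  refine LinearMap.ext fun F => funext fun p => ?_
  have := pairWedge_assoc (B := LinearMap.lsmul A L')
    (C := insertPairing A L' A p) (B' := LinearMap.lsmul A _)
    (C' := insertPairing A L' A p) (fun a b x => by
      rw [LinearMap.lsmul_apply, map_smul]; rfl) α ξ (F (p + 1))
  exact this.symm

theorem wedgeOp_comm {m n : ℕ} (α : L'' [⋀^Fin m]→ₗ[A] A) (β : L'' [⋀^Fin n]→ₗ[A] A) :
    wedgeOp (Pi.single m α) * wedgeOp (Pi.single n β) = (-1 : ℤ) ^ (m * n) •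
      (wedgeOp (Pi.single n β) * wedgeOp (L' := L') (Pi.single m α)) := by
  refine LinearMap.ext fun F => funext fun p => ?_
  have := pairWedge_comm (B := LinearMap.lsmul A (L' [⋀^Fin p]→ₗ[A] A)) (C := LinearMap.lsmul A _)
    (B' := LinearMap.lsmul A _) (C' := LinearMap.lsmul A _) (c := 1)
    (fun a b x => by rw [one_smul]; exact smul_comm a b x) m α (Pi.single n β) (F p)
  rw [one_smul, twist_single, ← pow_mul, map_zsmul] at this
  exact this

theorem wedgeOp_insertFormOp_comm {m n : ℕ} (α : L'' [⋀^Fin m]→ₗ[A] A)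
    (ξ : L'' [⋀^Fin n]→ₗ[A] L') :
    wedgeOp (Pi.single m α) * insertFormOp (Pi.single n ξ) = (-1 : ℤ) ^ (m * n) •
      (insertFormOp (Pi.single n ξ) * wedgeOp (Pi.single m α)) := by
  refine LinearMap.ext fun F => funext fun p => ?_
  have := pairWedge_comm (B := LinearMap.lsmul A (L' [⋀^Fin p]→ₗ[A] A))
    (C := insertPairing A L' A p)
    (B' := LinearMap.lsmul A _) (C' := insertPairing A L' A p) (c := 1)
    (fun a b x => by rw [one_smul]; exact (map_smul (insertPairing A L' A p b) a x).symm)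
    m α (Pi.single n ξ) (F (p + 1))
  rw [one_smul, twist_single, ← pow_mul, map_zsmul] at this
  exact this

theorem insertFormOp_comm {m n : ℕ} (ξ : L'' [⋀^Fin m]→ₗ[A] L') (η : L'' [⋀^Fin n]→ₗ[A] L') :
    insertFormOp (Pi.single m ξ) * insertFormOp (Pi.single n η) = -(-1 : ℤ) ^ (m * n) •
      (insertFormOp (Pi.single n η) * insertFormOp (A := A) (Pi.single m ξ)) := by
  refine LinearMap.ext fun F => funext fun p => ?_
  have := pairWedge_comm (B := insertPairing A L' A p)
    (C := insertPairing A L' A (p + 1))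
    (B' := insertPairing A L' A (p + 1)) (C' := insertPairing A L' A p) (c := -1)
    (fun a b x => insertPairing_comm p a b x) m ξ (Pi.single n η) (F (p + 2))
  rw [twist_single, ← pow_mul, map_zsmul, neg_one_smul, LinearMap.smul_apply, ← neg_smul] at this
  exact this

theorem lieOp_mul_wedgeOp (x : L') (α : Forms A L'' A) :
    lieOp x * wedgeOp α = wedgeOp ((ofLie x).onForms (ofLie x) α) +
      wedgeOp α * lieOp (A := A) (L'' := L'') x :=
  LinearMap.ext fun F => funext fun p =>
    onForms_pairWedge (ofLie x) (E₁ := ofLie x) (B := LinearMap.lsmul A _)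
      (fun a m => by
        rw [LinearMap.lsmul_apply, ModDer.leibniz, add_comm]; rfl) α (F p)

/-- Cartan's formula for `d'`. -/
theorem insertOp_dPrimeOp (x : L') :
    insertOp x * dPrimeOp R A L' L'' + dPrimeOp R A L' L'' * insertOp x = lieOp x := by
  refine LinearMap.ext fun F => funext fun p => funext fun q => ?_
  ext v y
  have h := contract_formsD (R := R) x (swapForms R q F)
  have h1 := congrArg (fun ω : Forms A L' (L'' [⋀^Fin q]→ₗ[A] A) => ω p y v)
    (eq_sub_iff_add_eq.mp h)
  refine Eq.trans h1 ?_
  change ⁅x, F p q v y⁆ - ∑ j, F p q (update v j ⁅x, v j⁆) y -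
    (∑ j, altSwap R (F p q) (update y j ⁅x, y j⁆)) v = _
  have e : (lieOp x F p q) v y = (⁅x, F p q v y⁆ - ∑ j, F p q v (update y j ⁅x, y j⁆)) -
    (∑ j, F p q (update v j ⁅x, v j⁆)) y := rfl
  refine Eq.trans ?_ e.symm
  rw [alternatingMap_sum_apply, alternatingMap_sum_apply]
  change _ - _ - ∑ j, F p q v (update y j ⁅x, y j⁆) = _
  abel

end operators

/-! ### The crossed product and the operator `d'` -/

section

variable {A V M : Type*} [CommRing A] [AddCommGroup V] [Module A V] [AddCommGroup M] [Module A M]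

/-- A property of homogeneous forms that is additive and holds for decomposable forms holds for
all forms with values in a finitely generated projective module. -/
theorem forms_induction [Module.Finite A M] [Module.Projective A M] {k : ℕ}
    {P : Forms A V M → Prop} (h0 : P 0) (hadd : ∀ ω η, P ω → P η → P (ω + η))
    (ht : ∀ x (α : V [⋀^Fin k]→ₗ[A] A), P (tensorForm x (Pi.single k α)))
    (ω : V [⋀^Fin k]→ₗ[A] M) : P (Pi.single k ω) := by
  obtain ⟨n, x, φ, h⟩ := exists_sum_tensorForm (A := A) (V := V) (M := M)
  have e : (Pi.single k ω : Forms A V M) =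
      ∑ b, tensorForm (x b) (Pi.single k ((φ b).compAlternatingMap ω)) := by
    simp only [tensorForm_single]
    conv_lhs => rw [h k ω]
    exact map_sum (AddMonoidHom.single (fun n => V [⋀^Fin n]→ₗ[A] M) k) _ _
  rw [e]
  exact sum_induction _ P (fun a b => hadd a b) h0 fun b _ => ht _ _

end

section crossed

variable {A K V M : Type*} [CommRing A] [LieRing K] [Module A K] [LieRingModule K A]
  [LieRinehartRing A K] [AddCommGroup V] [Module A V] [LieRingModule K V] [LieRinehartModule A K V]
  [AddCommGroup M] [Module A M]

open ModDer

theorem crossedBracket_apply (ξ η : Forms A V K) (n : ℕ) (v : Fin n → V) :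
    crossedBracket ξ η n v = ∑ S : Finset (Fin n), shuffleSign S •
      (⁅evalOn ξ S v, evalOn η Sᶜ v⁆ - derivSum η (evalOn ξ S v) Sᶜ v
        + derivSum ξ (evalOn η Sᶜ v) S v) := rfl

theorem derivSum_add_form {n : ℕ} (ω η : Forms A V M) (y : K) (S : Finset (Fin n)) (v : Fin n → V) :
    derivSum (ω + η) y S v = derivSum ω y S v + derivSum η y S v := by
  simp only [derivSum, evalOn_add, sum_add_distrib]

theorem crossedBracket_add_left (ξ ξ' η : Forms A V K) :
    crossedBracket (ξ + ξ') η = crossedBracket ξ η + crossedBracket ξ' η := by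
  funext n
  ext v
  simp only [Pi.add_apply, AlternatingMap.add_apply, crossedBracket_apply, ← sum_add_distrib,
    ← smul_add, evalOn_add, add_lie, derivSum_add, derivSum_add_form]
  refine sum_congr rfl fun S _ => ?_
  congr 1
  abel

theorem crossedBracket_add_right (ξ η η' : Forms A V K) :
    crossedBracket ξ (η + η') = crossedBracket ξ η + crossedBracket ξ η' := by
  funext n
  ext v
  simp only [Pi.add_apply, AlternatingMap.add_apply, crossedBracket_apply, ← sum_add_distrib,
    ← smul_add, evalOn_add, lie_add, derivSum_add, derivSum_add_form]
  refine sum_congr rfl fun S _ => ?_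
  congr 1
  abel

theorem crossedBracket_zero_left (η : Forms A V K) : crossedBracket 0 η = 0 := by
  have := crossedBracket_add_left (0 : Forms A V K) 0 η
  simpa using this

theorem crossedBracket_zero_right (ξ : Forms A V K) : crossedBracket ξ 0 = 0 := by
  have := crossedBracket_add_right ξ (0 : Forms A V K) 0
  simpa using this

theorem sum_eq_sum_orderEmbOfFin {n : ℕ} {N : Type*} [AddCommMonoid N] (S : Finset (Fin n))
    (f : Fin n → N) : ∑ i ∈ S, f i = ∑ j : Fin S.card, f (S.orderEmbOfFin rfl j) := by
  conv_lhs => rw [← S.map_orderEmbOfFin_univ rfl, sum_map]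
  rfl

theorem derivSum_eq {n : ℕ} (ω : Forms A V M) (y : K) (S : Finset (Fin n)) (v : Fin n → V) :
    derivSum ω y S v = ∑ j, ω S.card (update (v ∘ S.orderEmbOfFin rfl) j
      ⁅y, (v ∘ S.orderEmbOfFin rfl) j⁆) := by
  rw [derivSum, sum_eq_sum_orderEmbOfFin]
  refine sum_congr rfl fun j _ => ?_
  rw [evalOn, update_comp_eq_of_injective _ (S.orderEmbOfFin rfl).injective]
  rfl

theorem evalOn_onForms_ofLie {n : ℕ} [LieRingModule K M] [LieRinehartModule A K M]
    (ω : Forms A V M) (y : K) (S : Finset (Fin n)) (v : Fin n → V) :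
    evalOn ((ofLie y).onForms (ofLie y) ω) S v = ⁅y, evalOn ω S v⁆ - derivSum ω y S v := by
  rw [derivSum_eq]; rfl

/-- The crossed product bracket of decomposable forms. -/
theorem crossedBracket_tensorForm (x y : K) (α β : Forms A V A) :
    crossedBracket (tensorForm x α) (tensorForm y β) =
      tensorForm ⁅x, y⁆ (wedge α β) + tensorForm y (wedge α ((ofLie x).onForms (ofLie x) β)) -
        tensorForm x (wedge ((ofLie y).onForms (ofLie y) α) β) := by
  funext n
  ext v
  simp only [Pi.add_apply, Pi.sub_apply, AlternatingMap.add_apply, AlternatingMap.sub_apply,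
    tensorForm_apply, crossedBracket_apply, wedge_eq_pairWedge, pairWedge_apply, sum_smul,
    ← sum_add_distrib, ← sum_sub_distrib, smul_assoc, ← smul_add, ← smul_sub]
  refine sum_congr rfl fun S _ => ?_
  congr 1
  have hd : ∀ (γ : Forms A V A) (z u : K) (T : Finset (Fin n)),
      derivSum (tensorForm z γ) u T v = derivSum γ u T v • z := by
    intro γ z u T
    simp only [derivSum, evalOn_tensorForm, sum_smul]
  have hl : ∀ (a b : A), ⁅a • x, b • y⁆ =
      (a * b) • ⁅x, y⁆ + (a * ⁅x, b⁆) • y - (b * ⁅y, a⁆) • x := by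
    intro a b
    have h1 : ⁅a • x, y⁆ = a • ⁅x, y⁆ - ⁅y, a⁆ • x := by
      rw [← lie_skew, LieRinehartRing.leibniz_smul_right, ← lie_skew x y, smul_neg]
      abel
    rw [LieRinehartRing.leibniz_smul_right, h1, LieRinehartRing.lie_smul_eq_mul]
    simp only [smul_sub, smul_smul, mul_comm b]
    abel
  simp only [evalOn_tensorForm, evalOn_onForms_ofLie, hd, hl, derivSum_smul, LinearMap.lsmul_apply,
    smul_eq_mul, mul_sub, sub_mul, sub_smul]
  simp only [mul_comm]
  abel

end crossed

section ringIdentities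

variable {T : Type*} [Ring T] {E F ix iy d L Lx Ex Ey Fx ixy : T} {s : ℤ}

/-- The relation `[i_x, [d, e_α]] = e_{x α}` that follows from Cartan's formula, for an insertion
`i_x` that commutes with a multiplication `e_α`. -/
theorem insert_mul_commutator (hL : ix * d + d * ix = L) (hE : ix * E = E * ix)
    (hLE : L * E = Ex + E * L) :
    ix * (d * E - E * d) = Ex - (d * E - E * d) * ix := by
  have h1 : ix * d = L - d * ix := eq_sub_of_add_eq hL
  calc ix * (d * E - E * d) = (ix * d) * E - (ix * E) * d := by noncomm_ring
    _ = L * E - d * (ix * E) - E * (ix * d) := by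
      rw [hE, mul_assoc E, h1, sub_mul, mul_assoc d ix E, hE]
    _ = Ex - (d * E - E * d) * ix := by rw [hLE, hE, h1]; noncomm_ring

/-- If `D` is a commutator `[d, e_α]`, then `D e_β - s e_β D` anticommutes with insertions. -/
theorem insert_mul_commutator_sub {D : T} (hF : ix * F = F * ix) (hD : ix * D = Ex - D * ix)
    (hEx : Ex * F = s • (F * Ex)) :
    ix * (D * F - s • (F * D)) = -((D * F - s • (F * D)) * ix) := by
  calc ix * (D * F - s • (F * D)) = (ix * D) * F - s • ((ix * F) * D) := by
        rw [mul_sub, mul_smul_comm, mul_assoc, mul_assoc]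
    _ = Ex * F - D * (ix * F) - s • (F * (ix * D)) := by
      rw [hF, mul_assoc F ix D, hD, sub_mul, mul_assoc D ix F, hF]
    _ = -((D * F - s • (F * D)) * ix) := by
      rw [hD, hF, hEx, mul_sub, smul_sub, sub_mul, smul_mul_assoc, mul_assoc, mul_assoc]
      abel

/-- The commutator of `[e_α i_x, d] = e_α L_x + [d, e_α] i_x` and `e_β i_y`, for multiplications
`e` by even or odd elements and insertions `i`. -/
theorem commutator_identity (hs : s = 1 ∨ s = -1) (hLx : ix * d + d * ix = Lx)
    (hxF : ix * F = F * ix) (hyE : iy * E = E * iy) (hF : Lx * F = Fx + F * Lx)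
    (hDy : iy * (d * E - E * d) = Ey - (d * E - E * d) * iy)
    (hDF : (d * E - E * d) * F = s • (F * (d * E - E * d)))
    (hEF : E * F = s • (F * E)) (hFE : Ey * F = s • (F * Ey))
    (hxy : ix * iy = -(iy * ix)) (hL : iy * Lx = Lx * iy - ixy) :
    (E * ix * d + d * (E * ix)) * (F * iy) - s • (F * iy * (E * ix * d + d * (E * ix))) =
      E * F * ixy + E * Fx * iy - Ey * F * ix := by
  have h1 : E * ix * d + d * (E * ix) = E * Lx + (d * E - E * d) * ix := by
    rw [← hLx]; noncomm_ring
  set D := d * E - E * d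
  have h4 : Lx * iy = iy * Lx + ixy := by rw [hL]; abel
  have e1 : (E * Lx + D * ix) * (F * iy) =
      E * Fx * iy + E * F * ixy + E * F * iy * Lx + D * F * ix * iy := by
    calc (E * Lx + D * ix) * (F * iy) = E * (Lx * F) * iy + D * (ix * F) * iy := by noncomm_ring
      _ = E * Fx * iy + E * F * (Lx * iy) + D * F * ix * iy := by rw [hF, hxF]; noncomm_ring
      _ = _ := by rw [h4]; noncomm_ring
  have e2 : F * iy * (E * Lx + D * ix) = F * E * iy * Lx + F * Ey * ix - F * D * iy * ix := by
    calc F * iy * (E * Lx + D * ix) = F * (iy * E) * Lx + F * (iy * D) * ix := by noncomm_ring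
      _ = _ := by rw [hyE, hDy]; noncomm_ring
  have e3 : F * D * ix * iy = -(F * D * iy * ix) := by
    rw [mul_assoc (F * D), hxy]; noncomm_ring
  rw [h1, e1, e2, hDF, hEF, hFE]
  rcases hs with rfl | rfl
  · simp only [one_smul, e3]; noncomm_ring
  · simp only [neg_smul, one_smul, neg_mul, e3]; noncomm_ring

end ringIdentities

section lieOperators

open ModDer

variable (R : Type*) {A L' L'' : Type*} [CommRing R] [CommRing A] [Algebra R A]
  [LieRing L'] [LieAlgebra R L'] [Module A L'] [LieRingModule L' A] [LieRinehartRing A L']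
  [LieRinehartAlgebra R A L']
  [LieRing L''] [LieAlgebra R L''] [Module A L''] [LieRingModule L'' A] [LieRinehartRing A L'']
  [LieRinehartAlgebra R A L'']
  [LieRingModule L' L''] [LieModule R L' L''] [LieRinehartModule A L' L'']
  [LieRingModule L'' L'] [LieModule R L'' L'] [LieRinehartModule A L'' L']

theorem wedgeOp_apply_eq_zero (α : Forms A L'' A) {F : BiForms A L' L''} {p : ℕ} (h : F p = 0) :
    wedgeOp α F p = 0 := by
  rw [wedgeOp_apply, h, map_zero]

/-- The commutator of `d'` and the multiplication by `α` is the multiplication by `d'α`, so that it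
commutes up to sign with multiplications by scalar forms. -/
theorem dPrimeOp_wedgeOp_commutator {m n : ℕ} (α : L'' [⋀^Fin m]→ₗ[A] A)
    (β : L'' [⋀^Fin n]→ₗ[A] A) :
    (dPrimeOp R A L' L'' * wedgeOp (Pi.single m α)
      - wedgeOp (Pi.single m α) * dPrimeOp R A L' L'') *
      wedgeOp (Pi.single n β) = (-1 : ℤ) ^ (m * n) • (wedgeOp (Pi.single n β) *
        (dPrimeOp R A L' L'' * wedgeOp (Pi.single m α)
          - wedgeOp (Pi.single m α) * dPrimeOp R A L' L'')) := by
  set s : ℤ := (-1) ^ (m * n)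
  set d := dPrimeOp R A L' L''
  set E : Module.End ℤ (BiForms A L' L'') := wedgeOp (Pi.single m α)
  set F : Module.End ℤ (BiForms A L' L'') := wedgeOp (Pi.single n β)
  set D := d * E - E * d with hD
  rw [← sub_eq_zero]
  have hx : ∀ x : L', insertOp x * (D * F - s • (F * D)) =
      -((D * F - s • (F * D)) * insertOp x) := by
    intro x
    have c := insertOp_dPrimeOp R (A := A) (L'' := L'') x
    have hE : insertOp x * E = E * insertOp x := insertOp_mul_wedgeOp x _
    have hF : insertOp x * F = F * insertOp x := insertOp_mul_wedgeOp x _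
    have hL : lieOp x * E = _ := lieOp_mul_wedgeOp x (Pi.single m α)
    rw [onForms_single] at hL
    exact insert_mul_commutator_sub hF (insert_mul_commutator c hE hL) (wedgeOp_comm _ _)
  refine LinearMap.ext fun G => funext fun p => ?_
  induction p generalizing G with
  | zero =>
    have h0 : ∀ H : BiForms A L' L'', D H 0 = 0 := by
      intro H
      have h1 : d (E H) 0 = 0 := dPrimeOp_apply_zero R _
      have h2 : E (d H) 0 = 0 := wedgeOp_apply_eq_zero _ (dPrimeOp_apply_zero R _)
      change d (E H) 0 - E (d H) 0 = 0
      rw [h1, h2, sub_zero]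
    have h3 : F (D G) 0 = 0 := wedgeOp_apply_eq_zero _ (h0 G)
    change D (F G) 0 - s • F (D G) 0 = 0
    rw [h0, h3, smul_zero, sub_zero]
  | succ p ih =>
    refine biForms_succ_ext fun x => ?_
    have := LinearMap.congr_fun (hx x) G
    rw [Module.End.mul_apply] at this
    rw [this, LinearMap.zero_apply, map_zero, LinearMap.neg_apply, Pi.neg_apply,
      Module.End.mul_apply, ih]
    simp

/-- The Lie derivative `[i_ξ, d']` along `ξ ∈ Alt_A(L'', L')`. -/
def lieFormOp (ξ : Forms A L'' L') : Module.End ℤ (BiForms A L' L'') :=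
  insertFormOp ξ * dPrimeOp R A L' L'' + dPrimeOp R A L' L'' * insertFormOp ξ

/-- The commutator of a Lie derivative and an insertion is the insertion of the crossed product
bracket. -/
theorem lieFormOp_insertFormOp_commutator [Module.Finite A L'] [Module.Projective A L'] {k l : ℕ}
    (ξ : L'' [⋀^Fin k]→ₗ[A] L') (η : L'' [⋀^Fin l]→ₗ[A] L') :
    lieFormOp R (Pi.single k ξ) * insertFormOp (Pi.single l η) - (-1 : ℤ) ^ (k * l) •
      (insertFormOp (Pi.single l η) * lieFormOp R (Pi.single k ξ)) =
        insertFormOp (crossedBracket (Pi.single k ξ) (Pi.single l η)) := by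
  refine forms_induction (P := fun ω : Forms A L'' L' => lieFormOp R ω *
    insertFormOp (Pi.single l η) - (-1 : ℤ) ^ (k * l) • (insertFormOp (Pi.single l η) *
      lieFormOp R ω) = insertFormOp (crossedBracket ω (Pi.single l η))) ?_ ?_ ?_ ξ
  · simp [lieFormOp, crossedBracket_zero_left]
  · intro ω ω' h h'
    rw [crossedBracket_add_left, map_add, ← h, ← h']
    simp only [lieFormOp, map_add, add_mul, mul_add, smul_add]
    abel
  intro x α
  refine forms_induction (P := fun ω : Forms A L'' L' => lieFormOp R (tensorForm x (Pi.single k α))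
    * insertFormOp ω - (-1 : ℤ) ^ (k * l) • (insertFormOp ω *
      lieFormOp R (tensorForm x (Pi.single k α))) =
        insertFormOp (crossedBracket (tensorForm x (Pi.single k α)) ω)) ?_ ?_ ?_ η
  · simp [crossedBracket_zero_right]
  · intro ω ω' h h'
    rw [crossedBracket_add_right, insertFormOp.map_add (crossedBracket _ ω), ← h, ← h']
    simp only [map_add, add_mul, mul_add, smul_add]
    abel
  intro y β
  have hE := lieOp_mul_wedgeOp (A := A) (L'' := L'') y (Pi.single k α)
  have hEy := onForms_single (ofLie y) (ofLie y) k α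
  have hFE : wedgeOp ((ofLie y).onForms (ofLie y) (Pi.single k α)) * wedgeOp (Pi.single l β) =
      (-1 : ℤ) ^ (k * l) • (wedgeOp (Pi.single l β) *
        wedgeOp (L' := L') ((ofLie y).onForms (ofLie y) (Pi.single k α))) := by
    rw [hEy]; exact wedgeOp_comm _ _
  rw [crossedBracket_tensorForm, map_sub, map_add, insertFormOp_tensorForm,
    insertFormOp_tensorForm, insertFormOp_tensorForm, insertFormOp_tensorForm,
    ← wedgeOp_mul_wedgeOp, ← wedgeOp_mul_wedgeOp, ← wedgeOp_mul_wedgeOp, lieFormOp,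
    insertFormOp_tensorForm]
  exact commutator_identity (neg_one_pow_eq_or ℤ _) (insertOp_dPrimeOp R x)
    (insertOp_mul_wedgeOp x _) (insertOp_mul_wedgeOp y _) (lieOp_mul_wedgeOp x _)
    (insert_mul_commutator (insertOp_dPrimeOp R y) (insertOp_mul_wedgeOp y _) hE)
    (dPrimeOp_wedgeOp_commutator R α β) (wedgeOp_comm α β) hFE
    (insertOp_mul_insertOp x y) (insertOp_mul_lieOp y x)

/-- The insertion pairing is invariant under the action of `L''`. -/
theorem lie_insertPairing (p : ℕ) (v : L'') (x : L') (f : L' [⋀^Fin (p + 1)]→ₗ[A] A) :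
    ⁅v, insertPairing A L' A p x f⁆ =
      insertPairing A L' A p ⁅v, x⁆ f + insertPairing A L' A p x ⁅v, f⁆ := by
  have := contract_onForms (ofLie v : ModDer (fun a : A => ⁅v, a⁆) L') (ofLie v) x
    (Pi.single (p + 1) f : Forms A L' A)
  have h2 := congrFun this p
  simp only [onForms_single, contract_single_succ, Pi.single_eq_same, Pi.sub_apply] at h2
  exact (sub_eq_iff_eq_add.mp h2.symm).trans (add_comm _ _)

/-- The operator `d''` is a graded derivation for insertions. -/
theorem dDoublePrimeOp_mul_insertFormOp {k : ℕ} (ξ : L'' [⋀^Fin k]→ₗ[A] L') :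
    dDoublePrimeOp R A L' L'' * insertFormOp (Pi.single k ξ) =
      insertFormOp (Pi.single (k + 1) (ceD ξ)) +
        (-1 : ℤ) ^ k • (insertFormOp (Pi.single k ξ) * dDoublePrimeOp R A L' L'') := by
  refine LinearMap.ext fun F => funext fun p => ?_
  have h := formsD_pairWedge (R := R) (B := insertPairing A L' A p)
    (fun v x f => lie_insertPairing p v x f) (Pi.single k ξ) (F (p + 1))
  have hd : formsD R A L'' L' (Pi.single k ξ) = Pi.single (k + 1) (ceD ξ) := by
    funext n
    cases n with
    | zero =>
      rw [Pi.single_eq_of_ne (by omega)]; rfl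
    | succ n =>
      rw [formsD_succ]
      by_cases h : n = k
      · subst h; simp
      · rw [Pi.single_eq_of_ne h, Pi.single_eq_of_ne (by omega)]
        exact map_zero (ceLinear R)
  rw [twist_single, hd, map_zsmul] at h
  exact h

/-- Alternating maps of no variables are elements. -/
def evalZero (A W M : Type*) [CommRing A] [AddCommGroup W] [Module A W] [AddCommGroup M]
    [Module A M] : (W [⋀^Fin 0]→ₗ[A] M) →ₗ[A] M where
  toFun f := f ![]
  map_add' _ _ := rfl
  map_smul' _ _ := rfl

theorem crossedAction_apply {K V M : Type*} [LieRing K] [Module A K] [LieRingModule K A]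
    [LieRinehartRing A K] [AddCommGroup V] [Module A V] [LieRingModule K V]
    [LieRinehartModule A K V] [AddCommGroup M] [Module A M] [LieRingModule K M]
    [LieRinehartModule A K M] (ξ : Forms A V K) (β : Forms A V M) (n : ℕ) (v : Fin n → V) :
    crossedAction ξ β n v = ∑ S : Finset (Fin n), shuffleSign S •
      (⁅evalOn ξ S v, evalOn β Sᶜ v⁆ - derivSum β (evalOn ξ S v) Sᶜ v) := rfl

/-- On forms on `L''` with values in `A` the Lie derivative along `ξ` is the action of the crossed
product. -/
theorem evalZero_lieFormOp (ξ : Forms A L'' L') (F : BiForms A L' L'') :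
    mapForms (evalZero A L' A) (lieFormOp R ξ F 0) =
      crossedAction ξ (mapForms (evalZero A L' A) (F 0)) := by
  have h0 : lieFormOp R ξ F 0 = insertFormOp ξ (dPrimeOp R A L' L'' F) 0 := by
    change _ + dPrimeOp R A L' L'' (insertFormOp ξ F) 0 = _
    rw [dPrimeOp_apply_zero, add_zero]
    rfl
  have h1 : ∀ (y : L') (q : ℕ) (w : Fin q → L''), dPrimeOp R A L' L'' F 1 q w (Fin.cons y ![]) =
      ⁅y, F 0 q w ![]⁆ - ∑ j, F 0 q (update w j ⁅y, w j⁆) ![] := by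
    intro y q w
    have h := congrFun (LinearMap.congr_fun (insertOp_dPrimeOp R (A := A) (L'' := L'') y) F) 0
    have h2 : dPrimeOp R A L' L'' (insertOp y F) 0 = 0 := dPrimeOp_apply_zero R _
    rw [LinearMap.add_apply, Pi.add_apply, Module.End.mul_apply, Module.End.mul_apply, h2,
      add_zero] at h
    have h3 := congrArg (fun ω : Forms A L'' (L' [⋀^Fin 0]→ₗ[A] A) => ω q w ![]) h
    refine Eq.trans h3 ?_
    change (⁅y, F 0 q w ![]⁆ - ∑ j : Fin 0, _) - (∑ j, F 0 q (update w j ⁅y, w j⁆)) ![] = _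
    rw [alternatingMap_sum_apply, Fin.sum_univ_zero, sub_zero]
  funext n
  ext v
  rw [h0, mapForms_apply, insertFormOp_apply, pairWedge_apply, map_sum, crossedAction_apply]
  refine sum_congr rfl fun S _ => ?_
  rw [map_zsmul]
  congr 1
  refine (h1 _ _ _).trans ?_
  rw [derivSum_eq]
  rfl

end lieOperators

/-! ### From bigraded forms to graded multilinear functions -/

section signs

theorem neg_one_pow_congr_even {m n : ℕ} (h : Even m ↔ Even n) : (-1 : ℤ) ^ m = (-1) ^ n := by
  rcases Nat.even_or_odd m with hm | hm
  · rw [hm.neg_one_pow, (h.mp hm).neg_one_pow]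
  · rw [hm.neg_one_pow, (Nat.not_even_iff_odd.mp fun hn =>
      (Nat.not_even_iff_odd.mpr hm) (h.mpr hn)).neg_one_pow]

theorem sum_Iio_succ_cons {n : ℕ} (a : ℕ) (f : Fin n → ℕ) (j : Fin n) :
    ∑ l ∈ Iio j.succ, (Fin.cons a f : Fin (n + 1) → ℕ) l = a + ∑ l ∈ Iio j, f l := by
  have h : Iio j.succ = insert 0 ((Iio j).map (Fin.succEmb n)) := by
    ext i
    refine Fin.cases (by simp) (fun i => by simp) i
  rw [h, sum_insert (by simp), sum_map]
  simp

theorem neg_one_pow_eq_neg_of_even {m n : ℕ} (h : Even m ↔ ¬ Even n) :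
    (-1 : ℤ) ^ m = -(-1) ^ n := by
  rw [neg_one_pow_congr_even (n := n + 1) (by rw [h, Nat.even_add_one]), pow_succ, mul_neg_one]

theorem neg_one_pow_swap_sign (m n Z : ℕ) :
    (-1 : ℤ) ^ (n * (m + Z) + (m * Z + m * n)) = (-1) ^ (m * n + (m * (n + Z) + n * Z)) := by
  refine neg_one_pow_congr_even ?_
  simp only [Nat.even_add, Nat.even_mul]
  grind

end signs

section squareZero

variable {A V M M₁ M₂ M₃ : Type*} [CommRing A] [AddCommGroup V] [Module A V]
  [AddCommGroup M] [Module A M] [AddCommGroup M₁] [Module A M₁] [AddCommGroup M₂] [Module A M₂]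
  [AddCommGroup M₃] [Module A M₃]

/-- Multiplication by a homogeneous form of even degree squares to zero if the pairing does. -/
theorem pairWedge_self_eq_zero {B : M₁ →ₗ[A] M₂ →ₗ[A] M₃} {C : M₁ →ₗ[A] M →ₗ[A] M₂}
    (h : ∀ a x, B a (C a x) = 0) {k : ℕ} (hk : Even k) (ω : V [⋀^Fin k]→ₗ[A] M₁)
    (γ : Forms A V M) : pairWedge B (Pi.single k ω) (pairWedge C (Pi.single k ω) γ) = 0 := by
  -- The pairings are alternating, hence skew-symmetric; `2` need not be invertible.
  have h' : ∀ a b x, B a (C b x) = (-1 : ℤ) • B b (C a x) := by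
    intro a b x
    have := h (a + b) x
    simp only [map_add, LinearMap.add_apply, h, zero_add, add_zero] at this
    rw [neg_one_smul, eq_neg_iff_add_eq_zero, ← this]
    abel
  funext n
  induction n generalizing γ with
  | zero =>
    refine zero_ext ?_
    simp only [pairWedge_zero_apply, h, Pi.zero_apply, AlternatingMap.zero_apply]
  | succ n ih =>
    refine succ_ext_of_contract fun v => ?_
    rw [contract_pairWedge, contract_pairWedge, twist_single, hk.neg_one_pow, one_smul, map_add,
      ← add_assoc, Pi.add_apply, ih, map_zero]
    cases k with
    | zero => simp [contract_single_zero]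
    | succ k =>
      rw [contract_single_succ, pairWedge_comm h' k _ (Pi.single (k + 1) ω), twist_single,
        ← pow_mul, (Nat.even_mul_succ_self k).neg_one_pow, one_smul]
      simp

end squareZero

section comparison

open ModDer

variable (R : Type*) {A L' L'' : Type*} [CommRing R] [CommRing A] [Algebra R A]
  [LieRing L'] [LieAlgebra R L'] [Module A L'] [LieRingModule L' A] [LieRinehartRing A L']
  [LieRinehartAlgebra R A L']
  [LieRing L''] [LieAlgebra R L''] [Module A L''] [LieRingModule L'' A] [LieRinehartRing A L'']
  [LieRinehartAlgebra R A L'']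
  [LieRingModule L' L''] [LieModule R L' L''] [LieRinehartModule A L' L'']
  [LieRingModule L'' L'] [LieModule R L'' L'] [LieRinehartModule A L'' L']

/-- The function of homogeneous elements `ξ₁, …, ξ_p` of `Alt_A(L'', L')` that corresponds to a
bigraded form. On decomposable elements `ξᵢ = αᵢ ⊗ xᵢ` its value is
`α₁ ∧ ⋯ ∧ α_p ∧ F(x₁, …, x_p)`; the sign comes from moving `ξ₁` past the other elements. -/
def toDGFun : ∀ p : ℕ, BiForms A L' L'' → DGFun A L' L'' p
  | 0, F, _ => mapForms (evalZero A L' A) (F 0)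
  | p + 1, F, ξ => (-1 : ℤ) ^ ((ξ 0).1 * ∑ l : Fin p, (Fin.tail ξ l).1) •
      toDGFun p (insertFormOp (ξ 0).toForms F) (Fin.tail ξ)

theorem toDGFun_zero (F : BiForms A L' L'') (ξ : Fin 0 → HForm A L' L'') :
    toDGFun 0 F ξ = mapForms (evalZero A L' A) (F 0) := rfl

theorem toDGFun_cons {p : ℕ} (F : BiForms A L' L'') (a : HForm A L' L'')
    (η : Fin p → HForm A L' L'') :
    toDGFun (p + 1) F (Fin.cons a η) = (-1 : ℤ) ^ (a.1 * ∑ l, (η l).1) •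
      toDGFun p (insertFormOp a.toForms F) η := rfl

theorem toDGFun_add (p : ℕ) (F G : BiForms A L' L'') (ξ : Fin p → HForm A L' L'') :
    toDGFun p (F + G) ξ = toDGFun p F ξ + toDGFun p G ξ := by
  induction p generalizing F G with
  | zero => simp [toDGFun_zero]
  | succ p ih =>
    rw [← Fin.cons_self_tail ξ, toDGFun_cons, toDGFun_cons, toDGFun_cons, map_add, ih, smul_add]

/-- `toDGFun` as an additive map. -/
def toDGFunHom (p : ℕ) (ξ : Fin p → HForm A L' L'') : BiForms A L' L'' →+ Forms A L'' A :=
  AddMonoidHom.mk' (fun F => toDGFun p F ξ) fun F G => toDGFun_add p F G ξ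

theorem toDGFun_zsmul (p : ℕ) (c : ℤ) (F : BiForms A L' L'') (ξ : Fin p → HForm A L' L'') :
    toDGFun p (c • F) ξ = c • toDGFun p F ξ :=
  map_zsmul (toDGFunHom p ξ) c F

theorem toDGFun_neg (p : ℕ) (F : BiForms A L' L'') (ξ : Fin p → HForm A L' L'') :
    toDGFun p (-F) ξ = -toDGFun p F ξ :=
  map_neg (toDGFunHom p ξ) F

theorem toDGFun_sub (p : ℕ) (F G : BiForms A L' L'') (ξ : Fin p → HForm A L' L'') :
    toDGFun p (F - G) ξ = toDGFun p F ξ - toDGFun p G ξ :=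
  map_sub (toDGFunHom p ξ) F G

theorem toDGFun_smul (p : ℕ) (a : A) (F : BiForms A L' L'') (ξ : Fin p → HForm A L' L'') :
    toDGFun p (a • F) ξ = a • toDGFun p F ξ := by
  induction p generalizing F with
  | zero => exact map_smul (mapForms (evalZero A L' A)) a (F 0)
  | succ p ih =>
    have h : insertFormOp (ξ 0).toForms (a • F) = a • insertFormOp (ξ 0).toForms F :=
      funext fun p => map_smul (pairWedge (insertPairing A L' A p) (ξ 0).toForms) a (F (p + 1))
    rw [← Fin.cons_self_tail ξ, toDGFun_cons, toDGFun_cons, h, ih, smul_comm]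

theorem toDGFun_congr (p : ℕ) {F G : BiForms A L' L''} (h : F p = G p)
    (ξ : Fin p → HForm A L' L'') : toDGFun p F ξ = toDGFun p G ξ := by
  induction p generalizing F G with
  | zero => rw [toDGFun_zero, toDGFun_zero, h]
  | succ p ih =>
    rw [← Fin.cons_self_tail ξ, toDGFun_cons, toDGFun_cons]
    congr 1
    exact ih (by rw [insertFormOp_apply, insertFormOp_apply, h]) _

/-- If `F` has total degree `N`, then its value on `ξ₁, …, ξ_p` has degree
`N - p + |ξ₁| + ⋯ + |ξ_p|`. -/
theorem toDGFun_eq_zero {p : ℕ} {N : ℤ} {F : BiForms A L' L''}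
    (hF : ∀ q : ℕ, (q : ℤ) + p ≠ N → F p q = 0) (ξ : Fin p → HForm A L' L'') {n : ℕ}
    (hn : (n : ℤ) + p ≠ N + ∑ i, ((ξ i).1 : ℤ)) : toDGFun p F ξ n = 0 := by
  induction p generalizing F N with
  | zero =>
    have : F 0 n = 0 := hF n (by simpa using hn)
    rw [toDGFun_zero]
    ext v
    rw [mapForms_apply, this]
    rfl
  | succ p ih =>
    obtain ⟨a, η, rfl⟩ : ∃ a η, ξ = Fin.cons a η := ⟨_, _, (Fin.cons_self_tail ξ).symm⟩
    rw [toDGFun_cons, Pi.smul_apply]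
    rw [Fin.sum_univ_succ] at hn
    rw [ih (N := N + a.1 - 1), smul_zero]
    · intro q hq
      rw [insertFormOp_apply]
      refine pairWedge_apply_eq_zero _ fun b c hbc => ?_
      by_cases hb : b = a.1
      · right
        refine hF c fun hc => hq ?_
        push_cast at hc
        subst hbc hb
        push_cast
        linarith
      · left
        exact Pi.single_eq_of_ne (M := fun n => L'' [⋀^Fin n]→ₗ[A] L') hb a.2
    · intro h
      apply hn
      simp only [Fin.cons_zero, Fin.cons_succ]
      push_cast
      linarith

theorem sum_update_fst {p : ℕ} (η : Fin p → HForm A L' L'') (j : Fin p) (z : HForm A L' L'') :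
    ∑ l, (update η j z l).1 + (η j).1 = ∑ l, (η l).1 + z.1 := by
  have h : ∀ l, (update η j z l).1 = update (fun l => (η l).1) j z.1 l := by
    intro l
    by_cases hl : l = j
    · subst hl; simp
    · simp [hl]
  simp only [h]
  rw [sum_update_of_mem (mem_univ j), ← add_sum_erase univ (fun l => (η l).1) (mem_univ j),
    sdiff_singleton_eq_erase]
  ring

theorem toDGFun_update_add {p : ℕ} (F : BiForms A L' L'') (ξ : Fin p → HForm A L' L'') (i : Fin p)
    (k : ℕ) (x y : L'' [⋀^Fin k]→ₗ[A] L') :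
    toDGFun p F (update ξ i ⟨k, x + y⟩) =
      toDGFun p F (update ξ i ⟨k, x⟩) + toDGFun p F (update ξ i ⟨k, y⟩) := by
  induction p generalizing F with
  | zero => exact i.elim0
  | succ p ih =>
    obtain ⟨a, η, rfl⟩ : ∃ a η, ξ = Fin.cons a η := ⟨_, _, (Fin.cons_self_tail ξ).symm⟩
    refine Fin.cases ?_ (fun i => ?_) i
    · have h : HForm.toForms ⟨k, x + y⟩ =
          HForm.toForms (⟨k, x⟩ : HForm A L' L'') + HForm.toForms ⟨k, y⟩ := 
        Pi.single_add (f := fun n => L'' [⋀^Fin n]→ₗ[A] L') k x y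
      simp only [Fin.update_cons_zero, toDGFun_cons, h, map_add, LinearMap.add_apply, toDGFun_add,
        smul_add]
    · have hs : ∀ z : L'' [⋀^Fin k]→ₗ[A] L',
          ∑ l, (update η i (⟨k, z⟩ : HForm A L' L'') l).1 = ∑ l, (η l).1 + k - (η i).1 := by
        intro z
        have := sum_update_fst η i ⟨k, z⟩
        simp only at this
        omega
      simp only [← Fin.cons_update, toDGFun_cons, ih, hs, smul_add]

/-- The sign comes from moving `α` past the arguments. -/
theorem toDGFun_wedgeOp {p m : ℕ} (α : L'' [⋀^Fin m]→ₗ[A] A) (F : BiForms A L' L'')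
    (ξ : Fin p → HForm A L' L'') :
    toDGFun p (wedgeOp (Pi.single m α) F) ξ =
      (-1 : ℤ) ^ (m * ∑ l, (ξ l).1) • wedge (Pi.single m α) (toDGFun p F ξ) := by
  induction p generalizing F with
  | zero =>
    have := mapForms_pairWedge (f := evalZero A L' A) (f' := evalZero A L' A)
      (B := LinearMap.lsmul A _) (B' := LinearMap.lsmul A A) (c := 1)
      (by intro a b; rw [one_smul]; rfl) (Pi.single m α) (F 0)
    rw [one_smul] at this
    rw [Fin.sum_univ_zero, mul_zero, pow_zero, one_smul]
    exact this
  | succ p ih =>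
    obtain ⟨a, η, rfl⟩ : ∃ a η, ξ = Fin.cons a η := ⟨_, _, (Fin.cons_self_tail ξ).symm⟩
    have h := LinearMap.congr_fun (wedgeOp_insertFormOp_comm α a.2) F
    have h' : insertFormOp a.toForms (wedgeOp (Pi.single m α) F) =
        (-1 : ℤ) ^ (m * a.1) • wedgeOp (Pi.single m α) (insertFormOp a.toForms F) := by
      refine Eq.trans ?_ (congrArg (fun G => (-1 : ℤ) ^ (m * a.1) • G) h.symm)
      rw [LinearMap.smul_apply, smul_smul, ← pow_add, Even.neg_one_pow ⟨_, rfl⟩, one_smul]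
      rfl
    simp only [toDGFun_cons, h', toDGFun_zsmul, ih, wedge_eq_pairWedge, map_zsmul, smul_smul,
      ← pow_add, Fin.sum_univ_succ, Fin.cons_zero, Fin.cons_succ]
    congr 1
    refine neg_one_pow_congr_even ?_
    simp only [Nat.even_add, Nat.even_mul]
    tauto

theorem HForm.toForms_smul {m : ℕ} (α : L'' [⋀^Fin m]→ₗ[A] A) (a : HForm A L' L'') :
    (a.smul α).toForms = wedge (Pi.single m α) a.toForms := by
  funext n
  by_cases h : n = m + a.1
  · subst h
    exact Pi.single_eq_same (M := fun n => L'' [⋀^Fin n]→ₗ[A] L') _ _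
  · refine (Pi.single_eq_of_ne (M := fun n => L'' [⋀^Fin n]→ₗ[A] L') h _).trans
      (pairWedge_apply_eq_zero (LinearMap.lsmul A L') fun b c hbc => ?_).symm
    by_cases hb : b = m
    · right
      exact Pi.single_eq_of_ne (M := fun n => L'' [⋀^Fin n]→ₗ[A] L') (by omega) a.2
    · left
      exact Pi.single_eq_of_ne (M := fun n => L'' [⋀^Fin n]→ₗ[A] A) hb α

theorem toDGFun_update_smul {p : ℕ} (F : BiForms A L' L'') (ξ : Fin p → HForm A L' L'') (i : Fin p)
    {m : ℕ} (α : L'' [⋀^Fin m]→ₗ[A] A) :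
    toDGFun p F (update ξ i ((ξ i).smul α)) =
      (-1 : ℤ) ^ (m * ∑ l ∈ Iio i, (ξ l).1) • wedge (Pi.single m α) (toDGFun p F ξ) := by
  induction p generalizing F with
  | zero => exact i.elim0
  | succ p ih =>
    obtain ⟨a, η, rfl⟩ : ∃ a η, ξ = Fin.cons a η := ⟨_, _, (Fin.cons_self_tail ξ).symm⟩
    refine Fin.cases ?_ (fun i => ?_) i
    · have h : insertFormOp (a.smul α).toForms F =
          wedgeOp (Pi.single m α) (insertFormOp a.toForms F) := by
        rw [HForm.toForms_smul, ← wedgeOp_mul_insertFormOp]; rfl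
      have hd : (a.smul α).1 = m + a.1 := rfl
      have h0 : Iio (0 : Fin (p + 1)) = ∅ := by ext i; simp
      simp only [Fin.update_cons_zero, toDGFun_cons, Fin.cons_zero, h, hd, toDGFun_wedgeOp, h0,
        sum_empty, mul_zero, pow_zero, one_mul, wedge_eq_pairWedge, map_zsmul, smul_smul,
        ← pow_add]
      congr 1
      refine neg_one_pow_congr_even ?_
      simp only [Nat.even_add, Nat.even_mul]
      grind
    · have hs := sum_update_fst η i ((η i).smul α)
      have hs' : ∑ l, (update η i ((η i).smul α) l).1 = ∑ l, (η l).1 + m := by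
        have hd : ((η i).smul α).1 = m + (η i).1 := rfl
        omega
      have hc : ∀ l, ((Fin.cons a η : Fin (p + 1) → HForm A L' L'') l).1 =
          (Fin.cons a.1 (fun l => (η l).1) : Fin (p + 1) → ℕ) l := by
        intro l
        refine Fin.cases rfl (fun l => rfl) l
      simp only [Fin.cons_succ, ← Fin.cons_update, toDGFun_cons, ih, hs', hc, sum_Iio_succ_cons,
        wedge_eq_pairWedge, map_zsmul, smul_smul, ← pow_add]
      congr 1
      refine neg_one_pow_congr_even ?_
      simp only [Nat.even_add, Nat.even_mul]
      grind

theorem toDGFun_swap {p : ℕ} (F : BiForms A L' L'') (ξ : Fin p → HForm A L' L'') (i j : Fin p)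
    (hij : (j : ℕ) = i + 1) :
    toDGFun p F (ξ ∘ Equiv.swap i j) = -(-1 : ℤ) ^ ((ξ i).1 * (ξ j).1) • toDGFun p F ξ := by
  induction p generalizing F with
  | zero => exact i.elim0
  | succ p ih =>
    obtain ⟨a, η, rfl⟩ : ∃ a η, ξ = Fin.cons a η := ⟨_, _, (Fin.cons_self_tail ξ).symm⟩
    obtain ⟨j, rfl⟩ : ∃ j' : Fin p, j = j'.succ :=
      ⟨j.pred (fun h => by subst h; simp at hij), by simp⟩
    induction i using Fin.cases with
    | zero =>
      cases p with
      | zero => exact j.elim0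
      | succ p =>
        obtain rfl : j = 0 := by ext; simpa using hij
        obtain ⟨b, ζ, rfl⟩ : ∃ b ζ, η = Fin.cons b ζ := ⟨_, _, (Fin.cons_self_tail η).symm⟩
        have e : (Fin.cons a (Fin.cons b ζ : Fin (p + 1) → HForm A L' L'') :
            Fin (p + 2) → HForm A L' L'') ∘ Equiv.swap 0 (Fin.succ 0) =
            Fin.cons b (Fin.cons a ζ : Fin (p + 1) → HForm A L' L'') := by
          funext l
          refine Fin.cases ?_ (fun l => Fin.cases ?_ (fun l => ?_) l) l
          · simp
          · simp
          · rw [comp_apply, Equiv.swap_apply_of_ne_of_ne (by simp) (by simp [Fin.ext_iff])]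
            rfl
        have h := LinearMap.congr_fun (insertFormOp_comm a.2 b.2 (A := A)) F
        have h' : insertFormOp a.toForms (insertFormOp b.toForms F) =
            -(-1 : ℤ) ^ (a.1 * b.1) • insertFormOp b.toForms (insertFormOp a.toForms F) := h
        rw [e]
        simp only [toDGFun_cons, h', toDGFun_zsmul, Fin.sum_univ_succ, Fin.cons_zero,
          Fin.cons_succ, neg_smul, smul_neg, toDGFun_neg, smul_smul, neg_mul, ← pow_add,
          neg_one_pow_swap_sign]
    | succ i =>
      have hij' : (j : ℕ) = i + 1 := by simpa using hij
      have e : (Fin.cons a η : Fin (p + 1) → HForm A L' L'') ∘ Equiv.swap i.succ j.succ =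
          Fin.cons a (η ∘ Equiv.swap i j) := by
        funext l
        refine Fin.cases ?_ (fun l => ?_) l
        · rw [comp_apply, Equiv.swap_apply_of_ne_of_ne (Fin.succ_ne_zero i).symm
            (Fin.succ_ne_zero j).symm]
          rfl
        · rw [comp_apply, ← (Fin.succ_injective p).map_swap]
          rfl
      have hs : ∑ l, ((η ∘ Equiv.swap i j) l).1 = ∑ l, (η l).1 :=
        Equiv.sum_comp (Equiv.swap i j) fun l => (η l).1
      rw [e, toDGFun_cons, toDGFun_cons, hs, ih _ _ _ _ hij', Fin.cons_succ, Fin.cons_succ,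
        smul_comm]

theorem insertFormOp_sq {k : ℕ} (hk : Even k) (ξ : L'' [⋀^Fin k]→ₗ[A] L') (F : BiForms A L' L'') :
    insertFormOp (Pi.single k ξ) (insertFormOp (Pi.single k ξ) F) = 0 :=
  funext fun p => pairWedge_self_eq_zero (fun x f => f.curryLeft_same x) hk ξ (F (p + 2))

/-- `toDGFun` vanishes on equal neighbours of even degree. -/
theorem toDGFun_eq_zero_of_eq {p : ℕ} (F : BiForms A L' L'') (ξ : Fin p → HForm A L' L'')
    (i j : Fin p) (hij : (j : ℕ) = i + 1) (h : ξ i = ξ j) (he : Even (ξ i).1) :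
    toDGFun p F ξ = 0 := by
  induction p generalizing F with
  | zero => exact i.elim0
  | succ p ih =>
    obtain ⟨a, η, rfl⟩ : ∃ a η, ξ = Fin.cons a η := ⟨_, _, (Fin.cons_self_tail ξ).symm⟩
    obtain ⟨j, rfl⟩ : ∃ j' : Fin p, j = j'.succ :=
      ⟨j.pred (fun h => by subst h; simp at hij), by simp⟩
    induction i using Fin.cases with
    | zero =>
      cases p with
      | zero => exact j.elim0
      | succ p =>
        obtain rfl : j = 0 := by ext; simpa using hij
        obtain ⟨b, ζ, rfl⟩ : ∃ b ζ, η = Fin.cons b ζ := ⟨_, _, (Fin.cons_self_tail η).symm⟩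
        simp only [Fin.cons_zero, Fin.cons_succ] at h he
        subst h
        have h' : insertFormOp a.toForms (insertFormOp a.toForms F) = 0 := insertFormOp_sq he a.2 F
        have h0 := map_zero (toDGFunHom p ζ)
        change toDGFun p 0 ζ = 0 at h0
        simp only [toDGFun_cons, h', h0, smul_zero]
    | succ i =>
      rw [toDGFun_cons, ih _ η i j (by simpa using hij) h he, smul_zero]

end comparison

/-! ### Compatibility with the differentials of the crossed product -/

section compatibility

open ModDer

variable (R : Type*) {A L' L'' : Type*} [CommRing R] [CommRing A] [Algebra R A]
  [LieRing L'] [LieAlgebra R L'] [Module A L'] [LieRingModule L' A] [LieRinehartRing A L']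
  [LieRinehartAlgebra R A L']
  [LieRing L''] [LieAlgebra R L''] [Module A L''] [LieRingModule L'' A] [LieRinehartRing A L'']
  [LieRinehartAlgebra R A L'']
  [LieRingModule L' L''] [LieModule R L' L''] [LieRinehartModule A L' L'']
  [LieRingModule L'' L'] [LieModule R L'' L'] [LieRinehartModule A L'' L']

/-- The crossed product bracket of elements of degrees `k` and `l` has degree `k + l`. -/
theorem crossedBracket_single_apply_eq_zero {k l n : ℕ} (ξ : L'' [⋀^Fin k]→ₗ[A] L')
    (η : L'' [⋀^Fin l]→ₗ[A] L') (h : n ≠ k + l) :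
    crossedBracket (Pi.single k ξ) (Pi.single l η) n = 0 := by
  have h0 : ∀ {m : ℕ} (ω : L'' [⋀^Fin m]→ₗ[A] L') (S : Finset (Fin n)) (v : Fin n → L''),
      S.card ≠ m → evalOn (Pi.single m ω : Forms A L'' L') S v = 0 := by
    intro m ω S v hS
    rw [evalOn, Pi.single_eq_of_ne hS]
    rfl
  have h1 : ∀ {m : ℕ} (ω : L'' [⋀^Fin m]→ₗ[A] L') (y : L') (S : Finset (Fin n)) (v : Fin n → L''),
      S.card ≠ m → derivSum (Pi.single m ω : Forms A L'' L') y S v = 0 :=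
    fun ω y S v hS => sum_eq_zero fun i _ => h0 ω S _ hS
  ext v
  rw [crossedBracket_apply]
  refine sum_eq_zero fun S _ => ?_
  by_cases hS : S.card = k
  · have hS' : Sᶜ.card ≠ l := by
      intro e
      have := S.card_add_card_compl
      rw [Fintype.card_fin] at this
      omega
    rw [h0 η _ v hS', h1 η _ _ v hS', lie_zero, derivSum_zero, sub_zero, add_zero, smul_zero]
  · rw [h0 ξ _ v hS, h1 ξ _ _ v hS, zero_lie, derivSum_zero, sub_zero, add_zero, smul_zero]

theorem HForm.toForms_bracket (a b : HForm A L' L'') :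
    (a.bracket b).toForms = crossedBracket a.toForms b.toForms := by
  funext n
  by_cases h : n = a.1 + b.1
  · subst h
    exact Pi.single_eq_same (M := fun n => L'' [⋀^Fin n]→ₗ[A] L') _ _
  · exact (Pi.single_eq_of_ne (M := fun n => L'' [⋀^Fin n]→ₗ[A] L') h _).trans
      (crossedBracket_single_apply_eq_zero a.2 b.2 h).symm

theorem sum_Iio_succ_cons_fst {p : ℕ} (a : HForm A L' L'') (η : Fin p → HForm A L' L'')
    (j : Fin p) : ∑ l ∈ Iio j.succ, ((Fin.cons a η : Fin (p + 1) → HForm A L' L'') l).1 =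
      a.1 + ∑ l ∈ Iio j, (η l).1 := by
  rw [← sum_Iio_succ_cons a.1 (fun l => (η l).1) j]
  exact sum_congr rfl fun l _ => by refine Fin.cases rfl (fun l => rfl) l

theorem sum_Iio_zero_fst {p : ℕ} (ξ : Fin (p + 1) → HForm A L' L'') :
    ∑ l ∈ Iio (0 : Fin (p + 1)), (ξ l).1 = 0 := by
  rw [show Iio (0 : Fin (p + 1)) = ∅ by ext i; simp, sum_empty]

theorem sum_update_d_fst {p : ℕ} (η : Fin p → HForm A L' L'') (j : Fin p) :
    ∑ l, (update η j (η j).d l).1 = ∑ l, (η l).1 + 1 := by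
  have hs := sum_update_fst η j (η j).d
  have hd : (η j).d.1 = (η j).1 + 1 := rfl
  omega

theorem sum_update_bracket_fst {p : ℕ} (a : HForm A L' L'') (η : Fin p → HForm A L' L'')
    (j : Fin p) : ∑ l, (update η j (a.bracket (η j)) l).1 = ∑ l, (η l).1 + a.1 := by
  have hs := sum_update_fst η j (a.bracket (η j))
  have hd : (a.bracket (η j)).1 = a.1 + (η j).1 := rfl
  omega

theorem dgD₂_apply {p : ℕ} (f : DGFun A L' L'' p) (ξ : Fin p → HForm A L' L'') :
    dgD₂ R A L' L'' p f ξ = (-1 : ℤ) ^ (∑ i, (ξ i).1) •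
      (formsD R A L'' A (f ξ) -
        ∑ i, (-1 : ℤ) ^ (∑ l ∈ Iio i, (ξ l).1) • f (update ξ i (ξ i).d)) := rfl

theorem formsD_mapForms_evalZero (F : Forms A L'' (L' [⋀^Fin 0]→ₗ[A] A)) :
    formsD R A L'' A (mapForms (evalZero A L' A) F) =
      mapForms (evalZero A L' A) (formsD R A L'' _ F) := by
  have hl : ∀ (v : L'') (f : L' [⋀^Fin 0]→ₗ[A] A),
      evalZero A L' A ⁅v, f⁆ = ⁅v, evalZero A L' A f⁆ := by
    intro v f
    change ⁅v, f ![]⁆ - ∑ j : Fin 0, _ = _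
    rw [Fin.sum_univ_zero, sub_zero]
    rfl
  funext n
  cases n with
  | zero => ext v; rfl
  | succ n =>
    ext v
    rw [mapForms_apply, formsD_succ, formsD_succ, ceD_apply, ceD_apply, ceFun, ceFun, map_sum]
    refine sum_congr rfl fun i _ => ?_
    rw [map_zsmul, map_sub, hl, map_sum]
    rfl

/-- The operator `d''` corresponds to the differential induced by the differentials `d''` of
`Alt_A(L'', A)` and `Alt_A(L'', L')`. -/
theorem toDGFun_dDoublePrimeOp {p : ℕ} (F : BiForms A L' L'') (ξ : Fin p → HForm A L' L'') :
    toDGFun p (dDoublePrimeOp R A L' L'' F) ξ = dgD₂ R A L' L'' p (toDGFun p F) ξ := by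
  induction p generalizing F with
  | zero =>
    rw [dgD₂_apply, Fin.sum_univ_zero, Fin.sum_univ_zero, pow_zero, one_smul, sub_zero,
      toDGFun_zero, toDGFun_zero, formsD_mapForms_evalZero]
    rfl
  | succ p ih =>
    obtain ⟨a, η, rfl⟩ : ∃ a η, ξ = Fin.cons a η := ⟨_, _, (Fin.cons_self_tail ξ).symm⟩
    have h : insertFormOp a.toForms (dDoublePrimeOp R A L' L'' F) = (-1 : ℤ) ^ a.1 •
        (dDoublePrimeOp R A L' L'' (insertFormOp a.toForms F) - insertFormOp a.d.toForms F) := by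
      have h1 : dDoublePrimeOp R A L' L'' (insertFormOp a.toForms F) =
          insertFormOp a.d.toForms F + (-1 : ℤ) ^ a.1 •
            insertFormOp a.toForms (dDoublePrimeOp R A L' L'' F) :=
        LinearMap.congr_fun (dDoublePrimeOp_mul_insertFormOp R a.2) F
      rw [h1, add_sub_cancel_left, smul_smul, ← pow_add, Even.neg_one_pow ⟨_, rfl⟩, one_smul]
    have hd : a.d.1 = a.1 + 1 := rfl
    rw [toDGFun_cons, h, toDGFun_zsmul, toDGFun_sub, ih, dgD₂_apply, dgD₂_apply,
      Fin.sum_univ_succ, Fin.sum_univ_succ]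
    simp only [Fin.cons_zero, Fin.cons_succ, Fin.update_cons_zero, ← Fin.cons_update,
      sum_Iio_succ_cons_fst, sum_Iio_zero_fst, toDGFun_cons, sum_update_d_fst, hd, map_zsmul,
      smul_sub, smul_add, smul_sum, smul_smul, ← pow_add]
    rw [sub_add_eq_sub_sub_swap]
    congr 2
    · congr 1
      refine neg_one_pow_congr_even ?_
      simp only [Nat.even_add, Nat.even_mul]
      grind
    · refine sum_congr rfl fun j _ => ?_
      congr 1
      refine neg_one_pow_congr_even ?_
      simp only [Nat.even_add, Nat.even_mul, Nat.not_even_one]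
      grind
    · refine neg_one_pow_congr_even ?_
      simp only [Nat.even_add, Nat.even_mul, Nat.not_even_one]
      grind

/-- The action of `a` on a function of homogeneous elements, evaluated at `η`: the part of the
graded Cartan-Chevalley-Eilenberg operator in which `a` is the first argument. -/
def dgLie {p : ℕ} (a : HForm A L' L'') (f : DGFun A L' L'' p) (η : Fin p → HForm A L' L'') :
    Forms A L'' A :=
  crossedAction a.toForms (f η) -
    ∑ j, (-1 : ℤ) ^ (a.1 * ∑ l ∈ Iio j, (η l).1) • f (update η j (a.bracket (η j)))

theorem crossedAction_zsmul (ξ : Forms A L'' L') (c : ℤ) (β : Forms A L'' A) :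
    crossedAction ξ (c • β) = c • crossedAction ξ β :=
  map_zsmul (AddMonoidHom.mk' (fun β : Forms A L'' A => crossedAction ξ β)
    (crossedAction_add ξ)) c β

/-- The Lie derivative along `a` corresponds to the action of `a` on functions of homogeneous
elements, with the Koszul sign of moving `a` past the arguments. -/
theorem toDGFun_lieFormOp [Module.Finite A L'] [Module.Projective A L'] {p : ℕ}
    (a : HForm A L' L'') (F : BiForms A L' L'') (η : Fin p → HForm A L' L'') :
    toDGFun p (lieFormOp R a.toForms F) η =
      (-1 : ℤ) ^ (a.1 * ∑ l, (η l).1) • dgLie a (toDGFun p F) η := by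
  induction p generalizing F with
  | zero =>
    rw [dgLie, Fin.sum_univ_zero, Fin.sum_univ_zero, mul_zero, pow_zero, one_smul, sub_zero,
      toDGFun_zero, toDGFun_zero, evalZero_lieFormOp]
  | succ p ih =>
    obtain ⟨b, ζ, rfl⟩ : ∃ b ζ, η = Fin.cons b ζ := ⟨_, _, (Fin.cons_self_tail η).symm⟩
    have h : insertFormOp b.toForms (lieFormOp R a.toForms F) = (-1 : ℤ) ^ (a.1 * b.1) •
        (lieFormOp R a.toForms (insertFormOp b.toForms F) -
          insertFormOp (a.bracket b).toForms F) := by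
      have h1 : lieFormOp R a.toForms (insertFormOp b.toForms F) - (-1 : ℤ) ^ (a.1 * b.1) •
          insertFormOp b.toForms (lieFormOp R a.toForms F) =
            insertFormOp (crossedBracket a.toForms b.toForms) F :=
        LinearMap.congr_fun (lieFormOp_insertFormOp_commutator R a.2 b.2) F
      rw [HForm.toForms_bracket, ← h1, sub_sub_cancel, smul_smul, ← pow_add,
        Even.neg_one_pow ⟨_, rfl⟩, one_smul]
    have hd : (a.bracket b).1 = a.1 + b.1 := rfl
    rw [toDGFun_cons, h, toDGFun_zsmul, toDGFun_sub, ih, dgLie, dgLie, Fin.sum_univ_succ,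
      Fin.sum_univ_succ]
    simp only [Fin.cons_zero, Fin.cons_succ, Fin.update_cons_zero, ← Fin.cons_update,
      sum_Iio_succ_cons_fst, sum_Iio_zero_fst, toDGFun_cons, sum_update_bracket_fst, hd,
      crossedAction_zsmul, smul_sub, smul_add, smul_sum, smul_smul, ← pow_add]
    rw [sub_add_eq_sub_sub_swap]
    congr 2
    · congr 1
      refine neg_one_pow_congr_even ?_
      simp only [Nat.even_add, Nat.even_mul]
      grind
    · refine sum_congr rfl fun j _ => ?_
      congr 1
      refine neg_one_pow_congr_even ?_
      simp only [Nat.even_add, Nat.even_mul]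
      grind
    · refine neg_one_pow_congr_even ?_
      simp only [Nat.even_add, Nat.even_mul]
      grind

theorem dgD₁_apply {p : ℕ} (f : DGFun A L' L'' p) (ξ : Fin (p + 1) → HForm A L' L'') :
    dgD₁ R A L' L'' p f ξ =
      ∑ i : Fin (p + 1), (-1 : ℤ) ^ ((i : ℕ) + (ξ i).1 * ∑ l ∈ Iio i, (ξ l).1) •
    (crossedAction (ξ i).toForms (f (i.removeNth ξ)) -
      ∑ j ∈ Ioi i, (-1 : ℤ) ^ ((ξ i).1 * ∑ l ∈ (Iio j).erase i, (ξ l).1) •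
        f (i.removeNth (update ξ j ((ξ i).bracket (ξ j))))) := rfl

theorem sum_Iio_succ_erase_zero_cons_fst {p : ℕ} (a : HForm A L' L'') (η : Fin p → HForm A L' L'')
    (j : Fin p) :
    ∑ l ∈ (Iio j.succ).erase 0, ((Fin.cons a η : Fin (p + 1) → HForm A L' L'') l).1 =
      ∑ l ∈ Iio j, (η l).1 := by
  have h := add_sum_erase (Iio j.succ)
    (fun l => ((Fin.cons a η : Fin (p + 1) → HForm A L' L'') l).1) (a := 0) (by simp)
  rw [sum_Iio_succ_cons_fst] at h
  exact Nat.add_left_cancel h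

theorem sum_Iio_succ_erase_succ_cons_fst {p : ℕ} (a : HForm A L' L'')
    (η : Fin p → HForm A L' L'') {i j : Fin p} (hij : i < j) :
    ∑ l ∈ (Iio j.succ).erase i.succ, ((Fin.cons a η : Fin (p + 1) → HForm A L' L'') l).1 =
      a.1 + ∑ l ∈ (Iio j).erase i, (η l).1 := by
  have h := add_sum_erase (Iio j.succ)
    (fun l => ((Fin.cons a η : Fin (p + 1) → HForm A L' L'') l).1) (a := i.succ) (by simpa)
  have h' := add_sum_erase (Iio j) (fun l => (η l).1) (a := i) (by simpa)
  rw [sum_Iio_succ_cons_fst] at h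
  simp only [Fin.cons_succ] at h
  omega

theorem sum_removeNth_fst {p : ℕ} (η : Fin (p + 1) → HForm A L' L'') (i : Fin (p + 1)) :
    (η i).1 + ∑ l, (i.removeNth η l).1 = ∑ l, (η l).1 :=
  (Fin.sum_univ_succAbove (fun l => (η l).1) i).symm

theorem dgD₁_zero (f : DGFun A L' L'' 0) (a : HForm A L' L'') (η : Fin 0 → HForm A L' L'') :
    dgD₁ R A L' L'' 0 f (Fin.cons a η) = dgLie a f η := by
  rw [dgD₁_apply, Fin.sum_univ_succ, dgLie]
  simp only [univ_eq_empty, sum_empty, sum_Ioi_zero]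
  simp [sum_Iio_zero_fst]

/-- The graded Cartan-Chevalley-Eilenberg operator satisfies Cartan's formula
`i_a d + d i_a = L_a`: here `g` is the contraction of `f` with `a`, up to the Koszul sign of
moving `a` past the other arguments. -/
theorem dgD₁_succ {p : ℕ} {f : DGFun A L' L'' (p + 1)} {g : DGFun A L' L'' p} {a : HForm A L' L''}
    (h : ∀ η, f (Fin.cons a η) = (-1 : ℤ) ^ (a.1 * ∑ l, (η l).1) • g η)
    (η : Fin (p + 1) → HForm A L' L'') :
    dgD₁ R A L' L'' (p + 1) f (Fin.cons a η) =
      dgLie a f η - (-1 : ℤ) ^ (a.1 * ∑ l, (η l).1) • dgD₁ R A L' L'' p g η := by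
  refine Eq.trans ?_ (sub_eq_add_neg _ _).symm
  rw [dgD₁_apply, Fin.sum_univ_succ]
  congr 1
  · rw [dgLie, sum_Ioi_zero]
    simp only [Fin.val_zero, sum_Iio_zero_fst, mul_zero, add_zero, pow_zero, one_smul,
      Fin.cons_zero, Fin.cons_succ, sum_Iio_succ_erase_zero_cons_fst, Fin.removeNth_zero,
      Fin.tail_cons, ← Fin.cons_update]
  · rw [dgD₁_apply, smul_sum, ← sum_neg_distrib]
    refine sum_congr rfl fun i _ => ?_
    rw [sum_Ioi_succ, ← neg_smul, ← smul_assoc]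
    -- The signs agree because omitting the `i`-th argument changes the total degree by `|ηᵢ|`, and
    -- replacing `ηⱼ` by `[ηᵢ, ηⱼ]` restores it.
    have hs := sum_removeNth_fst η i
    have hb : ∀ j ∈ Ioi i, ∑ l, (i.removeNth (update η j ((η i).bracket (η j))) l).1 =
        ∑ l, (η l).1 := by
      intro j hj
      have h1 := sum_removeNth_fst (update η j ((η i).bracket (η j))) i
      rw [sum_update_bracket_fst, update_of_ne (ne_of_lt (mem_Ioi.mp hj))] at h1
      omega
    rw [sum_congr rfl (g := fun j => (-1 : ℤ) ^ ((η i).1 * (a.1 + ∑ l ∈ (Iio j).erase i, (η l).1)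
      + a.1 * ∑ l, (η l).1) • g (i.removeNth (update η j ((η i).bracket (η j)))))]
    · simp only [Fin.cons_succ, removeNth_succ_cons, h, crossedAction_zsmul, smul_sub, smul_sum,
        smul_smul, sum_Iio_succ_cons_fst, Fin.val_succ, ← hs, smul_eq_mul, neg_mul, neg_smul,
        ← pow_add]
      simp only [← neg_smul]
      congr 1
      · congr 1
        refine neg_one_pow_eq_neg_of_even ?_
        simp only [Nat.even_add, Nat.even_mul, Nat.not_even_one]
        grind
      · refine sum_congr rfl fun j _ => ?_
        congr 1
        refine neg_one_pow_eq_neg_of_even ?_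
        simp only [Nat.even_add, Nat.even_mul, Nat.not_even_one]
        grind
    · intro j hj
      simp only [Fin.cons_succ, sum_Iio_succ_erase_succ_cons_fst a η (mem_Ioi.mp hj),
        ← Fin.cons_update, removeNth_succ_cons, h, hb j hj, smul_smul, ← pow_add]

/-- The operator `d'` corresponds to the graded Cartan-Chevalley-Eilenberg operator. -/
theorem toDGFun_dPrimeOp [Module.Finite A L'] [Module.Projective A L'] {p : ℕ}
    (F : BiForms A L' L'') (ξ : Fin (p + 1) → HForm A L' L'') :
    toDGFun (p + 1) (dPrimeOp R A L' L'' F) ξ = dgD₁ R A L' L'' p (toDGFun p F) ξ := by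
  induction p generalizing F with
  | zero =>
    obtain ⟨a, η, rfl⟩ : ∃ a η, ξ = Fin.cons a η := ⟨_, _, (Fin.cons_self_tail ξ).symm⟩
    have h : insertFormOp a.toForms (dPrimeOp R A L' L'' F) =
        lieFormOp R a.toForms F - dPrimeOp R A L' L'' (insertFormOp a.toForms F) :=
      (add_sub_cancel_right _ _).symm
    have h0 : toDGFun 0 (dPrimeOp R A L' L'' (insertFormOp a.toForms F)) η = 0 := by
      rw [toDGFun_zero, dPrimeOp_apply_zero, map_zero]
    rw [toDGFun_cons, h, toDGFun_sub, toDGFun_lieFormOp, h0, sub_zero, smul_smul, ← pow_add,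
      Even.neg_one_pow ⟨_, rfl⟩, one_smul, dgD₁_zero]
  | succ p ih =>
    obtain ⟨a, η, rfl⟩ : ∃ a η, ξ = Fin.cons a η := ⟨_, _, (Fin.cons_self_tail ξ).symm⟩
    have h : insertFormOp a.toForms (dPrimeOp R A L' L'' F) =
        lieFormOp R a.toForms F - dPrimeOp R A L' L'' (insertFormOp a.toForms F) :=
      (add_sub_cancel_right _ _).symm
    rw [toDGFun_cons, h, toDGFun_sub, toDGFun_lieFormOp, ih, smul_sub, smul_smul, ← pow_add,
      Even.neg_one_pow ⟨_, rfl⟩, one_smul, dgD₁_succ R (fun η => toDGFun_cons F a η)]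

/-- The total differentials correspond to each other. -/
theorem dgD_toDGFun [Module.Finite A L'] [Module.Projective A L'] (F : BiForms A L' L'') :
    dgD R A L' L'' (fun p => toDGFun p F) = fun p => toDGFun p (biFormsD R A L' L'' F) := by
  funext p ξ
  have h : toDGFun p (biFormsD R A L' L'' F) ξ = toDGFun p (dPrimeOp R A L' L'' F) ξ +
      (-1 : ℤ) ^ p • toDGFun p (dDoublePrimeOp R A L' L'' F) ξ := by
    rw [← toDGFun_zsmul, ← toDGFun_add]
    exact toDGFun_congr p (biFormsD_apply R F p) ξ
  rw [h, toDGFun_dDoublePrimeOp]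
  cases p with
  | zero =>
    rw [toDGFun_zero, dPrimeOp_apply_zero, map_zero]
    rfl
  | succ p =>
    rw [toDGFun_dPrimeOp]
    rfl

end compatibility

/-! ### The isomorphism with the cochains of the crossed product -/

section dgIsomorphism

variable (R A L' L'' : Type*) [CommRing R] [CommRing A] [Algebra R A]
  [LieRing L'] [LieAlgebra R L'] [Module A L'] [LieRingModule L' A] [LieRinehartRing A L']
  [LieRinehartAlgebra R A L']
  [LieRing L''] [LieAlgebra R L''] [Module A L''] [LieRingModule L'' A] [LieRinehartRing A L'']
  [LieRinehartAlgebra R A L'']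
  [LieRingModule L' L''] [LieModule R L' L''] [LieRinehartModule A L' L'']
  [LieRingModule L'' L'] [LieModule R L'' L'] [LieRinehartModule A L'' L']

variable {A L' L''}

/-- On elements of `L'` all signs are trivial and `toDGFun` is evaluation. -/
theorem toDGFun_const {p : ℕ} (F : BiForms A L' L'') (x : Fin p → L') (q : ℕ)
    (v : Fin q → L'') : toDGFun p F (fun i => HForm.const (x i)) q v = F p q v x := by
  induction p generalizing F with
  | zero =>
    rw [Subsingleton.elim x ![]]
    rfl
  | succ p ih =>
    have h : insertFormOp (HForm.const (A := A) (L'' := L'') (x 0)).toForms F =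
        insertOp (x 0) F :=
      funext fun p => pairWedge_single_zero _ _ _
    have hx : (fun i => HForm.const (x i) : Fin (p + 1) → HForm A L' L'') =
        Fin.cons (HForm.const (x 0)) (fun i => HForm.const (Fin.tail x i)) :=
      (Fin.cons_self_tail _).symm
    have h0 : (HForm.const (x 0) : HForm A L' L'').1 = 0 := rfl
    rw [hx, toDGFun_cons, h, h0, zero_mul, pow_zero, one_smul, ih]
    change F (p + 1) q v (Fin.cons (x 0) (Fin.tail x)) = _
    rw [Fin.cons_self_tail]

variable (A L' L'') in
/-- The map from bigraded forms to cochains of the crossed product. -/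
def toDGCochains (N : ℕ) : biFormsDegree R A L' L'' N →ₗ[R] dgCochains R A L' L'' N where
  toFun F := ⟨fun p => toDGFun p F.1, fun p ξ =>
    ⟨fun n hn => toDGFun_eq_zero (N := N) (fun q hq => F.2 p q (by omega)) ξ
        (by exact_mod_cast hn),
      fun i k x y => toDGFun_update_add _ _ _ _ _ _,
      fun i m α => toDGFun_update_smul _ _ _ _,
      fun i j hij => toDGFun_swap _ _ _ _ hij,
      fun i j hij h he => toDGFun_eq_zero_of_eq _ _ _ _ hij h he⟩⟩
  map_add' F G := Subtype.ext (funext fun p => funext fun ξ => toDGFun_add p F.1 G.1 ξ)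
  map_smul' r F := Subtype.ext (funext fun p => funext fun ξ => by
    change toDGFun p (r • F.1) ξ = r • toDGFun p F.1 ξ
    rw [← algebraMap_smul A r F.1, toDGFun_smul, algebraMap_smul])

theorem HForm.const_add (x y : L') : (HForm.const (x + y) : HForm A L' L'') =
    ⟨0, AlternatingMap.constOfIsEmpty A L'' (Fin 0) x +
      AlternatingMap.constOfIsEmpty A L'' (Fin 0) y⟩ := rfl

theorem HForm.smul_const {m : ℕ} (α : L'' [⋀^Fin m]→ₗ[A] A) (x : L') :
    (HForm.const x).smul α = ⟨m, tensorForm x (Pi.single m α) m⟩ := by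
  have h := congrFun (wedge_single_zero (Pi.single m α)
    (AlternatingMap.constOfIsEmpty A L'' (Fin 0) x)) m
  exact Sigma.ext rfl (heq_of_eq h)

theorem HForm.const_smul (a : A) (x : L') : (HForm.const (a • x) : HForm A L' L'') =
    (HForm.const x).smul (AlternatingMap.constOfIsEmpty A L'' (Fin 0) a) := by
  have h : AlternatingMap.constOfIsEmpty A L'' (Fin 0) (a • x) =
      tensorForm x (Pi.single 0 (AlternatingMap.constOfIsEmpty A L'' (Fin 0) a)) 0 := by
    ext v
    rw [tensorForm_apply, Pi.single_eq_same]
    rfl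
  rw [HForm.smul_const, ← h]
  rfl

variable {R}

/-- A cochain of the crossed product is determined by its values on elements of `L'`. -/
theorem dgCochains_eq_zero [Module.Finite A L'] [Module.Projective A L'] {N : ℕ}
    {f : ∀ p, DGFun A L' L'' p} (hf : f ∈ dgCochains R A L' L'' N)
    (h : ∀ p (x : Fin p → L'), f p (fun i => HForm.const (x i)) = 0) : f = 0 := by
  funext p ξ
  -- The arguments are replaced by elements of `L'` one after the other, from the last to the first.
  have key : ∀ (j : ℕ) (ξ : Fin p → HForm A L' L''),
      (∀ i : Fin p, j ≤ i → ∃ x, ξ i = HForm.const x) → f p ξ = 0 := by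
    intro j
    induction j with
    | zero =>
      intro ξ hξ
      choose x hx using fun i => hξ i (Nat.zero_le _)
      rw [funext hx]
      exact h p x
    | succ j ih =>
      intro ξ hξ
      by_cases hj : j < p
      · have hu : ∀ ω : Forms A L'' L', ω = Pi.single (ξ ⟨j, hj⟩).1 (ξ ⟨j, hj⟩).2 →
            f p (update ξ ⟨j, hj⟩ ⟨(ξ ⟨j, hj⟩).1, ω (ξ ⟨j, hj⟩).1⟩) = 0 := by
          rintro ω rfl
          have hadd := fun k => (hf p ξ).2.1 ⟨j, hj⟩ k
          refine forms_induction (P := fun ω : Forms A L'' L' =>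
            f p (update ξ ⟨j, hj⟩ ⟨(ξ ⟨j, hj⟩).1, ω (ξ ⟨j, hj⟩).1⟩) = 0) ?_ ?_ ?_ (ξ ⟨j, hj⟩).2
          · have := hadd (ξ ⟨j, hj⟩).1 0 0
            rw [add_zero] at this
            exact left_eq_add.mp this
          · intro ω η hω hη
            rw [Pi.add_apply, hadd, hω, hη, add_zero]
          · intro x α
            rw [← HForm.smul_const]
            have := (hf p (update ξ ⟨j, hj⟩ (HForm.const x))).2.2.1 ⟨j, hj⟩ _ α
            rw [update_idem, update_self, ih (update ξ ⟨j, hj⟩ (HForm.const x))] at this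
            · rw [this, wedge_eq_pairWedge, map_zero, smul_zero]
            · intro i hi
              by_cases hij : i = ⟨j, hj⟩
              · exact ⟨x, by rw [hij, update_self]⟩
              · rw [update_of_ne hij]
                exact hξ i (lt_of_le_of_ne hi fun e => hij (Fin.ext e.symm))
        have := hu _ rfl
        rwa [Pi.single_eq_same, Sigma.eta, update_eq_self] at this
      · exact ih ξ fun i hi => absurd (lt_of_le_of_lt hi i.2) hj
  exact key p ξ fun i hi => absurd i.2 (not_lt_of_ge hi)

theorem update_const {p : ℕ} (x : Fin p → L') (i : Fin p) (y : L') :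
    (fun j => HForm.const (update x i y j) : Fin p → HForm A L' L'') =
      update (fun j => HForm.const (x j)) i (HForm.const y) := by
  funext j
  by_cases h : j = i
  · subst h; simp
  · simp [h]

/-- The restriction of a cochain of the crossed product to elements of `L'`. -/
def dgRestrict {N : ℕ} {f : ∀ p, DGFun A L' L'' p} (hf : f ∈ dgCochains R A L' L'' N) (p q : ℕ) :
    L' [⋀^Fin p]→ₗ[A] (L'' [⋀^Fin q]→ₗ[A] A) :=
  AlternatingMap.ofAdjacent (fun x => f p (fun i => HForm.const (x i)) q)
    (fun x i y z => by
      simp only [update_const, HForm.const_add]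
      exact congrFun ((hf p _).2.1 i 0 _ _) q)
    (fun x i j hij h => congrFun ((hf p _).2.2.2.2 i j hij (congrArg HForm.const h)
      Even.zero) q)
    (fun x i a y _ => by
      simp only [update_const, HForm.const_smul]
      have := (hf p (update (fun j => HForm.const (x j)) i (HForm.const y))).2.2.1 i _
        (AlternatingMap.constOfIsEmpty A L'' (Fin 0) a)
      rw [update_idem, update_self, zero_mul, pow_zero, one_smul, wedge_single_zero_left] at this
      exact congrFun this q)

/-- Injectivity holds because a bigraded form can be read off from the values on elements of `L'`,
surjectivity because a cochain is determined by these values. -/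
theorem toDGCochains_bijective [Module.Finite A L'] [Module.Projective A L'] (N : ℕ) :
    Function.Bijective (toDGCochains R A L' L'' N) := by
  constructor
  · rw [injective_iff_map_eq_zero]
    intro F hF
    refine Subtype.ext (funext fun p => funext fun q => ?_)
    ext v x
    rw [← toDGFun_const]
    exact congrArg (fun f : ∀ p, DGFun A L' L'' p => f p (fun i => HForm.const (x i)) q v)
      (congrArg Subtype.val hF)
  · intro f
    refine ⟨⟨fun p q => altSwap R (dgRestrict f.2 p q), fun p q hpq => ?_⟩, ?_⟩
    · ext v x
      change f.1 p (fun i => HForm.const (x i)) q v = 0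
      have hs : ∑ i, (HForm.const (x i) : HForm A L' L'').1 = 0 := sum_eq_zero fun i _ => rfl
      rw [(f.2 p _).1 q (by rw [hs]; omega)]
      rfl
    · rw [← sub_eq_zero]
      refine Subtype.ext (dgCochains_eq_zero (Subtype.property _) fun p x => funext fun q => ?_)
      ext v
      refine sub_eq_zero.mpr ((toDGFun_const _ x q v).trans ?_)
      rfl

end dgIsomorphism

/-! ### Forms on the twilled sum -/

namespace TwilledSum

section projections

variable {A L' L'' : Type*} [CommRing A] [AddCommGroup L'] [AddCommGroup L'']
  [Module A L'] [Module A L'']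

variable (A L' L'') in
/-- The projection onto `L'`. -/
def fstLinear : TwilledSum A L' L'' →ₗ[A] L' := LinearMap.fst A L' L''

variable (A L' L'') in
/-- The projection onto `L''`. -/
def sndLinear : TwilledSum A L' L'' →ₗ[A] L'' := LinearMap.snd A L' L''

variable (A L' L'') in
/-- The inclusion of `L''` as a linear map. -/
def inrLinear : L'' →ₗ[A] TwilledSum A L' L'' := LinearMap.inr A L' L''

theorem eq_inl_add_inr (z : TwilledSum A L' L'') : z = inl z.1 + inr z.2 :=
  Prod.ext (add_zero z.1).symm (zero_add z.2).symm

theorem inl_add (x y : L') : (inl (x + y) : TwilledSum A L' L'') = inl x + inl y :=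
  Prod.ext rfl (add_zero (0 : L'')).symm

theorem inl_smul (a : A) (x : L') : (inl (a • x) : TwilledSum A L' L'') = a • inl x :=
  Prod.ext rfl (smul_zero a).symm

theorem inr_add (v w : L'') : (inr (v + w) : TwilledSum A L' L'') = inr v + inr w :=
  map_add (inrLinear A L' L'') v w

theorem inr_smul (a : A) (v : L'') : (inr (a • v) : TwilledSum A L' L'') = a • inr v :=
  map_smul (inrLinear A L' L'') a v

end projections

section brackets

variable {A L' L'' : Type*} [CommRing A] [LieRing L'] [LieRing L''] [Module A L'] [Module A L'']
  [LieRingModule L' A] [LieRingModule L'' A] [LieRingModule L' L''] [LieRingModule L'' L']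
  [IsTwilled A L' L'']

theorem lie_inl_inl (x y : L') :
    ⁅(inl x : TwilledSum A L' L''), (inl y : TwilledSum A L' L'')⁆ = inl ⁅x, y⁆ := by
  change ((⁅x, y⁆ + ⁅(0 : L''), y⁆ - ⁅(0 : L''), x⁆, ⁅(0 : L''), (0 : L'')⁆ + ⁅x, (0 : L'')⁆ -
    ⁅y, (0 : L'')⁆) : L' × L'') = (⁅x, y⁆, (0 : L''))
  simp

theorem lie_inl_inr (x : L') (v : L'') :
    ⁅(inl x : TwilledSum A L' L''), (inr v : TwilledSum A L' L'')⁆ =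
      inr ⁅x, v⁆ - inl ⁅v, x⁆ := by
  change ((⁅x, (0 : L')⁆ + ⁅(0 : L''), (0 : L')⁆ - ⁅v, x⁆, ⁅(0 : L''), v⁆ + ⁅x, v⁆ -
    ⁅(0 : L'), (0 : L'')⁆) : L' × L'') = ((0 : L') - ⁅v, x⁆, ⁅x, v⁆ - (0 : L''))
  simp

theorem lie_inr_inr (v w : L'') :
    ⁅(inr v : TwilledSum A L' L''), (inr w : TwilledSum A L' L'')⁆ = inr ⁅v, w⁆ := by
  change ((⁅(0 : L'), (0 : L')⁆ + ⁅v, (0 : L')⁆ - ⁅w, (0 : L')⁆, ⁅v, w⁆ + ⁅(0 : L'), w⁆ -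
    ⁅(0 : L'), v⁆) : L' × L'') = ((0 : L'), ⁅v, w⁆)
  simp

theorem inl_lie (x : L') (a : A) : ⁅(inl x : TwilledSum A L' L''), a⁆ = ⁅x, a⁆ := by
  change ⁅x, a⁆ + ⁅(0 : L''), a⁆ = ⁅x, a⁆
  simp

theorem inr_lie (v : L'') (a : A) : ⁅(inr v : TwilledSum A L' L''), a⁆ = ⁅v, a⁆ := by
  change ⁅(0 : L'), a⁆ + ⁅v, a⁆ = ⁅v, a⁆
  simp

end brackets

end TwilledSum

section restriction

open TwilledSum

variable {A L' L'' M : Type*} [CommRing A] [AddCommGroup L'] [AddCommGroup L'']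
  [Module A L'] [Module A L''] [AddCommGroup M] [Module A M]

theorem twilledSum_succ_ext {ω η : Forms A (TwilledSum A L' L'') M} {n : ℕ}
    (h : ∀ x, contract (inl x) ω n = contract (inl x) η n)
    (h' : ∀ v, contract (inr v) ω n = contract (inr v) η n) : ω (n + 1) = η (n + 1) := by
  refine succ_ext_of_contract fun z => ?_
  rw [eq_inl_add_inr z, contract_add_left, contract_add_left, Pi.add_apply, Pi.add_apply, h, h']

/-- The restriction of forms on `L' ⊕ L''` to `L''`. -/
def restrictSnd (ω : Forms A (TwilledSum A L' L'') M) : Forms A L'' M :=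
  fun n => (ω n).compLinearMap (inrLinear A L' L'')

theorem restrictSnd_apply (ω : Forms A (TwilledSum A L' L'') M) (n : ℕ) (v : Fin n → L'') :
    restrictSnd ω n v = ω n (fun i => inr (v i)) := rfl

/-- A form on `L' ⊕ L''` is determined by its contractions with elements of `L'` and its
restriction to `L''`. -/
theorem twilledSum_succ_ext_of_restrictSnd {ω η : Forms A (TwilledSum A L' L'') M} {n : ℕ}
    (h : ∀ x, contract (inl x) ω n = contract (inl x) η n)
    (h' : restrictSnd ω (n + 1) = restrictSnd η (n + 1)) : ω (n + 1) = η (n + 1) := by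
  rw [← sub_eq_zero]
  set ψ := ω (n + 1) - η (n + 1) with hψ
  -- The difference vanishes as soon as one of its arguments belongs to `L'`, so that its arguments
  -- may be replaced by their components in `L''`.
  have h0 : ∀ (x : L') (z : Fin (n + 1) → TwilledSum A L' L'') (i : Fin (n + 1)),
      ψ (update z i (inl x)) = 0 := by
    have hc : ∀ (x : L') (w : Fin n → TwilledSum A L' L''), ψ (Fin.cons (inl x) w) = 0 :=
      fun x w => sub_eq_zero.mpr
        (congrArg (fun f : TwilledSum A L' L'' [⋀^Fin n]→ₗ[A] M => f w) (h x))
    intro x z i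
    by_cases hi : i = 0
    · subst hi
      rw [← Fin.cons_self_tail z, Fin.update_cons_zero, hc]
    · have := ψ.map_swap (update z i (inl x)) (Ne.symm hi)
      rw [← neg_eq_zero, ← this, ← Fin.cons_self_tail (_ ∘ _), comp_apply, Equiv.swap_apply_left,
        update_self, hc]
  have h1 : ∀ (z : Fin (n + 1) → TwilledSum A L' L'') (S : Finset (Fin (n + 1))),
      ψ (S.piecewise (fun i => inr (z i).2) z) = ψ z := by
    intro z S
    induction S using Finset.induction_on with
    | empty => simp
    | insert i S hi ih =>
      have e : S.piecewise (fun i => inr (z i).2) z = update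
          (S.piecewise (fun i => inr (z i).2) z) i (inl (z i).1 + inr (z i).2) := by
        rw [← eq_inl_add_inr, eq_comm, update_eq_self_iff, piecewise_eq_of_notMem _ _ _ hi]
      rw [piecewise_insert, ← ih]
      conv_rhs => rw [e]
      rw [ψ.map_update_add, h0, zero_add]
  ext z
  rw [← h1 z univ, piecewise_univ]
  exact sub_eq_zero.mpr (congrArg (fun f : L'' [⋀^Fin (n + 1)]→ₗ[A] M => f fun i => (z i).2) h')

end restriction

section comparison

open TwilledSum ModDer

variable (R : Type*) {A L' L'' : Type*} [CommRing R] [CommRing A] [Algebra R A]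
  [LieRing L'] [LieAlgebra R L'] [Module A L'] [LieRingModule L' A] [LieRinehartRing A L']
  [LieRinehartAlgebra R A L']
  [LieRing L''] [LieAlgebra R L''] [Module A L''] [LieRingModule L'' A] [LieRinehartRing A L'']
  [LieRinehartAlgebra R A L'']
  [LieRingModule L' L''] [LieModule R L' L''] [LieRinehartModule A L' L'']
  [LieRingModule L'' L'] [LieModule R L'' L'] [LieRinehartModule A L'' L']

/-- The maps `(z, w) ↦ F(w₁'', …, w_q'')(z₁', …, z_p')` on `L' ⊕ L''`. -/
def twilledPair (F : BiForms A L' L'') :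
    DoubleForms A (TwilledSum A L' L'') (TwilledSum A L' L'') A := fun p q =>
  (altSwap A ((F p q).compLinearMap (sndLinear A L' L''))).compLinearMap (fstLinear A L' L'')

theorem twilledPair_apply (F : BiForms A L' L'') (p q : ℕ) (z : Fin p → TwilledSum A L' L'')
    (w : Fin q → TwilledSum A L' L'') :
    twilledPair F p q z w = F p q (fun j => (w j).2) (fun i => (z i).1) := rfl

/-- The form on `L' ⊕ L''` that corresponds to a bigraded form. -/
def toTwilledForms : BiForms A L' L'' →ₗ[A] Forms A (TwilledSum A L' L'') A where
  toFun F := shuffleForm (twilledPair F)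
  map_add' F G := shuffleForm_add (twilledPair F) (twilledPair G)
  map_smul' a F := shuffleForm_smul a (twilledPair F)

theorem toTwilledForms_zero_apply (F : BiForms A L' L'') (z : Fin 0 → TwilledSum A L' L'') :
    toTwilledForms F 0 z = F 0 0 ![] ![] := by
  refine (shuffleForm_zero_apply (twilledPair F) z).trans ?_
  rw [twilledPair_apply]
  exact congrArg₂ (fun v x => F 0 0 v x) (Subsingleton.elim _ _) (Subsingleton.elim _ _)

/-- Contraction of bigraded forms with `v ∈ L''`, with the sign `(-1)ᵖ`. -/
def contractOp (v : L'') : Module.End ℤ (BiForms A L' L'') := AddMonoidHom.toIntLinearMap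
  { toFun := fun (F : BiForms A L' L'') p => (-1 : ℤ) ^ p • contract v (F p)
    map_zero' := by funext p; simp
    map_add' := fun (_ _ : BiForms A L' L'') => by funext p; simp }

theorem contractOp_apply (v : L'') (F : BiForms A L' L'') (p : ℕ) :
    contractOp v F p = (-1 : ℤ) ^ p • contract v (F p) := rfl

theorem fst_cons {p : ℕ} (a : TwilledSum A L' L'') (z : Fin p → TwilledSum A L' L'') :
    (fun i => ((Fin.cons a z : Fin (p + 1) → TwilledSum A L' L'') i).1) =
      (Fin.cons a.1 fun i => (z i).1 : Fin (p + 1) → L') := by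
  funext i
  refine Fin.cases rfl (fun i => rfl) i

theorem snd_cons {p : ℕ} (a : TwilledSum A L' L'') (z : Fin p → TwilledSum A L' L'') :
    (fun i => ((Fin.cons a z : Fin (p + 1) → TwilledSum A L' L'') i).2) =
      (Fin.cons a.2 fun i => (z i).2 : Fin (p + 1) → L'') := by
  funext i
  refine Fin.cases rfl (fun i => rfl) i

theorem contract_inl_toTwilledForms (x : L') (F : BiForms A L' L'') :
    contract (inl x) (toTwilledForms F) = toTwilledForms (insertOp x F) := by
  have h1 : contractFst (inl x) (twilledPair F) = twilledPair (insertOp x F) := by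
    funext p q
    ext z w
    rw [contractFst_apply, twilledPair_apply, fst_cons]
    rfl
  have h2 : contractSnd (inl x) (twilledPair F) = 0 := by
    funext p q
    ext z w
    have h0 := (F p (q + 1)).map_coord_zero
      (m := (Fin.cons (0 : L'') fun i => (w i).2 : Fin (q + 1) → L'')) 0 rfl
    rw [contractSnd_apply, twilledPair_apply, snd_cons]
    refine (congrArg (fun f : L' [⋀^Fin p]→ₗ[A] A => (-1 : ℤ) ^ p • f fun i => (z i).1) h0).trans ?_
    exact smul_zero _
  refine (contract_shuffleForm (inl x) (twilledPair F)).trans ?_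
  rw [h1, h2]
  have h0 := shuffleForm_smul (0 : A)
    (0 : DoubleForms A (TwilledSum A L' L'') (TwilledSum A L' L'') A)
  rw [zero_smul, zero_smul] at h0
  rw [h0, add_zero]
  rfl

theorem contract_inr_toTwilledForms (v : L'') (F : BiForms A L' L'') :
    contract (inr v) (toTwilledForms F) = toTwilledForms (contractOp v F) := by
  have h1 : contractSnd (inr v) (twilledPair F) = twilledPair (contractOp v F) := by
    funext p q
    ext z w
    rw [contractSnd_apply, twilledPair_apply, snd_cons]
    rfl
  have h2 : contractFst (inr v) (twilledPair F) = 0 := by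
    funext p q
    ext z w
    rw [contractFst_apply, twilledPair_apply, fst_cons]
    exact (F (p + 1) q _).map_coord_zero 0 rfl
  refine (contract_shuffleForm (inr v) (twilledPair F)).trans ?_
  rw [h1, h2]
  have h0 := shuffleForm_smul (0 : A)
    (0 : DoubleForms A (TwilledSum A L' L'') (TwilledSum A L' L'') A)
  rw [zero_smul, zero_smul] at h0
  rw [h0, zero_add]
  rfl

/-- The `1`-form `v ↦ v · x` on `L''` with values in `L'`. -/
def actionForm (x : L') : Forms A L'' L' :=
  Pi.single (0 + 1) (ceD (AlternatingMap.constOfIsEmpty A L'' (Fin 0) x))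

theorem contract_actionForm (v : L'') (x : L') :
    contract v (actionForm x) =
      (Pi.single 0 (AlternatingMap.constOfIsEmpty A L'' (Fin 0) ⁅v, x⁆) : Forms A L'' L') := by
  rw [actionForm, contract_single_succ]
  congr 1
  ext w
  change ceFun _ (Fin.cons v w) = ⁅v, x⁆
  rw [ceFun]
  simp only [Fin.sum_univ_succ, univ_eq_empty, sum_empty, sum_Ioi_zero]
  simp

theorem twist_actionForm (x : L') :
    twist (-1) (actionForm x : Forms A L'' L') = -actionForm x := by
  have h : (-1 : ℤ) ^ (0 + 1) = -1 := by norm_num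
  rw [actionForm, twist_single, h, neg_one_smul]

/-- The operator on bigraded forms that corresponds to the Lie derivative of forms on `L' ⊕ L''`
along `x ∈ L'`. The second term comes from the component `-v · x ∈ L'` of `[x, v]`, for `v ∈ L''`;
its sign `(-1)ᵖ` from moving that component to the front of the `p` arguments in `L'`. -/
def twilledLieOp (x : L') : Module.End ℤ (BiForms A L' L'') := lieOp x +
  AddMonoidHom.toIntLinearMap
  { toFun := fun (F : BiForms A L' L'') p => (-1 : ℤ) ^ p • insertFormOp (actionForm x) F p
    map_zero' := by funext p; simp
    map_add' := fun (F G : BiForms A L' L'') => by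
      funext p
      rw [map_add]
      exact smul_add _ _ _ }

theorem twilledLieOp_apply (x : L') (F : BiForms A L' L'') (p : ℕ) :
    twilledLieOp x F p = lieOp x F p + (-1 : ℤ) ^ p • insertFormOp (actionForm x) F p := rfl

theorem insertOp_apply_of_eq (x : L') {F G H : BiForms A L' L''} {p : ℕ} {c : ℤ}
    (h : F (p + 1) = G (p + 1) + c • H (p + 1)) :
    insertOp x F p = insertOp x G p + c • insertOp x H p := by
  rw [insertOp_apply, insertOp_apply, insertOp_apply, h, map_add, map_zsmul]

/-- The commutator of contraction and Lie derivative on `L' ⊕ L''`, for `[x, y] ∈ L'`. -/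
theorem insertOp_twilledLieOp (x y : L') (F : BiForms A L' L'') :
    insertOp y (twilledLieOp x F) = twilledLieOp x (insertOp y F) - insertOp ⁅x, y⁆ F := by
  funext p
  have h1 : insertOp y (lieOp x F) = lieOp x (insertOp y F) - insertOp ⁅x, y⁆ F :=
    LinearMap.congr_fun (insertOp_mul_lieOp y x) F
  have h2 : insertOp y (insertFormOp (actionForm x) F) =
      -insertFormOp (actionForm x) (insertOp y F) := by
    have := LinearMap.congr_fun (insertOp_mul_insertFormOp y (actionForm x)) F
    rwa [Module.End.mul_apply, LinearMap.neg_apply, Module.End.mul_apply] at this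
  have h3 : insertOp y (twilledLieOp x F) p = insertOp y (lieOp x F) p +
      (-1 : ℤ) ^ (p + 1) • insertOp y (insertFormOp (actionForm x) F) p :=
    insertOp_apply_of_eq y (twilledLieOp_apply x F (p + 1))
  rw [h3, h1, h2, Pi.sub_apply, Pi.sub_apply, twilledLieOp_apply, Pi.neg_apply, pow_succ]
  simp only [mul_neg_one, neg_smul, smul_neg, neg_neg]
  abel

/-- The commutator of contraction and Lie derivative on `L' ⊕ L''`, for
`[x, v] = x · v - v · x`. -/
theorem contractOp_twilledLieOp (x : L') (v : L'') (F : BiForms A L' L'') :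
    contractOp v (twilledLieOp x F) =
      twilledLieOp x (contractOp v F) - contractOp ⁅x, v⁆ F + insertOp ⁅v, x⁆ F := by
  funext p
  have h1 : contract v (lieOp x F p) =
      (ofLie x).onForms ((ad x : ModDer (fun a : A => ⁅x, a⁆) L').forms (ofLie x) p)
        (contract v (F p)) - contract ⁅x, v⁆ (F p) :=
    contract_onForms _ _ v (F p)
  have h2 : contract v (insertFormOp (actionForm x) F p) = insertOp ⁅v, x⁆ F p -
      pairWedge (insertPairing A L' A p) (actionForm x) (contract v (F (p + 1))) := by
    rw [insertFormOp_apply, contract_pairWedge, contract_actionForm, pairWedge_single_zero,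
      twist_actionForm, map_neg, LinearMap.neg_apply,
      ← sub_eq_add_neg]
    rfl
  have h3 : insertFormOp (actionForm x) (contractOp v F) p = (-1 : ℤ) ^ (p + 1) •
      pairWedge (insertPairing A L' A p) (actionForm x) (contract v (F (p + 1))) := by
    rw [insertFormOp_apply, contractOp_apply, map_zsmul]
  have h4 : lieOp x (contractOp v F) p = (-1 : ℤ) ^ p •
      (ofLie x).onForms ((ad x : ModDer (fun a : A => ⁅x, a⁆) L').forms (ofLie x) p)
        (contract v (F p)) := map_zsmul ((ofLie x).onForms _) ((-1 : ℤ) ^ p) (contract v (F p))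
  have hs : (-1 : ℤ) ^ p * (-1) ^ p = 1 := by
    rw [← pow_add, Even.neg_one_pow ⟨_, rfl⟩]
  have hs' : (-1 : ℤ) ^ p * (-1) ^ (p + 1) = -1 := by
    rw [pow_succ, ← mul_assoc, hs, one_mul]
  rw [contractOp_apply, twilledLieOp_apply, map_add, map_zsmul, h1, h2, Pi.add_apply,
    Pi.sub_apply, twilledLieOp_apply, h3, h4, contractOp_apply]
  simp only [smul_add, smul_sub, smul_smul, hs, hs', one_smul, neg_one_smul]
  abel

theorem restrictSnd_toTwilledForms (F : BiForms A L' L'') :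
    restrictSnd (toTwilledForms F) = mapForms (evalZero A L' A) (F 0) := by
  funext n
  induction n generalizing F with
  | zero =>
    refine zero_ext ?_
    rw [restrictSnd_apply, toTwilledForms_zero_apply]
    rfl
  | succ n ih =>
    refine succ_ext_of_contract fun v => ?_
    have h : contract v (restrictSnd (toTwilledForms F)) =
        restrictSnd (contract (inr v) (toTwilledForms F)) := by
      funext n
      ext w
      rw [contract_apply, restrictSnd_apply, restrictSnd_apply, contract_apply]
      congr 1
      funext i
      refine Fin.cases rfl (fun i => rfl) i
    rw [h, contract_inr_toTwilledForms, ih, contractOp_apply, pow_zero, one_smul,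
      contract_mapForms]

variable [IsTwilled A L' L'']

/-- The Lie derivative along `x ∈ L'`. -/
theorem lie_toTwilledForms (x : L') (F : BiForms A L' L'') :
    (ad (inl x) : ModDer (fun a : A => ⁅(inl x : TwilledSum A L' L''), a⁆)
      (TwilledSum A L' L'')).onForms (ofLie (inl x)) (toTwilledForms F) =
        toTwilledForms (twilledLieOp x F) := by
  funext n
  induction n generalizing F with
  | zero =>
    refine zero_ext ?_
    have h : insertFormOp (actionForm x) F 0 0 ![] ![] = 0 := by
      rw [insertFormOp_apply, pairWedge_zero_apply, actionForm, Pi.single_eq_of_ne (by omega),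
        AlternatingMap.zero_apply, map_zero]
      rfl
    have h' : lieOp x F 0 0 ![] ![] = ⁅x, F 0 0 ![] ![]⁆ := by
      change (⁅x, F 0 0 ![] ![]⁆ - ∑ j : Fin 0, _) - (∑ j : Fin 0, _ : L' [⋀^Fin 0]→ₗ[A] A) ![] = _
      rw [Fin.sum_univ_zero, Fin.sum_univ_zero, sub_zero, AlternatingMap.zero_apply, sub_zero]
    rw [onForms_zero_apply, toTwilledForms_zero_apply, toTwilledForms_zero_apply,
      twilledLieOp_apply, pow_zero, one_smul, Pi.add_apply, AlternatingMap.add_apply,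
      AlternatingMap.add_apply, h, h', add_zero]
    exact inl_lie x _
  | succ n ih =>
    have e : ∀ z : TwilledSum A L' L'', (ad (inl x) : ModDer (fun a : A =>
      ⁅(inl x : TwilledSum A L' L''), a⁆) (TwilledSum A L' L'')) z =
        ⁅(inl x : TwilledSum A L' L''), z⁆ := fun _ => rfl
    refine twilledSum_succ_ext (fun y => ?_) fun v => ?_
    · rw [contract_onForms, contract_inl_toTwilledForms, contract_inl_toTwilledForms, Pi.sub_apply,
        ih, e, lie_inl_inl, contract_inl_toTwilledForms, insertOp_twilledLieOp, map_sub,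
        Pi.sub_apply]
    · rw [contract_onForms, contract_inr_toTwilledForms, contract_inr_toTwilledForms, Pi.sub_apply,
        ih, e, lie_inl_inr, contract_sub_left, contract_inl_toTwilledForms,
        contract_inr_toTwilledForms, contractOp_twilledLieOp, map_add, map_sub,
        Pi.add_apply, Pi.sub_apply, Pi.sub_apply]
      abel

/-- Cartan's formula for the total differential of bigraded forms. -/
theorem insertOp_biFormsD (x : L') (F : BiForms A L' L'') :
    insertOp x (biFormsD R A L' L'' F) + biFormsD R A L' L'' (insertOp x F) =
      twilledLieOp x F := by
  funext p
  have h1 : insertOp x (dPrimeOp R A L' L'' F) p + dPrimeOp R A L' L'' (insertOp x F) p =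
      lieOp x F p := by
    have := congrFun (LinearMap.congr_fun (insertOp_dPrimeOp R (A := A) (L'' := L'') x) F) p
    rwa [LinearMap.add_apply, Module.End.mul_apply, Module.End.mul_apply] at this
  have hx : ∀ G : BiForms A L' L'', insertFormOp
      (Pi.single 0 (AlternatingMap.constOfIsEmpty A L'' (Fin 0) x)) G = insertOp x G :=
    fun G => funext fun p => pairWedge_single_zero _ _ _
  have h2 : dDoublePrimeOp R A L' L'' (insertOp x F) p =
      insertFormOp (actionForm x) F p + insertOp x (dDoublePrimeOp R A L' L'' F) p := by
    have := congrFun (LinearMap.congr_fun (dDoublePrimeOp_mul_insertFormOp R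
      (AlternatingMap.constOfIsEmpty A L'' (Fin 0) x)) F) p
    rw [pow_zero, one_smul, Module.End.mul_apply, LinearMap.add_apply, Module.End.mul_apply, hx,
      hx] at this
    exact this
  have h3 : insertOp x (biFormsD R A L' L'' F) p = insertOp x (dPrimeOp R A L' L'' F) p +
      (-1 : ℤ) ^ (p + 1) • insertOp x (dDoublePrimeOp R A L' L'' F) p :=
    insertOp_apply_of_eq x (biFormsD_apply R F (p + 1))
  rw [Pi.add_apply, h3, biFormsD_apply, h2, twilledLieOp_apply, ← h1, pow_succ]
  simp only [mul_neg_one, neg_smul, smul_add]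
  abel

theorem restrictSnd_formsD (ω : Forms A (TwilledSum A L' L'') A) :
    restrictSnd (formsD R A (TwilledSum A L' L'') A ω) = formsD R A L'' A (restrictSnd ω) := by
  funext n
  cases n with
  | zero => ext v; rfl
  | succ n =>
    ext v
    rw [restrictSnd_apply, formsD_succ, formsD_succ, ceD_apply, ceD_apply, ceFun, ceFun]
    refine sum_congr rfl fun i _ => ?_
    congr 1
    rw [inr_lie]
    congr 1
    refine sum_congr rfl fun j _ => ?_
    rw [lie_inr_inr, restrictSnd_apply]
    congr 1
    funext l
    simp only [Fin.removeNth]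
    by_cases h : i.succAbove l = j
    · subst h; simp
    · simp [h]

/-- The total differential of bigraded forms corresponds to the Lie-Rinehart differential of the
twilled sum. -/
theorem formsD_toTwilledForms (F : BiForms A L' L'') :
    formsD R A (TwilledSum A L' L'') A (toTwilledForms F) =
      toTwilledForms (biFormsD R A L' L'' F) := by
  funext n
  induction n generalizing F with
  | zero =>
    refine zero_ext ?_
    rw [formsD_zero, toTwilledForms_zero_apply, biFormsD_apply, dPrimeOp_apply_zero, zero_add,
      pow_zero, one_smul]
    rfl
  | succ n ih =>
    refine twilledSum_succ_ext_of_restrictSnd (fun x => ?_) ?_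
    · rw [contract_formsD, contract_inl_toTwilledForms, contract_inl_toTwilledForms,
        lie_toTwilledForms, Pi.sub_apply, ih, ← insertOp_biFormsD R, map_add, Pi.add_apply,
        add_sub_cancel_right]
    · rw [restrictSnd_formsD, restrictSnd_toTwilledForms, restrictSnd_toTwilledForms,
        formsD_mapForms_evalZero, biFormsD_apply, dPrimeOp_apply_zero, zero_add, pow_zero,
        one_smul]
      rfl

end comparison

/-! ### The isomorphism with the forms on the twilled sum -/

section append

open TwilledSum

variable {A L' L'' M : Type*} [CommRing A] [AddCommGroup L'] [AddCommGroup L'']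
  [Module A L'] [Module A L''] [AddCommGroup M] [Module A M]

variable (A) in
/-- The tuple `(x₁, …, x_p, v₁, …, v_q)` of elements of `L' ⊕ L''`. -/
def appendTwilled {p q : ℕ} (x : Fin p → L') (v : Fin q → L'') :
    Fin (p + q) → TwilledSum A L' L'' :=
  Fin.append (fun i => inl (x i)) (fun j => inr (v j))

theorem appendTwilled_castAdd {p q : ℕ} (x : Fin p → L') (v : Fin q → L'') (i : Fin p) :
    appendTwilled A x v (Fin.castAdd q i) = inl (x i) := Fin.append_left _ _ i

theorem appendTwilled_natAdd {p q : ℕ} (x : Fin p → L') (v : Fin q → L'') (j : Fin q) :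
    appendTwilled A x v (Fin.natAdd p j) = inr (v j) := Fin.append_right _ _ j

theorem appendTwilled_update_left {p q : ℕ} (x : Fin p → L') (v : Fin q → L'') (i : Fin p)
    (y : L') : appendTwilled A (update x i y) v =
      update (appendTwilled A x v) (Fin.castAdd q i) (inl y) := by
  funext k
  refine Fin.addCases (fun l => ?_) (fun l => ?_) k
  · by_cases h : l = i
    · subst h; rw [appendTwilled_castAdd, update_self, update_self]
    · rw [appendTwilled_castAdd, update_of_ne h, update_of_ne (by simpa using h),
        appendTwilled_castAdd]
  · rw [appendTwilled_natAdd, update_of_ne, appendTwilled_natAdd]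
    intro e
    have := congrArg Fin.val e
    simp at this
    omega

theorem appendTwilled_update_right {p q : ℕ} (x : Fin p → L') (v : Fin q → L'') (j : Fin q)
    (w : L'') : appendTwilled A x (update v j w) =
      update (appendTwilled A x v) (Fin.natAdd p j) (inr w) := by
  funext k
  refine Fin.addCases (fun l => ?_) (fun l => ?_) k
  · rw [appendTwilled_castAdd, update_of_ne, appendTwilled_castAdd]
    intro e
    have := congrArg Fin.val e
    simp at this
    omega
  · by_cases h : l = j
    · subst h; rw [appendTwilled_natAdd, update_self, update_self]
    · rw [appendTwilled_natAdd, update_of_ne h, update_of_ne (by simpa using h),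
        appendTwilled_natAdd]

theorem forms_apply_cast {V : Type*} [AddCommGroup V] [Module A V] (ω : Forms A V M) {m n : ℕ}
    (h : m = n) (z : Fin n → V) : ω m (z ∘ Fin.cast h) = ω n z := by
  subst h; rfl

theorem forms_appendTwilled_zero (ω : Forms A (TwilledSum A L' L'') M) {q : ℕ} (x : Fin 0 → L')
    (v : Fin q → L'') : ω (0 + q) (appendTwilled A x v) = restrictSnd ω q v := by
  rw [appendTwilled, Fin.append_left_nil _ _ rfl]
  exact forms_apply_cast ω (Nat.zero_add q) _

theorem forms_appendTwilled_cons (ω : Forms A (TwilledSum A L' L'') M) {p q : ℕ} (y : L')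
    (x : Fin p → L') (v : Fin q → L'') :
    ω (p + 1 + q) (appendTwilled A (Fin.cons y x : Fin (p + 1) → L') v) =
      contract (inl y) ω (p + q) (appendTwilled A x v) := by
  have h : (fun i => inl ((Fin.cons y x : Fin (p + 1) → L') i) : Fin (p + 1) →
      TwilledSum A L' L'') = Fin.cons (inl y) fun i => inl (x i) := by
    funext i
    refine Fin.cases rfl (fun i => rfl) i
  rw [appendTwilled, h, Fin.append_cons, contract_apply]
  exact forms_apply_cast ω (Nat.add_right_comm p 1 q) _

/-- A form on `L' ⊕ L''` is determined by its values on elements of `L'` followed by elements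
of `L''`. -/
theorem twilledForms_eq_zero {ω : Forms A (TwilledSum A L' L'') M}
    (h : ∀ p q (x : Fin p → L') (v : Fin q → L''), ω (p + q) (appendTwilled A x v) = 0) :
    ω = 0 := by
  have hr : ∀ {ω : Forms A (TwilledSum A L' L'') M}, (∀ p q (x : Fin p → L') (v : Fin q → L''),
      ω (p + q) (appendTwilled A x v) = 0) → restrictSnd ω = 0 := by
    intro ω h
    funext q
    ext v
    rw [← forms_appendTwilled_zero ω ![] v, h]
    rfl
  funext n
  induction n generalizing ω with
  | zero =>
    refine zero_ext ?_
    have := congrArg (fun η : Forms A L'' M => η 0 ![]) (hr h)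
    refine Eq.trans ?_ this
    exact congrArg _ (Subsingleton.elim _ _)
  | succ n ih =>
    refine twilledSum_succ_ext_of_restrictSnd (fun y => ?_) ?_
    · refine (ih (ω := contract (inl y) ω) fun p q x v => ?_).trans (by rw [map_zero])
      rw [← forms_appendTwilled_cons, h]
    · rw [hr h]
      rfl

/-- The maps `(v, x) ↦ ω(x₁, …, x_p, v₁, …, v_q)`. -/
def splitForm (ω : Forms A (TwilledSum A L' L'') M) (p q : ℕ) :
    L'' [⋀^Fin q]→ₗ[A] (L' [⋀^Fin p]→ₗ[A] M) where
  toFun v :=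
    { toFun x := ω (p + q) (appendTwilled A x v)
      map_update_add' {inst} x i y z := by
        obtain rfl : inst = instDecidableEqFin p := Subsingleton.elim _ _
        simp only [appendTwilled_update_left, inl_add, AlternatingMap.map_update_add]
      map_update_smul' {inst} x i a y := by
        obtain rfl : inst = instDecidableEqFin p := Subsingleton.elim _ _
        simp only [appendTwilled_update_left, inl_smul, AlternatingMap.map_update_smul]
      map_eq_zero_of_eq' x i j h hij := by
        refine (ω (p + q)).map_eq_zero_of_eq _ (i := Fin.castAdd q i) (j := Fin.castAdd q j) ?_
          (by simpa using hij)
        rw [appendTwilled_castAdd, appendTwilled_castAdd, h] }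
  map_update_add' {inst} v i y z := by
    obtain rfl : inst = instDecidableEqFin q := Subsingleton.elim _ _
    ext x
    change ω (p + q) _ = ω (p + q) _ + ω (p + q) _
    simp only [appendTwilled_update_right, inr_add, AlternatingMap.map_update_add]
  map_update_smul' {inst} v i a y := by
    obtain rfl : inst = instDecidableEqFin q := Subsingleton.elim _ _
    ext x
    change ω (p + q) _ = a • ω (p + q) _
    simp only [appendTwilled_update_right, inr_smul, AlternatingMap.map_update_smul]
  map_eq_zero_of_eq' v i j h hij := by
    ext x
    refine (ω (p + q)).map_eq_zero_of_eq _ (i := Fin.natAdd p i) (j := Fin.natAdd p j) ?_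
      (by simpa using hij)
    rw [appendTwilled_natAdd, appendTwilled_natAdd, h]

end append

section isomorphism

open TwilledSum

variable (R A L' L'' : Type*) [CommRing R] [CommRing A] [Algebra R A]
  [LieRing L'] [LieAlgebra R L'] [Module A L'] [LieRingModule L' A] [LieRinehartRing A L']
  [LieRinehartAlgebra R A L']
  [LieRing L''] [LieAlgebra R L''] [Module A L''] [LieRingModule L'' A] [LieRinehartRing A L'']
  [LieRinehartAlgebra R A L'']
  [LieRingModule L' L''] [LieModule R L' L''] [LieRinehartModule A L' L'']
  [LieRingModule L'' L'] [LieModule R L'' L'] [LieRinehartModule A L'' L']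

variable {A L' L''}

theorem toTwilledForms_appendTwilled (F : BiForms A L' L'') {p q : ℕ} (x : Fin p → L')
    (v : Fin q → L'') : toTwilledForms F (p + q) (appendTwilled A x v) = F p q v x := by
  induction p generalizing F with
  | zero =>
    rw [forms_appendTwilled_zero, restrictSnd_toTwilledForms, mapForms_apply,
      Subsingleton.elim x ![]]
    rfl
  | succ p ih =>
    rw [← Fin.cons_self_tail x, forms_appendTwilled_cons, contract_inl_toTwilledForms, ih]
    rfl

theorem toTwilledForms_injective :
    Injective (toTwilledForms : BiForms A L' L'' →ₗ[A] Forms A (TwilledSum A L' L'') A) := by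
  rw [injective_iff_map_eq_zero]
  intro F hF
  funext p q
  ext v x
  rw [← toTwilledForms_appendTwilled, hF]
  rfl

theorem toTwilledForms_splitForm (ω : Forms A (TwilledSum A L' L'') A) :
    toTwilledForms (splitForm ω : BiForms A L' L'') = ω := by
  rw [← sub_eq_zero]
  refine twilledForms_eq_zero fun p q x v => ?_
  exact sub_eq_zero.mpr (toTwilledForms_appendTwilled _ x v)

theorem toTwilledForms_apply_eq_zero {F : BiForms A L' L''} {n : ℕ}
    (h : ∀ p q, p + q = n → F p q = 0) : toTwilledForms F n = 0 := by
  ext z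
  refine (shuffleForm_apply (twilledPair F) n z).trans (sum_eq_zero fun S _ => ?_)
  have hS : F S.card Sᶜ.card = 0 := h _ _ (by
    have := S.card_add_card_compl
    rwa [Fintype.card_fin] at this)
  have : evalOnPair (twilledPair F) S z = 0 := by
    rw [evalOnPair, twilledPair_apply, hS]
    rfl
  rw [this, smul_zero]

variable [IsTwilled A L' L'']

variable (A L' L'') in
/-- The map from bigraded forms to forms on the twilled sum. -/
def toTwilledCochains (N : ℕ) :
    biFormsDegree R A L' L'' N →ₗ[R] formsDegree R A (TwilledSum A L' L'') A N where
  toFun F := ⟨toTwilledForms F.1, fun n hn =>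
    toTwilledForms_apply_eq_zero fun p q hpq => F.2 p q (by omega)⟩
  map_add' F G := Subtype.ext (map_add toTwilledForms F.1 G.1)
  map_smul' r F := Subtype.ext (by
    change toTwilledForms (r • F.1) = r • toTwilledForms F.1
    rw [← algebraMap_smul A r F.1, map_smul, algebraMap_smul])

theorem toTwilledCochains_bijective (N : ℕ) : Bijective (toTwilledCochains R A L' L'' N) := by
  constructor
  · intro F G h
    exact Subtype.ext (toTwilledForms_injective (congrArg Subtype.val h))
  · intro ω
    refine ⟨⟨splitForm ω.1, fun p q hpq => ?_⟩, Subtype.ext (toTwilledForms_splitForm ω.1)⟩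
    ext v x
    change ω.1 (p + q) _ = 0
    rw [ω.2 (p + q) hpq]
    rfl

end isomorphism

/-! ### Complexes and cohomology -/

namespace CochainSystem

variable {R : Type*} [CommRing R] {K K' K'' : CochainSystem R}

theorem CommutesWithD.symm (hK : K.IsComplex) {Φ : ∀ N, K.C N ≃ₗ[R] K'.C N}
    (h : CommutesWithD Φ) : CommutesWithD fun N => (Φ N).symm := by
  intro N x y hxy
  have hD := (hK N _ ((Φ N).symm x).2).1
  have h1 := h N ((Φ N).symm x) ⟨_, hD⟩ rfl
  rw [LinearEquiv.apply_symm_apply, hxy] at h1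
  rw [Subtype.ext h1, LinearEquiv.symm_apply_apply]

theorem CommutesWithD.trans {Φ : ∀ N, K.C N ≃ₗ[R] K'.C N}
    {Ψ : ∀ N, K'.C N ≃ₗ[R] K''.C N} (h : CommutesWithD Φ) (h' : CommutesWithD Ψ) :
    CommutesWithD fun N => (Φ N).trans (Ψ N) :=
  fun N x y hxy => h' N (Φ N x) (Φ (N + 1) y) (h N x y hxy)

theorem CommutesWithD.map_cocycles {Φ : ∀ N, K.C N ≃ₗ[R] K'.C N} (h : CommutesWithD Φ) {N : ℕ}
    (x : K.cocycles N) : (Φ N ⟨x.1, x.2.1⟩).1 ∈ K'.cocycles N := by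
  refine ⟨(Φ N _).2, ?_⟩
  have := h N ⟨x.1, x.2.1⟩ 0 x.2.2
  rw [map_zero] at this
  exact this

/-- The isomorphism of cocycles induced by an isomorphism of complexes. -/
def cocyclesEquiv {Φ : ∀ N, K.C N ≃ₗ[R] K'.C N} (h : CommutesWithD Φ)
    (h' : CommutesWithD fun N => (Φ N).symm) (N : ℕ) : K.cocycles N ≃ₗ[R] K'.cocycles N where
  toFun x := ⟨(Φ N ⟨x.1, x.2.1⟩).1, h.map_cocycles x⟩
  invFun y := ⟨((Φ N).symm ⟨y.1, y.2.1⟩).1, h'.map_cocycles y⟩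
  map_add' x y := by
    have := congrArg Subtype.val (map_add (Φ N) ⟨x.1, x.2.1⟩ ⟨y.1, y.2.1⟩)
    exact Subtype.ext this
  map_smul' r x := by
    have := congrArg Subtype.val (map_smul (Φ N) r ⟨x.1, x.2.1⟩)
    exact Subtype.ext this
  left_inv x := by
    have := congrArg Subtype.val ((Φ N).symm_apply_apply ⟨x.1, x.2.1⟩)
    exact Subtype.ext this
  right_inv y := by
    have := congrArg Subtype.val ((Φ N).apply_symm_apply ⟨y.1, y.2.1⟩)
    exact Subtype.ext this

theorem CommutesWithD.map_coboundaries {Φ : ∀ N, K.C N ≃ₗ[R] K'.C N}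
    (h : CommutesWithD Φ) {N : ℕ} {x : K.C N} (hx : x.1 ∈ K.coboundaries N) :
    (Φ N x).1 ∈ K'.coboundaries N := by
  cases N with
  | zero =>
    have h0 : x = 0 := Subtype.ext hx
    rw [h0, map_zero]
    exact Submodule.zero_mem _
  | succ N =>
    obtain ⟨y, hy, hyx⟩ := hx
    exact ⟨(Φ N ⟨y, hy⟩).1, (Φ N ⟨y, hy⟩).2, h N ⟨y, hy⟩ x hyx⟩

/-- An isomorphism of cochain complexes induces isomorphisms in cohomology. -/
theorem exists_isInducedBy (hK : K.IsComplex) {Φ : ∀ N, K.C N ≃ₗ[R] K'.C N} (h : CommutesWithD Φ) :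
    ∃ φ : ∀ N, K.Cohomology N ≃ₗ[R] K'.Cohomology N, IsInducedBy φ Φ := by
  have h' := h.symm hK
  refine ⟨fun N => Submodule.Quotient.equiv _ _ (cocyclesEquiv h h' N) ?_, ?_⟩
  · ext y
    constructor
    · rintro ⟨x, hx, rfl⟩
      exact h.map_coboundaries (x := ⟨x.1, x.2.1⟩) hx
    · intro hy
      exact ⟨(cocyclesEquiv h h' N).symm y,
        h'.map_coboundaries (x := ⟨y.1, y.2.1⟩) hy, LinearEquiv.apply_symm_apply _ y⟩
  · intro N x y hxy
    obtain rfl : y = cocyclesEquiv h h' N x := Subtype.ext hxy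
    rfl

end CochainSystem

section complexes

open CochainSystem

variable (R A L' L'' : Type*) [CommRing R] [CommRing A] [Algebra R A]
  [LieRing L'] [LieAlgebra R L'] [Module A L'] [LieRingModule L' A] [LieRinehartRing A L']
  [LieRinehartAlgebra R A L']
  [LieRing L''] [LieAlgebra R L''] [Module A L''] [LieRingModule L'' A] [LieRinehartRing A L'']
  [LieRinehartAlgebra R A L'']
  [LieRingModule L' L''] [LieModule R L' L''] [LieRinehartModule A L' L'']
  [LieRingModule L'' L'] [LieModule R L'' L'] [LieRinehartModule A L'' L']

theorem lieRinehartComplex_isComplex (L : Type*) [LieRing L] [LieAlgebra R L] [Module A L]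
    [LieRingModule L A] [LieRinehartRing A L] [LieRinehartAlgebra R A L] :
    (lieRinehartComplex R A L A).IsComplex := by
  intro N ω hω
  refine ⟨fun n hn => ?_, formsD_formsD ω⟩
  cases n with
  | zero => rfl
  | succ n =>
    have h0 : ω n = 0 := hω n (by omega)
    change ceLinear R (ω n) = 0
    rw [h0, map_zero]

variable {A L' L''} in
theorem biFormsD_mem {N : ℕ} {F : BiForms A L' L''} (hF : F ∈ biFormsDegree R A L' L'' N) :
    biFormsD R A L' L'' F ∈ biFormsDegree R A L' L'' (N + 1) := by
  intro p q hpq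
  have h1 : dPrimeOp R A L' L'' F p q = 0 := by
    cases p with
    | zero => rw [dPrimeOp_apply_zero]; rfl
    | succ p =>
      have h0 : F p q = 0 := hF p q (by omega)
      change dPrime R A L' L'' p q (F p q) = 0
      rw [h0, map_zero]
  have h2 : dDoublePrimeOp R A L' L'' F p q = 0 := by
    cases q with
    | zero => rfl
    | succ q =>
      have h0 : F p q = 0 := hF p q (by omega)
      change ceLinear R (F p q) = 0
      rw [h0, map_zero]
  rw [biFormsD_apply, Pi.add_apply, h1, Pi.smul_apply, h2, smul_zero, add_zero]

variable [IsTwilled A L' L'']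

variable {A L' L''} in
/-- The total differential squares to zero because the Lie-Rinehart differential of the twilled sum
does. -/
theorem biFormsD_biFormsD (F : BiForms A L' L'') :
    biFormsD R A L' L'' (biFormsD R A L' L'' F) = 0 := by
  refine toTwilledForms_injective (Eq.trans ?_ (map_zero _).symm)
  rw [← formsD_toTwilledForms, ← formsD_toTwilledForms, formsD_formsD]

theorem biFormsComplex_isComplex : (biFormsComplex R A L' L'').IsComplex :=
  fun _ F hF => ⟨biFormsD_mem R hF, biFormsD_biFormsD R F⟩

variable [Module.Finite A L'] [Module.Projective A L']

/-- The isomorphism of bigraded forms and cochains of the crossed product. -/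
noncomputable def dgEquiv (N : ℕ) :
    (biFormsComplex R A L' L'').C N ≃ₗ[R] (dgLieRinehartComplex R A L' L'').C N :=
  LinearEquiv.ofBijective (toDGCochains R A L' L'' N) (toDGCochains_bijective N)

/-- The isomorphism of bigraded forms and forms on the twilled sum. -/
noncomputable def twilledEquiv (N : ℕ) : (biFormsComplex R A L' L'').C N ≃ₗ[R]
    (lieRinehartComplex R A (TwilledSum A L' L'') A).C N :=
  LinearEquiv.ofBijective (toTwilledCochains R A L' L'' N) (toTwilledCochains_bijective R N)

theorem dgEquiv_commutesWithD : CommutesWithD (dgEquiv R A L' L'') := by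
  intro N F G h
  refine (dgD_toDGFun R F.1).trans ?_
  exact congrArg (fun H : BiForms A L' L'' => fun p => toDGFun p H) h

theorem twilledEquiv_commutesWithD : CommutesWithD (twilledEquiv R A L' L'') := by
  intro N F G h
  refine (formsD_toTwilledForms R F.1).trans ?_
  exact congrArg (fun H : BiForms A L' L'' => toTwilledForms H) h

/-- The standard complex of the crossed product inherits its complex property from bigraded
forms. -/
theorem dgLieRinehartComplex_isComplex : (dgLieRinehartComplex R A L' L'').IsComplex := by
  intro N f hf
  obtain ⟨F, hF⟩ := (dgEquiv R A L' L'' N).surjective ⟨f, hf⟩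
  obtain rfl : (dgEquiv R A L' L'' N F).1 = f := congrArg Subtype.val hF
  obtain ⟨h1, h2⟩ := biFormsComplex_isComplex R A L' L'' N F.1 F.2
  have e1 := dgEquiv_commutesWithD R A L' L'' N F ⟨_, h1⟩ rfl
  have e2 := dgEquiv_commutesWithD R A L' L'' (N + 1) ⟨_, h1⟩ 0 h2
  rw [map_zero] at e2
  rw [e1]
  exact ⟨Subtype.property _, e2⟩

end complexes

end

theorem theorem3p1 (R A L' L'' : Type*) [CommRing R] [CommRing A] [Algebra R A]
    -- the Lie-Rinehart algebras `(A, L')` and `(A, L'')`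
    [LieRing L'] [LieAlgebra R L'] [Module A L'] [LieRingModule L' A] [LieRinehartRing A L']
    [LieRinehartAlgebra R A L']
    [LieRing L''] [LieAlgebra R L''] [Module A L''] [LieRingModule L'' A] [LieRinehartRing A L'']
    [LieRinehartAlgebra R A L'']
    -- the mutual actions
    [LieRingModule L' L''] [LieModule R L' L''] [LieRinehartModule A L' L'']
    [LieRingModule L'' L'] [LieModule R L'' L'] [LieRinehartModule A L'' L']
    [IsTwilled A L' L'']
    [Module.Finite A L'] [Module.Projective A L'] [Module.Finite A L''] [Module.Projective A L''] :
    -- all three are cochain complexes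
    (biFormsComplex R A L' L'').IsComplex ∧
    (dgLieRinehartComplex R A L' L'').IsComplex ∧
    (lieRinehartComplex R A (TwilledSum A L' L'') A).IsComplex ∧
    -- the bigraded complex computes the differential graded Lie-Rinehart cohomology
    (∃ (Φ : ∀ N, (biFormsComplex R A L' L'').C N ≃ₗ[R] (dgLieRinehartComplex R A L' L'').C N)
      (φ : ∀ N, (biFormsComplex R A L' L'').Cohomology N ≃ₗ[R]
        (dgLieRinehartComplex R A L' L'').Cohomology N),
      (∀ N (F : (biFormsComplex R A L' L'').C N) (p q : ℕ) (x : Fin p → L') (v : Fin q → L''),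
        (Φ N F).1 p (fun i => HForm.const (x i)) q v = F.1 p q v x) ∧
      CochainSystem.CommutesWithD Φ ∧ CochainSystem.IsInducedBy φ Φ) ∧
    -- which is canonically isomorphic to the Lie-Rinehart cohomology of the twilled sum
    (∃ (Ψ : ∀ N, (dgLieRinehartComplex R A L' L'').C N ≃ₗ[R]
        (lieRinehartComplex R A (TwilledSum A L' L'') A).C N)
      (ψ : ∀ N, (dgLieRinehartComplex R A L' L'').Cohomology N ≃ₗ[R]
        (lieRinehartComplex R A (TwilledSum A L' L'') A).Cohomology N),
      (∀ N (f : (dgLieRinehartComplex R A L' L'').C N) (p q : ℕ) (x : Fin p → L')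
        (v : Fin q → L''),
        (Ψ N f).1 (p + q)
            (Fin.append (fun i => TwilledSum.inl (x i)) (fun j => TwilledSum.inr (v j))) =
          f.1 p (fun i => HForm.const (x i)) q v) ∧
      CochainSystem.CommutesWithD Ψ ∧ CochainSystem.IsInducedBy ψ Ψ) := by
  have hB := biFormsComplex_isComplex R A L' L''
  have hD := dgLieRinehartComplex_isComplex R A L' L''
  have hΦ := dgEquiv_commutesWithD R A L' L''
  have hΨ := (hΦ.symm hB).trans (twilledEquiv_commutesWithD R A L' L'')
  obtain ⟨φ, hφ⟩ := CochainSystem.exists_isInducedBy hB hΦ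
  obtain ⟨ψ, hψ⟩ := CochainSystem.exists_isInducedBy hD hΨ
  refine ⟨hB, hD, lieRinehartComplex_isComplex R A (TwilledSum A L' L''),
    ⟨dgEquiv R A L' L'', φ, fun N F p q x v => toDGFun_const F.1 x q v, hΦ, hφ⟩,
    ⟨_, ψ, fun N f p q x v => ?_, hΨ, hψ⟩⟩
  obtain ⟨F, rfl⟩ := (dgEquiv R A L' L'' N).surjective f
  rw [LinearEquiv.trans_apply, LinearEquiv.symm_apply_apply]
  exact (toTwilledForms_appendTwilled F.1 x v).trans (toDGFun_const F.1 x q v).symm
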